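/- Let $\nu$ be a compactly supported probability measure on $\mathbb R$, the law of a bounded self-adjoint element $y_0$ of a tracial $W^*$-probability space $(\mathscr A,\tau)$, so that $\tau(y_0^n)=\int x^n\,d\nu(x)$. Fix $r\in(0,2]$; if $r=2$, assume that $\nu$ is not a Dirac measure. For $s>0$ put $t=rs$, let $\tilde\sigma_{s-t/2}$ be a semicircular element of variance $s-t/2$ freely independent of $y_0$, and put $x_0=y_0+\tilde\sigma_{s-t/2}$. Notation. For a self-adjoint element $x$ with law $\mu$, for $\rho\in\mathbb R$ and $u>0$, let $$G_x(z)=\int\frac{d\mu(y)}{z-y},\qquad H_{x,\rho}(z)=z+\rho\,G_x(z),\qquad v_{x,u}(a)=\inf\Big\{v>0:\int\frac{d\mu(y)}{(a-y)^2+v^2}\le\frac1u\Big\},$$ $$\Lambda_{x,u}=\{a+ib:|b|<v_{x,u}(a)\},\qquad \Omega_{x,u}=\big[H_{x,-u}(\Lambda_{x,u}^c)\big]^c,$$ and let $b_{x,u}(a)=2v_{x,u}(a_0)$, where $a_0$ is the unique real number with $\mathrm{Re}\,H_{x,-u}(a_0+iv_{x,u}(a_0))=a$. Put $\Omega_{s,t}=\Omega_{x_0,t/2}$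 and $b_{s,t}=b_{x_0,t/2}$ (the domain of the Brown measure of $y_0+\tilde\sigma_{s-t/2}+i\sigma_{t/2}$ and its boundary function). Let $a_{s,t}(\alpha)=\mathrm{Re}\,H_{y_0,s-t}(\alpha+iv_{y_0,s}(\alpha))$ and $U_{s,t}(\alpha+i\beta)=a_{s,t}(\alpha)+i\frac ts\beta$. A function on $\mathbb R$ is unimodal if it is nondecreasing up to some point and nonincreasing from that point on. Then the following hold. 1. Let $D_\nu=\sup\{|x-y|:x,y\in\mathrm{supp}\,\nu\}$. If $s\ge 4D_\nu^2$ (and $s>0$), then $b_{s,t}$ is unimodal, and $\Omega_{s,t}\cap\mathbb R$ is a (nonempty) interval. 2. For every $c>1$ there is $s_0$ such that for all $s\ge s_0$ the set $\Omega_{s,t}\cap\mathbb R$ is nonempty and bounded, $$\Big|\sup(\Omega_{s,t}\cap\mathbb R)-\Big(\tau(y_0)+\frac{2s-t}{\sqrt s}\Big)\Big|<\frac{c(3r+2|1-r|)\tau(y_0^2)}{2\sqrt s},$$ $$\Big|\inf(\Omega_{s,t}\cap\mathbb R)-\Big(\tau(y_0)-\frac{2s-t}{\sqrt s}\Big)\Big|<\frac{c(3r+2|1-r|)\tau(y_0^2)}{2\sqrt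 s}$$ (with $\le$ in place of $<$ when $\nu=\delta_0$), and $$\Omega_{s,t}\cap\mathbb R\subset\Big(\tau(y_0)-\frac{2s-t}{\sqrt s}-\frac{c(3r+2|1-r|)\tau(y_0^2)}{2\sqrt s},\ \tau(y_0)+\frac{2s-t}{\sqrt s}+\frac{c(3r+2|1-r|)\tau(y_0^2)}{2\sqrt s}\Big).$$ 3. For every $\varphi_0\in(0,\pi/2)$ there is $s_0$ such that for all $s\ge s_0$ and all $\varphi\in(0,\pi)$ with $|\cos\varphi|\le\cos\varphi_0$ there is a unique $\alpha\in\mathbb R$ with $$H_{y_0,s}(\alpha+iv_{y_0,s}(\alpha))=\tau(y_0)+2\sqrt s\cos\varphi ;$$ the point $U_{s,t}(\alpha+iv_{y_0,s}(\alpha))$ is the point $a+ib_{s,t}(a)$, $a=a_{s,t}(\alpha)$, of the boundary curve of $\Omega_{s,t}$, and $$\Big|U_{s,t}(\alpha+iv_{y_0,s}(\alpha))-\Big[\tau(y_0)+\frac{2s-t}{\sqrt s}\cos\varphi+i\frac t{\sqrt s}\sin\varphi\Big]\Big|<\frac{r\,\tau(y_0^2)}{(\sin\varphi_0)\sqrt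 s}$$ (with $\le$ in place of $<$ when $\nu=\delta_0$). -/

import Mathlib

open MeasureTheory Filter Set

universe u

/-! ### Free independence and the law of a free sum -/

/-- A tracial state on a unital C*-algebra. The algebras with a normal faithful tracial state
(W*-probability spaces) are special cases; normality and faithfulness are not needed here. -/
structure IsTracialState {A : Type u} [CStarAlgebra A] (τ : A →L[ℂ] ℂ) : Prop where
  map_one : τ 1 = 1
  nonneg : ∀ a : A, 0 ≤ (τ (star a * a)).re ∧ (τ (star a * a)).im = 0
  trace : ∀ a b : A, τ (a * b) = τ (b * a)

/-- Free independence of a family of star-subalgebras: `τ` vanishes on every alternating product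
`a₁ a₂ ⋯ aₙ` (`n ≥ 1`) of centered elements, neighbours being taken from different subalgebras. -/
def IsFreeFamily {A : Type u} [CStarAlgebra A] (τ : A →L[ℂ] ℂ) {ι : Type}
    (S : ι → StarSubalgebra ℂ A) : Prop :=
  ∀ l : List (ι × A), l ≠ [] → l.IsChain (fun p q => p.1 ≠ q.1) →
    (∀ p ∈ l, p.2 ∈ S p.1 ∧ τ p.2 = 0) → τ (l.map Prod.snd).prod = 0

/-- Two elements are freely independent if the unital star-algebras they generate are. -/
def AreFree {A : Type u} [CStarAlgebra A] (τ : A →L[ℂ] ℂ) (a b : A) : Prop :=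
  IsFreeFamily τ (fun i : Bool => StarAlgebra.adjoin ℂ {if i then a else b})

/-- `μ` is the law of the self-adjoint element `a`: the unique compactly supported probability
measure on `ℝ` with the same moments. -/
structure IsLaw {A : Type u} [CStarAlgebra A] (τ : A →L[ℂ] ℂ) (a : A) (μ : Measure ℝ) : Prop where
  isProbabilityMeasure : IsProbabilityMeasure μ
  isCompact_support : IsCompact μ.support
  moment : ∀ n : ℕ, τ (a ^ n) = ((∫ x, x ^ n ∂μ : ℝ) : ℂ)

/-- `μ` is the free convolution of `ν` and `η`, i.e. the law of `a + b` where `a`, `b` are freely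
independent self-adjoint elements with laws `ν` and `η`. -/
def IsFreeConvolution (ν η μ : Measure ℝ) : Prop :=
  ∃ (A : Type u) (_ : CStarAlgebra A) (τ : A →L[ℂ] ℂ) (a b : A),
    IsTracialState τ ∧ IsSelfAdjoint a ∧ IsSelfAdjoint b ∧ AreFree τ a b ∧
      IsLaw τ a ν ∧ IsLaw τ b η ∧ IsLaw τ (a + b) μ

/-- The semicircle law of variance `c ≥ 0`, with density `√(4c - x²) / (2πc)` on `[-2√c, 2√c]`
(`Real.sqrt` vanishes outside this interval); for `c = 0` it is the Dirac mass at `0`. -/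
noncomputable def semicircleLaw (c : ℝ) : Measure ℝ :=
  if c = 0 then Measure.dirac 0
  else volume.withDensity
    (fun x : ℝ => ENNReal.ofReal (Real.sqrt (4 * c - x ^ 2) / (2 * Real.pi * c)))

/-! ### The functions `G`, `H`, `v` and the domains -/

/-- The Cauchy transform `G(z) = ∫ (z - x)⁻¹ dμ(x)`. -/
noncomputable def cauchyTransform (μ : Measure ℝ) (z : ℂ) : ℂ :=
  ∫ x : ℝ, (z - (x : ℂ))⁻¹ ∂μ

/-- `H_ρ(z) = z + ρ G(z)`, for any real `ρ` (possibly negative). -/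
noncomputable def bianeH (μ : Measure ℝ) (ρ : ℝ) (z : ℂ) : ℂ :=
  z + (ρ : ℂ) * cauchyTransform μ z

/-- The function `v_t` of a law `μ`. The integral below decreases in `v`, so `v_t(a)` is the unique
`v > 0` with `∫ dμ(x) / ((a - x)² + v²) = 1/t` if `∫ dμ(x) / (a - x)² > 1/t`, and `0` otherwise. -/
noncomputable def bianeV (μ : Measure ℝ) (t a : ℝ) : ℝ :=
  sInf {v : ℝ | 0 < v ∧ ∫ x : ℝ, 1 / ((a - x) ^ 2 + v ^ 2) ∂μ ≤ 1 / t}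

/-- The point `a + i v_t(a)`. -/
noncomputable def bianePoint (μ : Measure ℝ) (t a : ℝ) : ℂ :=
  (a : ℂ) + (bianeV μ t a : ℂ) * Complex.I

/-- `Λ_t = {a + ib : |b| < v_t(a)}`, the domain of `x₀ + c_t`, where `μ` is the law of `x₀` and
`c_t` is circular. -/
def circularDomain (μ : Measure ℝ) (t : ℝ) : Set ℂ :=
  {z : ℂ | |z.im| < bianeV μ t z.re}

/-- `[H_{-t}(Λ_tᶜ)]ᶜ`, the domain of `x₀ + i σ_t`, where `μ` is the law of `x₀`. -/
def skewDomain (μ : Measure ℝ) (t : ℝ) : Set ℂ :=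
  (bianeH μ (-t) '' (circularDomain μ t)ᶜ)ᶜ

/-- `a_t(a₀) = Re H_{-t}(a₀ + i v_t(a₀))`, a homeomorphism of `ℝ` if `μ` is not a Dirac mass. -/
noncomputable def skewRe (μ : Measure ℝ) (t a₀ : ℝ) : ℝ :=
  (bianeH μ (-t) (bianePoint μ t a₀)).re

/-- The boundary function of `skewDomain μ t`: `b_t(a) = 2 v_t(a₀)`, with `a₀` the point that
`skewRe μ t` maps to `a`. -/
noncomputable def skewB (μ : Measure ℝ) (t a : ℝ) : ℝ :=
  2 * bianeV μ t (Function.invFun (skewRe μ t) a)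

/-! In the next two definitions `μ` is the law of `x₀ = y₀ + σ̃_{s - t/2}`. -/

/-- The domain `Ω_{s,t}` of `y₀ + σ̃_{s - t/2} + i σ_{t/2} = x₀ + i σ_{t/2}`. -/
def ellipticDomain (μ : Measure ℝ) (t : ℝ) : Set ℂ :=
  skewDomain μ (t / 2)

/-- The boundary function `b_{s,t}` of `Ω_{s,t}`. -/
noncomputable def ellipticB (μ : Measure ℝ) (t : ℝ) : ℝ → ℝ :=
  skewB μ (t / 2)

/-! In the next two definitions `ν` is the law of `y₀`. -/

/-- `a_{s,t}(α) = Re H_{s-t}(α + i v_s(α))`. -/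
noncomputable def ellipticRe (ν : Measure ℝ) (s t α : ℝ) : ℝ :=
  (bianeH ν (s - t) (bianePoint ν s α)).re

/-- `U_{s,t}(α + iβ) = a_{s,t}(α) + i (t/s) β`. -/
noncomputable def ellipticU (ν : Measure ℝ) (s t : ℝ) (z : ℂ) : ℂ :=
  (ellipticRe ν s t z.re : ℂ) + ((t * z.im / s : ℝ) : ℂ) * Complex.I

/-- The trace of a set on the real line, `Ω ∩ ℝ`. -/
def realTrace (Ω : Set ℂ) : Set ℝ :=
  {x : ℝ | (x : ℂ) ∈ Ω}

/-- A function on `ℝ` is unimodal if it is nondecreasing up to some point and nonincreasing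
from this point on. -/
def IsUnimodal (f : ℝ → ℝ) : Prop :=
  ∃ m : ℝ, MonotoneOn f (Iic m) ∧ AntitoneOn f (Ici m)

/-! Everything is reduced to the single function `bianeV ν s` of the initial law. Put `c = s - t/2`.
Freeness gives the subordination identity `G_μ(H_{ν,c}(z)) = G_ν(z)` near infinity. It is obtained
from the traces of resolvents and the explicit inverse `g ↦ c g + 1/g` of the semicircular Cauchy
transform (`IsFreeConvolution.eventually_cauchyTransform_eq`). The identity theorem carries it to
the region above the graph of `v_{ν,s}`, and a Lipschitz bound carries it to the graph itself
(`subordination_boundary`). There `H_{ν,c}` sends the graph of `v_{ν,s}` to the graph of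
`v_{μ,t/2}`, multiplying heights by `(s-c)/s`. Composing with `H_{μ,-t/2}` gives `H_{ν,s-t}`, since
`c - t/2 = s - t`. Hence `b_{s,t}(a_{s,t}(α)) = (t/s) v_{ν,s}(α)`, and the real trace is
`a_{s,t}({v_{ν,s} > 0})` (`IsFreeConvolution.elliptic`).

This uses that `a_{s,t}` is an increasing bijection of the line. On the graph, `G` is
`1/s`-Lipschitz with `Im G = -v/s`, so its real part has increments at most `(b-a)/s` in absolute
value. The equality cases are conjugate points or a Dirac law (`strictMono_bianeRe`).

Unimodality: the kernel `1/(x² + v²)` is concave for `3x² ≤ v²`. If `s` is large against the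
diameter, every superlevel set of `v_{ν,s}` is therefore an interval
(`one_div_lt_kernelIntegral_of_between`).

Endpoints: at the right end `a` of `{v_{ν,s} > 0}` one has `∫ (a-x)⁻² dν = 1/s`. Expanding about the
mean, where the linear term vanishes, gives `a_{s,t}(a) = τ(y₀) + (2-r)√s + (1+r/2) Var/√s + ⋯`. The
left end follows by reflection.

Boundary curve: as `G(z) ≈ 1/(z-m)` with `m = τ(y₀)`, the equation `H_s(z) = m + 2√s cos φ` is a
perturbed quadratic for `z - m` with roots `√s e^{±iφ}`. The upper half-plane selects one root, and
the error is of order `Var/(√s sin φ)` (`norm_bianePoint_sub_le`). -/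

open scoped Topology ComplexConjugate

/-! ### The kernel integral and the function `bianeV` -/

/-- The integral `∫ dμ(x) / ((a - x)² + v²)` entering the definition of `bianeV`. -/
noncomputable def kernelIntegral (μ : Measure ℝ) (a v : ℝ) : ℝ :=
  ∫ x : ℝ, 1 / ((a - x) ^ 2 + v ^ 2) ∂μ

section Kernel

variable {μ : Measure ℝ}

lemma kernel_nonneg (a v x : ℝ) : 0 ≤ 1 / ((a - x) ^ 2 + v ^ 2) := by positivity

lemma kernel_le {v : ℝ} (hv : 0 < v) (a x : ℝ) : 1 / ((a - x) ^ 2 + v ^ 2) ≤ 1 / v ^ 2 :=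
  one_div_le_one_div_of_le (by positivity) (by nlinarith [sq_nonneg (a - x)])

lemma measurable_kernel (a v : ℝ) : Measurable fun x : ℝ => 1 / ((a - x) ^ 2 + v ^ 2) := by
  fun_prop

lemma kernelIntegral_nonneg (a v : ℝ) : 0 ≤ kernelIntegral μ a v :=
  integral_nonneg fun x => kernel_nonneg a v x

lemma bianeV_nonneg (t a : ℝ) : 0 ≤ bianeV μ t a :=
  Real.sInf_nonneg fun _ hv => hv.1.le

lemma bianeV_set_bddBelow (t a : ℝ) :
    BddBelow {v : ℝ | 0 < v ∧ ∫ x : ℝ, 1 / ((a - x) ^ 2 + v ^ 2) ∂μ ≤ 1 / t} :=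
  ⟨0, fun _ hv => hv.1.le⟩

variable [IsProbabilityMeasure μ]

lemma integrable_kernel {v : ℝ} (hv : 0 < v) (a : ℝ) :
    Integrable (fun x : ℝ => 1 / ((a - x) ^ 2 + v ^ 2)) μ := by
  refine Integrable.of_bound (measurable_kernel a v).aestronglyMeasurable (1 / v ^ 2) ?_
  refine Eventually.of_forall fun x => ?_
  rw [Real.norm_of_nonneg (kernel_nonneg a v x)]
  exact kernel_le hv a x

lemma kernelIntegral_le {v : ℝ} (hv : 0 < v) (a : ℝ) : kernelIntegral μ a v ≤ 1 / v ^ 2 := by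
  have := integral_mono (integrable_kernel (μ := μ) hv a) (integrable_const (1 / v ^ 2))
    (fun x => kernel_le hv a x)
  simpa [kernelIntegral] using this

lemma kernelIntegral_strictAnti {v w : ℝ} (hv : 0 < v) (hvw : v < w) (a : ℝ) :
    kernelIntegral μ a w < kernelIntegral μ a v := by
  have hw : 0 < w := hv.trans hvw
  rw [← sub_pos, kernelIntegral, kernelIntegral,
    ← integral_sub (integrable_kernel hv a) (integrable_kernel hw a)]
  have hpos : ∀ x : ℝ, 0 < 1 / ((a - x) ^ 2 + v ^ 2) - 1 / ((a - x) ^ 2 + w ^ 2) := fun x => by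
    rw [sub_pos]
    exact one_div_lt_one_div_of_lt (by positivity) (by nlinarith)
  rw [integral_pos_iff_support_of_nonneg (fun x => (hpos x).le)
    ((integrable_kernel hv a).sub (integrable_kernel hw a))]
  have : Function.support
      (fun x : ℝ => 1 / ((a - x) ^ 2 + v ^ 2) - 1 / ((a - x) ^ 2 + w ^ 2)) = univ := by
    ext x; simpa using (hpos x).ne'
  rw [this]; simp

lemma kernelIntegral_anti {v w : ℝ} (hv : 0 < v) (hvw : v ≤ w) (a : ℝ) :
    kernelIntegral μ a w ≤ kernelIntegral μ a v := by
  rcases hvw.eq_or_lt with rfl | h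
  · exact le_rfl
  · exact (kernelIntegral_strictAnti hv h a).le

lemma continuousAt_kernelIntegral {v : ℝ} (hv : 0 < v) (a : ℝ) :
    ContinuousAt (fun p : ℝ × ℝ => kernelIntegral μ p.1 p.2) (a, v) := by
  refine continuousAt_of_dominated (bound := fun _ => 1 / (v / 2) ^ 2) ?_ ?_ (integrable_const _) ?_
  · exact Eventually.of_forall fun p => (measurable_kernel p.1 p.2).aestronglyMeasurable
  · have : ∀ᶠ p : ℝ × ℝ in 𝓝 (a, v), v / 2 < p.2 :=
      continuousAt_snd.eventually_const_lt (by simpa using half_lt_self hv)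
    filter_upwards [this] with p hp
    refine Eventually.of_forall fun x => ?_
    rw [Real.norm_of_nonneg (kernel_nonneg _ _ x)]
    refine (kernel_le (by linarith) _ x).trans ?_
    exact one_div_le_one_div_of_le (by positivity) (by nlinarith)
  · refine Eventually.of_forall fun x => ?_
    have : (a - x) ^ 2 + v ^ 2 ≠ 0 := by positivity
    exact ContinuousAt.div (by fun_prop) (by fun_prop) this

lemma kernelIntegral_sqrt_le {t : ℝ} (ht : 0 < t) (a : ℝ) : kernelIntegral μ a √t ≤ 1 / t := by
  simpa [Real.sq_sqrt ht.le] using kernelIntegral_le (μ := μ) (Real.sqrt_pos.2 ht) a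

/-- The kernel integral is decreasing and continuous in the height, so the infimum defining `bianeV`
is attained whenever it is positive. This dictionary replaces most arguments about `bianeV` by
inequalities between integrals. -/
lemma kernelIntegral_le_iff {t : ℝ} (ht : 0 < t) {v : ℝ} (hv : 0 < v) (a : ℝ) :
    kernelIntegral μ a v ≤ 1 / t ↔ bianeV μ t a ≤ v := by
  constructor
  · intro h
    exact csInf_le (bianeV_set_bddBelow t a) ⟨hv, h⟩
  · intro h
    have key : ∀ w, v < w → kernelIntegral μ a w ≤ 1 / t := fun w hw => by
      obtain ⟨u, hu, huw⟩ := exists_lt_of_csInf_lt (s := {v : ℝ | 0 < v ∧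
        ∫ x : ℝ, 1 / ((a - x) ^ 2 + v ^ 2) ∂μ ≤ 1 / t})
        ⟨√t, Real.sqrt_pos.2 ht, kernelIntegral_sqrt_le ht a⟩ (h.trans_lt hw)
      exact (kernelIntegral_anti hu.1 huw.le a).trans hu.2
    have hc : Tendsto (fun w => kernelIntegral μ a w) (𝓝[>] v) (𝓝 (kernelIntegral μ a v)) := by
      have := (continuousAt_kernelIntegral (μ := μ) hv a).tendsto.comp
        (show Tendsto (fun w : ℝ => (a, w)) (𝓝 v) (𝓝 (a, v)) by
          exact (Continuous.prodMk_right a).tendsto v)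
      exact this.mono_left nhdsWithin_le_nhds
    exact le_of_tendsto hc (eventually_mem_nhdsWithin.mono key)

lemma lt_kernelIntegral_iff {t : ℝ} (ht : 0 < t) {v : ℝ} (hv : 0 < v) (a : ℝ) :
    1 / t < kernelIntegral μ a v ↔ v < bianeV μ t a := by
  rw [← not_le, kernelIntegral_le_iff ht hv, not_le]

lemma continuous_kernelIntegral_left {v : ℝ} (hv : 0 < v) :
    Continuous fun a => kernelIntegral μ a v :=
  continuous_iff_continuousAt.2 fun a =>
    ContinuousAt.comp (f := fun b : ℝ => (b, v)) (continuousAt_kernelIntegral (μ := μ) hv a)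
      (by fun_prop)

lemma continuousAt_kernelIntegral_right {v : ℝ} (hv : 0 < v) (a : ℝ) :
    ContinuousAt (fun w => kernelIntegral μ a w) v :=
  (continuousAt_kernelIntegral (μ := μ) hv a).comp
    (Continuous.prodMk_right a).continuousAt

lemma kernelIntegral_bianeV {t : ℝ} (ht : 0 < t) {a : ℝ} (h : 0 < bianeV μ t a) :
    kernelIntegral μ a (bianeV μ t a) = 1 / t := by
  refine le_antisymm ((kernelIntegral_le_iff ht h a).2 le_rfl) ?_
  have hc : Tendsto (fun w => kernelIntegral μ a w) (𝓝[<] bianeV μ t a)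
      (𝓝 (kernelIntegral μ a (bianeV μ t a))) :=
    (continuousAt_kernelIntegral_right h a).tendsto.mono_left nhdsWithin_le_nhds
  refine ge_of_tendsto hc ?_
  filter_upwards [eventually_mem_nhdsWithin, mem_nhdsWithin_of_mem_nhds (lt_mem_nhds h)]
    with w hw hw0
  exact ((lt_kernelIntegral_iff ht hw0 a).2 hw).le

lemma kernelIntegral_lt_iff {t : ℝ} (ht : 0 < t) {v : ℝ} (hv : 0 < v) (a : ℝ) :
    kernelIntegral μ a v < 1 / t ↔ bianeV μ t a < v := by
  constructor
  · intro h
    refine lt_of_le_of_ne ((kernelIntegral_le_iff ht hv a).1 h.le) fun he => ?_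
    have := kernelIntegral_bianeV (μ := μ) ht (a := a) (he ▸ hv)
    rw [he] at this
    exact h.ne this
  · intro h
    obtain ⟨w, hw, hwv⟩ := exists_between h
    have hw0 : 0 < w := (bianeV_nonneg t a).trans_lt hw
    exact (kernelIntegral_strictAnti hw0 hwv a).trans_le ((kernelIntegral_le_iff ht hw0 a).2 hw.le)

lemma bianeV_eq_of_kernelIntegral_eq {t : ℝ} (ht : 0 < t) {v : ℝ} (hv : 0 < v) {a : ℝ}
    (h : kernelIntegral μ a v = 1 / t) : bianeV μ t a = v := by
  refine le_antisymm ((kernelIntegral_le_iff ht hv a).1 h.le) (not_lt.1 fun h' => ?_)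
  exact ((kernelIntegral_lt_iff ht hv a).2 h').ne h

lemma bianeV_eq_zero_of_forall {t : ℝ} (ht : 0 < t) {a : ℝ}
    (h : ∀ v, 0 < v → kernelIntegral μ a v ≤ 1 / t) : bianeV μ t a = 0 :=
  le_antisymm (le_of_forall_pos_le_add fun v hv => by
    simpa using (kernelIntegral_le_iff ht hv a).1 (h v hv)) (bianeV_nonneg t a)

lemma bianeV_le_sqrt {t : ℝ} (ht : 0 < t) (a : ℝ) : bianeV μ t a ≤ √t :=
  (kernelIntegral_le_iff ht (Real.sqrt_pos.2 ht) a).1 (kernelIntegral_sqrt_le ht a)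

lemma continuous_bianeV {t : ℝ} (ht : 0 < t) : Continuous (bianeV μ t) := by
  refine continuous_iff_continuousAt.2 fun a => tendsto_order.2 ⟨fun v hv => ?_, fun v hv => ?_⟩
  · rcases lt_or_ge v 0 with h0 | h0
    · exact Eventually.of_forall fun b => h0.trans_le (bianeV_nonneg t b)
    obtain ⟨w, hvw, hw⟩ := exists_between hv
    have hw0 : 0 < w := h0.trans_lt hvw
    have := (continuous_kernelIntegral_left (μ := μ) hw0).continuousAt.eventually_const_lt
      ((lt_kernelIntegral_iff ht hw0 a).2 hw)
    filter_upwards [this] with b hb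
    exact hvw.trans ((lt_kernelIntegral_iff ht hw0 b).1 hb)
  · have hv0 : 0 < v := (bianeV_nonneg t a).trans_lt hv
    have := (continuous_kernelIntegral_left (μ := μ) hv0).continuousAt.eventually_lt_const
      ((kernelIntegral_lt_iff ht hv0 a).2 hv)
    filter_upwards [this] with b hb
    exact (kernelIntegral_lt_iff ht hv0 b).1 hb

end Kernel

/-! ### The Cauchy transform on the region above the graph of `bianeV` -/

/-- The closed region above the graph of `bianeV μ t`. -/
def upperRegion (μ : Measure ℝ) (t : ℝ) : Set ℂ :=
  {z : ℂ | bianeV μ t z.re ≤ z.im}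

lemma normSq_sub_ofReal (z : ℂ) (x : ℝ) :
    ‖z - (x : ℂ)‖ ^ 2 = (z.re - x) ^ 2 + z.im ^ 2 := by
  rw [← Complex.normSq_eq_norm_sq, Complex.normSq_apply]; simp; ring

lemma norm_sq_inv_sub_ofReal (z : ℂ) (x : ℝ) :
    ‖(z - (x : ℂ))⁻¹‖ ^ 2 = 1 / ((z.re - x) ^ 2 + z.im ^ 2) := by
  rw [norm_inv, inv_pow, normSq_sub_ofReal, one_div]

lemma measurable_inv_sub_ofReal (z : ℂ) : Measurable fun x : ℝ => (z - (x : ℂ))⁻¹ := by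
  fun_prop

lemma sub_ofReal_ne_zero {z : ℂ} (hz : z.im ≠ 0) (x : ℝ) : z - (x : ℂ) ≠ 0 := fun h => by
  apply hz; simpa using congrArg Complex.im h

lemma norm_inv_sub_ofReal_le {z : ℂ} (hz : z.im ≠ 0) (x : ℝ) :
    ‖(z - (x : ℂ))⁻¹‖ ≤ 1 / |z.im| := by
  rw [norm_inv, ← one_div]
  refine one_div_le_one_div_of_le (abs_pos.2 hz) ?_
  simpa using Complex.abs_im_le_norm (z - (x : ℂ))

lemma integrable_inv_sub_ofReal {μ : Measure ℝ} [IsProbabilityMeasure μ] {z : ℂ}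
    (hz : z.im ≠ 0) : Integrable (fun x : ℝ => (z - (x : ℂ))⁻¹) μ :=
  Integrable.of_bound (measurable_inv_sub_ofReal z).aestronglyMeasurable (1 / |z.im|)
    (Eventually.of_forall fun x => norm_inv_sub_ofReal_le hz x)

lemma im_cauchyTransform (μ : Measure ℝ) [IsProbabilityMeasure μ] (z : ℂ) :
    (cauchyTransform μ z).im = -z.im * kernelIntegral μ z.re z.im := by
  by_cases hz : z.im = 0
  · have : cauchyTransform μ z = ((∫ x : ℝ, (z.re - x)⁻¹ ∂μ : ℝ) : ℂ) := by
      rw [cauchyTransform, ← integral_complex_ofReal]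
      congr 1 with x
      have : z = (z.re : ℂ) := by apply Complex.ext <;> simp [hz]
      rw [this]; push_cast; simp
    rw [this, hz]; simp
  · rw [cauchyTransform, ← Complex.imCLM_apply, ← ContinuousLinearMap.integral_comp_comm _
      (integrable_inv_sub_ofReal hz), kernelIntegral, ← integral_const_mul]
    congr 1 with x
    rw [Complex.imCLM_apply, Complex.inv_im, Complex.normSq_eq_norm_sq, normSq_sub_ofReal]
    simp [div_eq_mul_inv]

lemma im_bianeH (μ : Measure ℝ) [IsProbabilityMeasure μ] (ρ : ℝ) (z : ℂ) :
    (bianeH μ ρ z).im = z.im * (1 - ρ * kernelIntegral μ z.re z.im) := by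
  simp [bianeH, im_cauchyTransform]; ring

lemma re_bianePoint (μ : Measure ℝ) (t a : ℝ) : (bianePoint μ t a).re = a := by simp [bianePoint]

lemma im_bianePoint (μ : Measure ℝ) (t a : ℝ) : (bianePoint μ t a).im = bianeV μ t a := by
  simp [bianePoint]

lemma bianePoint_mem_upperRegion (μ : Measure ℝ) (t a : ℝ) :
    bianePoint μ t a ∈ upperRegion μ t := by
  simp [upperRegion, re_bianePoint, im_bianePoint]

lemma im_nonneg_of_mem_upperRegion {μ : Measure ℝ} {t : ℝ} {z : ℂ} (hz : z ∈ upperRegion μ t) :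
    0 ≤ z.im := (bianeV_nonneg t z.re).trans hz

/-- The integral `∫ dμ(x) / ((z - x)(w - x))`. -/
noncomputable def productKernel (μ : Measure ℝ) (z w : ℂ) : ℂ :=
  ∫ x : ℝ, (z - (x : ℂ))⁻¹ * (w - (x : ℂ))⁻¹ ∂μ

/-- The real part of `H_ρ` along the graph of `v_t`. -/
noncomputable def bianeRe (μ : Measure ℝ) (t ρ a : ℝ) : ℝ := (bianeH μ ρ (bianePoint μ t a)).re

lemma bianeRe_eq (μ : Measure ℝ) (t ρ a : ℝ) :
    bianeRe μ t ρ a = a + ρ * (cauchyTransform μ (bianePoint μ t a)).re := by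
  simp [bianeRe, bianeH, re_bianePoint]

lemma not_conj_bianePoint_eq {μ : Measure ℝ} {t a b : ℝ} (hab : a < b) :
    conj (bianePoint μ t a) ≠ bianePoint μ t b := fun h => by
  have := congrArg Complex.re h
  rw [Complex.conj_re, re_bianePoint, re_bianePoint] at this
  exact hab.ne this

lemma bianePoint_sub_ne_zero {μ : Measure ℝ} {t a b : ℝ} (hab : a < b) :
    bianePoint μ t b - bianePoint μ t a ≠ 0 := fun h => by
  have := congrArg Complex.re h
  simp only [Complex.sub_re, re_bianePoint, Complex.zero_re] at this
  linarith

section Region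

variable {μ : Measure ℝ} [IsProbabilityMeasure μ] {t : ℝ}

lemma isClosed_upperRegion (ht : 0 < t) : IsClosed (upperRegion μ t) :=
  isClosed_le ((continuous_bianeV ht).comp Complex.continuous_re) Complex.continuous_im

lemma im_cauchyTransform_bianePoint (ht : 0 < t) (a : ℝ) :
    (cauchyTransform μ (bianePoint μ t a)).im = -bianeV μ t a / t := by
  rw [im_cauchyTransform, re_bianePoint, im_bianePoint]
  rcases (bianeV_nonneg (μ := μ) t a).eq_or_lt with h | h
  · rw [← h]; simp
  · rw [kernelIntegral_bianeV ht h]; ring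

/-- Fatou's lemma brings the bound down from heights above the graph. Where `v_t` vanishes, `z` may
be a real point of the support, so the kernel is taken with value `∞` at a zero denominator;
finiteness then shows that `z` is not an atom. -/
lemma lintegral_kernel_le (ht : 0 < t) {z : ℂ} (hz : z ∈ upperRegion μ t) :
    ∫⁻ x : ℝ, (ENNReal.ofReal ((z.re - x) ^ 2 + z.im ^ 2))⁻¹ ∂μ ≤ ENNReal.ofReal (1 / t) := by
  set ε : ℕ → ℝ := fun n => 1 / ((n : ℝ) + 1) with hε
  have hε0 : ∀ n, 0 < ε n := fun n => by positivity
  have hlim : Tendsto ε atTop (𝓝 0) := tendsto_one_div_add_atTop_nhds_zero_nat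
  have hz0 := im_nonneg_of_mem_upperRegion hz
  have hpt : ∀ x : ℝ, Tendsto
      (fun n => (ENNReal.ofReal ((z.re - x) ^ 2 + (z.im + ε n) ^ 2))⁻¹) atTop
      (𝓝 (ENNReal.ofReal ((z.re - x) ^ 2 + z.im ^ 2))⁻¹) := fun x => by
    refine (ENNReal.tendsto_ofReal ?_).inv
    have : Tendsto (fun n => (z.re - x) ^ 2 + (z.im + ε n) ^ 2) atTop
        (𝓝 ((z.re - x) ^ 2 + (z.im + 0) ^ 2)) :=
      tendsto_const_nhds.add ((tendsto_const_nhds.add hlim).pow 2)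
    simpa using this
  have hn : ∀ n, ∫⁻ x : ℝ, (ENNReal.ofReal ((z.re - x) ^ 2 + (z.im + ε n) ^ 2))⁻¹ ∂μ
      ≤ ENNReal.ofReal (1 / t) := fun n => by
    have hpos : 0 < z.im + ε n := add_pos_of_nonneg_of_pos hz0 (hε0 n)
    have h1 : ∀ x : ℝ, (ENNReal.ofReal ((z.re - x) ^ 2 + (z.im + ε n) ^ 2))⁻¹
        = ENNReal.ofReal (1 / ((z.re - x) ^ 2 + (z.im + ε n) ^ 2)) := fun x => by
      rw [one_div, ENNReal.ofReal_inv_of_pos (by positivity)]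
    simp_rw [h1]
    rw [← ofReal_integral_eq_lintegral_ofReal (integrable_kernel hpos _)
      (Eventually.of_forall fun x => kernel_nonneg _ _ x)]
    refine ENNReal.ofReal_le_ofReal ((kernelIntegral_le_iff ht hpos _).2 ?_)
    exact le_trans hz (by linarith [hε0 n])
  calc ∫⁻ x : ℝ, (ENNReal.ofReal ((z.re - x) ^ 2 + z.im ^ 2))⁻¹ ∂μ
      = ∫⁻ x : ℝ, liminf
          (fun n => (ENNReal.ofReal ((z.re - x) ^ 2 + (z.im + ε n) ^ 2))⁻¹) atTop ∂μ := by
        congr 1 with x; exact (hpt x).liminf_eq.symm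
    _ ≤ liminf (fun n => ∫⁻ x : ℝ,
          (ENNReal.ofReal ((z.re - x) ^ 2 + (z.im + ε n) ^ 2))⁻¹ ∂μ) atTop :=
        lintegral_liminf_le fun n => by fun_prop
    _ ≤ ENNReal.ofReal (1 / t) := by
        refine (liminf_le_liminf (Eventually.of_forall hn)).trans ?_
        simp

lemma ae_ne_of_mem_upperRegion (ht : 0 < t) {z : ℂ} (hz : z ∈ upperRegion μ t) :
    ∀ᵐ x : ℝ ∂μ, z - (x : ℂ) ≠ 0 := by
  have hfin := ae_lt_top (μ := μ)
    (f := fun x : ℝ => (ENNReal.ofReal ((z.re - x) ^ 2 + z.im ^ 2))⁻¹) (by fun_prop)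
    ((lintegral_kernel_le ht hz).trans_lt ENNReal.ofReal_lt_top).ne
  filter_upwards [hfin] with x hx h0
  rw [← normSq_sub_ofReal, h0] at hx
  simp at hx

lemma integrable_norm_sq_of_mem_upperRegion (ht : 0 < t) {z : ℂ} (hz : z ∈ upperRegion μ t) :
    Integrable (fun x : ℝ => ‖(z - (x : ℂ))⁻¹‖ ^ 2) μ ∧
      ∫ x : ℝ, ‖(z - (x : ℂ))⁻¹‖ ^ 2 ∂μ ≤ 1 / t := by
  have hm : Measurable (fun x : ℝ => ‖(z - (x : ℂ))⁻¹‖ ^ 2) := by fun_prop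
  have hle : ∫⁻ x : ℝ, ENNReal.ofReal (‖(z - (x : ℂ))⁻¹‖ ^ 2) ∂μ ≤ ENNReal.ofReal (1 / t) := by
    refine le_trans (le_of_eq (lintegral_congr_ae ?_)) (lintegral_kernel_le ht hz)
    filter_upwards [ae_ne_of_mem_upperRegion ht hz] with x hx
    have : 0 < (z.re - x) ^ 2 + z.im ^ 2 := by
      rw [← normSq_sub_ofReal]; have := norm_pos_iff.2 hx; positivity
    rw [norm_sq_inv_sub_ofReal, one_div, ENNReal.ofReal_inv_of_pos this]
  have hi : Integrable (fun x : ℝ => ‖(z - (x : ℂ))⁻¹‖ ^ 2) μ := by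
    refine ⟨hm.aestronglyMeasurable, ?_⟩
    rw [hasFiniteIntegral_iff_ofReal (Eventually.of_forall fun x => by positivity)]
    exact hle.trans_lt ENNReal.ofReal_lt_top
  refine ⟨hi, ?_⟩
  rw [← ofReal_integral_eq_lintegral_ofReal hi (Eventually.of_forall fun x => by positivity)] at hle
  exact (ENNReal.ofReal_le_ofReal_iff (by positivity)).1 hle

lemma integrable_inv_of_mem_upperRegion (ht : 0 < t) {z : ℂ} (hz : z ∈ upperRegion μ t) :
    Integrable (fun x : ℝ => (z - (x : ℂ))⁻¹) μ := by
  refine Integrable.mono' ((integrable_norm_sq_of_mem_upperRegion ht hz).1.add (integrable_const 1))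
    (measurable_inv_sub_ofReal z).aestronglyMeasurable (Eventually.of_forall fun x => ?_)
  simp only [Pi.add_apply]
  nlinarith [sq_nonneg (‖(z - (x : ℂ))⁻¹‖ - 1)]

lemma integrable_mul_of_mem_upperRegion (ht : 0 < t) {z w : ℂ} (hz : z ∈ upperRegion μ t)
    (hw : w ∈ upperRegion μ t) :
    Integrable (fun x : ℝ => (z - (x : ℂ))⁻¹ * (w - (x : ℂ))⁻¹) μ := by
  refine Integrable.mono' ((integrable_norm_sq_of_mem_upperRegion ht hz).1.add
    (integrable_norm_sq_of_mem_upperRegion ht hw).1)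
    ((measurable_inv_sub_ofReal z).mul (measurable_inv_sub_ofReal w)).aestronglyMeasurable
    (Eventually.of_forall fun x => ?_)
  simp only [Pi.add_apply]
  rw [norm_mul]
  nlinarith [sq_nonneg (‖(z - (x : ℂ))⁻¹‖ - ‖(w - (x : ℂ))⁻¹‖), sq_nonneg ‖(z - (x : ℂ))⁻¹‖,
    sq_nonneg ‖(w - (x : ℂ))⁻¹‖]

lemma cauchyTransform_sub (ht : 0 < t) {z w : ℂ} (hz : z ∈ upperRegion μ t)
    (hw : w ∈ upperRegion μ t) :
    cauchyTransform μ z - cauchyTransform μ w = -(z - w) * productKernel μ z w := by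
  rw [cauchyTransform, cauchyTransform, ← integral_sub (integrable_inv_of_mem_upperRegion ht hz)
    (integrable_inv_of_mem_upperRegion ht hw), productKernel, ← integral_const_mul]
  refine integral_congr_ae ?_
  filter_upwards [ae_ne_of_mem_upperRegion ht hz, ae_ne_of_mem_upperRegion ht hw] with x h1 h2
  field_simp
  ring

/-- By `2|pq| ≤ |p|² + |q|²` and the defining bound of the region at both points. With the
difference quotient formula for `G` it makes `G` Lipschitz up to the graph, including points of the
real line. -/
lemma norm_productKernel_le (ht : 0 < t) {z w : ℂ} (hz : z ∈ upperRegion μ t)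
    (hw : w ∈ upperRegion μ t) : ‖productKernel μ z w‖ ≤ 1 / t := by
  obtain ⟨iz, lz⟩ := integrable_norm_sq_of_mem_upperRegion ht hz
  obtain ⟨iw, lw⟩ := integrable_norm_sq_of_mem_upperRegion ht hw
  have h1 : ‖productKernel μ z w‖
      ≤ ∫ x : ℝ, (‖(z - (x : ℂ))⁻¹‖ ^ 2 + ‖(w - (x : ℂ))⁻¹‖ ^ 2) / 2 ∂μ := by
    refine norm_integral_le_of_norm_le ((iz.add iw).div_const 2) (Eventually.of_forall fun x => ?_)
    rw [norm_mul]
    nlinarith [sq_nonneg (‖(z - (x : ℂ))⁻¹‖ - ‖(w - (x : ℂ))⁻¹‖)]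
  rw [integral_div, integral_add iz iw] at h1
  linarith

lemma norm_cauchyTransform_sub_le (ht : 0 < t) {z w : ℂ} (hz : z ∈ upperRegion μ t)
    (hw : w ∈ upperRegion μ t) :
    ‖cauchyTransform μ z - cauchyTransform μ w‖ ≤ 1 / t * ‖z - w‖ := by
  rw [cauchyTransform_sub ht hz hw, norm_mul, norm_neg, mul_comm]
  exact mul_le_mul_of_nonneg_right (norm_productKernel_le ht hz hw) (norm_nonneg _)

lemma norm_cauchyTransform_le (ht : 0 < t) {z : ℂ} (hz : z ∈ upperRegion μ t) :
    ‖cauchyTransform μ z‖ ≤ 1 / √t := by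
  obtain ⟨iz, lz⟩ := integrable_norm_sq_of_mem_upperRegion ht hz
  have hs : 0 < √t := Real.sqrt_pos.2 ht
  have h1 : ‖cauchyTransform μ z‖
      ≤ ∫ x : ℝ, (√t * ‖(z - (x : ℂ))⁻¹‖ ^ 2 + 1 / √t) / 2 ∂μ := by
    refine norm_integral_le_of_norm_le
      (((iz.const_mul _).add (integrable_const _)).div_const 2) (Eventually.of_forall fun x => ?_)
    have : 2 * ‖(z - (x : ℂ))⁻¹‖ ≤ √t * ‖(z - (x : ℂ))⁻¹‖ ^ 2 + 1 / √t := by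
      have : √t * ‖(z - (x : ℂ))⁻¹‖ ^ 2 + 1 / √t - 2 * ‖(z - (x : ℂ))⁻¹‖
          = (√t * ‖(z - (x : ℂ))⁻¹‖ - 1) ^ 2 / √t := by field_simp; ring
      have h2 : 0 ≤ (√t * ‖(z - (x : ℂ))⁻¹‖ - 1) ^ 2 / √t := by positivity
      linarith
    linarith
  rw [integral_div, integral_add (iz.const_mul _) (integrable_const _), integral_const_mul] at h1
  have h3 : √t * ∫ x : ℝ, ‖(z - (x : ℂ))⁻¹‖ ^ 2 ∂μ ≤ 1 / √t := by
    have h4 : √t * (1 / t) = 1 / √t := by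
      field_simp; rw [Real.sq_sqrt ht.le]
    rw [← h4]; exact mul_le_mul_of_nonneg_left lz hs.le
  simp only [integral_const, probReal_univ, one_smul] at h1
  linarith

lemma eq_dirac_of_ae_eq {μ : Measure ℝ} [IsProbabilityMeasure μ] {a : ℝ}
    (h : ∀ᵐ x ∂μ, x = a) : μ = Measure.dirac a := by
  have h0 : μ {a}ᶜ = 0 := h
  ext s hs
  by_cases ha : a ∈ s
  · rw [Measure.dirac_apply' _ hs, indicator_of_mem ha]
    have : μ sᶜ = 0 := measure_mono_null (by intro x hx hxa; exact hx (hxa ▸ ha)) h0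
    simpa using (prob_compl_eq_zero_iff hs).1 this
  · rw [Measure.dirac_apply' _ hs, indicator_of_notMem ha]
    exact measure_mono_null (by intro x hx hxa; exact ha (hxa ▸ hx)) h0

/-- The equality case of the bound `‖∫ dμ(x) / ((z - x)(w - x))‖ ≤ 1 / t`. -/
lemma ae_eq_of_norm_productKernel_eq (ht : 0 < t) {z w : ℂ} (hz : z ∈ upperRegion μ t)
    (hw : w ∈ upperRegion μ t) (h : ‖productKernel μ z w‖ = 1 / t) :
    ∀ᵐ x : ℝ ∂μ, conj w - (x : ℂ) = (t * productKernel μ z w) * (z - (x : ℂ)) := by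
  obtain ⟨iz, lz⟩ := integrable_norm_sq_of_mem_upperRegion ht hz
  obtain ⟨iw, lw⟩ := integrable_norm_sq_of_mem_upperRegion ht hw
  have ip := integrable_mul_of_mem_upperRegion ht hz hw
  set K := productKernel μ z w with hK
  set κ : ℂ := t * K with hκ
  have hκ1 : ‖κ‖ = 1 := by rw [hκ, norm_mul, h]; simp [abs_of_pos ht, ht.ne']
  have hexp : ∀ x : ℝ, ‖(z - (x : ℂ))⁻¹ - κ * conj ((w - (x : ℂ))⁻¹)‖ ^ 2
      = ‖(z - (x : ℂ))⁻¹‖ ^ 2 + ‖(w - (x : ℂ))⁻¹‖ ^ 2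
        - 2 * (conj κ * ((z - (x : ℂ))⁻¹ * (w - (x : ℂ))⁻¹)).re := fun x => by
    have hk : κ.re * κ.re + κ.im * κ.im = 1 := by
      rw [← Complex.normSq_apply, Complex.normSq_eq_norm_sq, hκ1]; norm_num
    generalize (z - (x : ℂ))⁻¹ = p
    generalize (w - (x : ℂ))⁻¹ = q
    simp only [← Complex.normSq_eq_norm_sq, Complex.normSq_apply, Complex.sub_re, Complex.sub_im,
      Complex.mul_re, Complex.mul_im, Complex.conj_re, Complex.conj_im]
    linear_combination (q.re ^ 2 + q.im ^ 2) * hk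
  have hi : Integrable (fun x : ℝ => ‖(z - (x : ℂ))⁻¹ - κ * conj ((w - (x : ℂ))⁻¹)‖ ^ 2) μ := by
    simp_rw [hexp]
    exact (iz.add iw).sub ((ip.const_mul _).re.const_mul 2)
  have hzero : ∫ x : ℝ, ‖(z - (x : ℂ))⁻¹ - κ * conj ((w - (x : ℂ))⁻¹)‖ ^ 2 ∂μ = 0 := by
    refine le_antisymm ?_ (integral_nonneg fun x => by positivity)
    simp_rw [hexp]
    have hre : ∫ x : ℝ, (conj κ * ((z - (x : ℂ))⁻¹ * (w - (x : ℂ))⁻¹)).re ∂μ = 1 / t := by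
      have := ContinuousLinearMap.integral_comp_comm Complex.reCLM (ip.const_mul (conj κ))
      simp only [Complex.reCLM_apply] at this
      rw [this, integral_const_mul]
      change (conj κ * K).re = 1 / t
      have : K = κ / t := by
        rw [hκ, mul_div_cancel_left₀ _ (Complex.ofReal_ne_zero.2 ht.ne')]
      rw [this, mul_div_assoc', ← Complex.normSq_eq_conj_mul_self, Complex.normSq_eq_norm_sq, hκ1]
      norm_cast; simp
    have hsub := integral_sub (iz.add iw) ((ip.const_mul (conj κ)).re.const_mul 2)
    simp only [Pi.add_apply, RCLike.re_eq_complex_re] at hsub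
    rw [hsub, integral_const_mul, integral_add iz iw, hre]
    linarith
  rw [integral_eq_zero_iff_of_nonneg (fun x => by positivity) hi] at hzero
  filter_upwards [hzero, ae_ne_of_mem_upperRegion ht hz, ae_ne_of_mem_upperRegion ht hw]
    with x hx h1 h2
  have h3 : conj w - (x : ℂ) ≠ 0 := fun h0 => h2 <| by
    have := congrArg conj h0; simpa using this
  have hx' : (z - (x : ℂ))⁻¹ = κ * (conj w - (x : ℂ))⁻¹ := by
    have : ‖(z - (x : ℂ))⁻¹ - κ * conj ((w - (x : ℂ))⁻¹)‖ = 0 := by simpa using hx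
    have := sub_eq_zero.1 (norm_eq_zero.1 this)
    simpa using this
  field_simp at hx'
  rw [hx']; ring

/-- In the equality case with factor `1` the relation reads `conj w - x = z - x`, and one value of
`x` suffices. -/
lemma conj_eq_of_productKernel_eq (ht : 0 < t) {z w : ℂ} (hz : z ∈ upperRegion μ t)
    (hw : w ∈ upperRegion μ t) (h : t * productKernel μ z w = 1) : conj w = z := by
  have hn : ‖productKernel μ z w‖ = 1 / t := by
    have : productKernel μ z w = 1 / t := by
      rw [← h, mul_div_cancel_left₀ _ (Complex.ofReal_ne_zero.2 ht.ne')]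
    rw [this]; simp [abs_of_pos ht]
  obtain ⟨x, hx⟩ := (ae_eq_of_norm_productKernel_eq ht hz hw hn).exists
  rw [h] at hx
  linear_combination hx

/-- In the equality case `x` satisfies an affine equation almost surely. If the factor `κ` is not
`1`, that equation has only one solution. -/
lemma productKernel_eq_or_dirac (ht : 0 < t) {z w : ℂ} (hz : z ∈ upperRegion μ t)
    (hw : w ∈ upperRegion μ t) (h : ‖productKernel μ z w‖ = 1 / t) :
    t * productKernel μ z w = 1 ∨ ∃ a, μ = Measure.dirac a := by
  by_cases h1 : t * productKernel μ z w = 1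
  · exact Or.inl h1
  · right
    set κ : ℂ := t * productKernel μ z w with hκ
    refine ⟨((conj w - κ * z) / (1 - κ)).re, eq_dirac_of_ae_eq ?_⟩
    filter_upwards [ae_eq_of_norm_productKernel_eq ht hz hw h] with x hx
    have : (x : ℂ) = (conj w - κ * z) / (1 - κ) := by
      rw [eq_div_iff (sub_ne_zero.2 (Ne.symm h1))]
      linear_combination -hx
    rw [← this]; simp

/-! ### Monotonicity and surjectivity of the real part of `H_ρ` along the graph -/

/-- On the graph the imaginary increments of `G` are exactly `-1/t` times those of the point.
Removing them from both sides of the squared Lipschitz inequality leaves the horizontal increments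
only. -/
lemma re_cauchyTransform_sub_sq_le (ht : 0 < t) (a b : ℝ) :
    ((cauchyTransform μ (bianePoint μ t b)).re - (cauchyTransform μ (bianePoint μ t a)).re) ^ 2
      ≤ ((b - a) / t) ^ 2 := by
  have h := norm_cauchyTransform_sub_le ht (bianePoint_mem_upperRegion μ t b)
    (bianePoint_mem_upperRegion μ t a)
  have h2 := pow_le_pow_left₀ (norm_nonneg _) h 2
  rw [mul_pow, ← Complex.normSq_eq_norm_sq, ← Complex.normSq_eq_norm_sq, Complex.normSq_apply,
    Complex.normSq_apply] at h2
  simp only [Complex.sub_re, Complex.sub_im, re_bianePoint, im_bianePoint,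
    im_cauchyTransform_bianePoint ht] at h2
  have e1 : ((b - a) / t) ^ 2 = (1 / t) ^ 2 * ((b - a) * (b - a)) := by ring
  have e2 : (-bianeV μ t b / t - -bianeV μ t a / t) * (-bianeV μ t b / t - -bianeV μ t a / t)
      = (1 / t) ^ 2 * ((bianeV μ t b - bianeV μ t a) * (bianeV μ t b - bianeV μ t a)) := by ring
  rw [e2] at h2
  rw [e1]
  linarith

lemma abs_re_cauchyTransform_sub_le (ht : 0 < t) {a b : ℝ} (hab : a ≤ b) :
    |(cauchyTransform μ (bianePoint μ t b)).re - (cauchyTransform μ (bianePoint μ t a)).re|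
      ≤ (b - a) / t :=
  abs_le_of_sq_le_sq (re_cauchyTransform_sub_sq_le ht a b) (div_nonneg (sub_nonneg.2 hab) ht.le)

lemma im_cauchyTransform_bianePoint_sub (ht : 0 < t) (a b : ℝ) :
    (cauchyTransform μ (bianePoint μ t b) - cauchyTransform μ (bianePoint μ t a)).im
      = -(bianePoint μ t b - bianePoint μ t a).im / t := by
  rw [Complex.sub_im, im_cauchyTransform_bianePoint ht, im_cauchyTransform_bianePoint ht,
    Complex.sub_im, im_bianePoint, im_bianePoint]
  ring

/-- Equality would give `ΔG = -Δz / t`, that is, the product kernel equal to `1/t`, which forces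
conjugate points; these have equal real parts. So this side is strict for every law. -/
lemma neg_lt_re_cauchyTransform_sub (ht : 0 < t) {a b : ℝ} (hab : a < b) :
    -((b - a) / t)
      < (cauchyTransform μ (bianePoint μ t b)).re - (cauchyTransform μ (bianePoint μ t a)).re := by
  have hb := bianePoint_mem_upperRegion μ t b
  have ha := bianePoint_mem_upperRegion μ t a
  refine lt_of_le_of_ne (neg_le_of_abs_le (abs_re_cauchyTransform_sub_le ht hab.le)) fun he => ?_
  refine not_conj_bianePoint_eq hab (conj_eq_of_productKernel_eq ht hb ha ?_)
  have hΔ : cauchyTransform μ (bianePoint μ t b) - cauchyTransform μ (bianePoint μ t a)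
      = -(bianePoint μ t b - bianePoint μ t a) / t := by
    apply Complex.ext
    · rw [Complex.sub_re, ← he, Complex.div_ofReal_re, Complex.neg_re, Complex.sub_re,
        re_bianePoint, re_bianePoint]; ring
    · rw [im_cauchyTransform_bianePoint_sub ht, Complex.div_ofReal_im, Complex.neg_im]
  have h0 := bianePoint_sub_ne_zero (μ := μ) (t := t) hab
  have ht' : (t : ℂ) ≠ 0 := Complex.ofReal_ne_zero.2 ht.ne'
  rw [cauchyTransform_sub ht hb ha, eq_div_iff ht'] at hΔ
  apply mul_left_cancel₀ (neg_ne_zero.2 h0)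
  linear_combination hΔ

/-- Equality here gives `ΔG = conj Δz / t`, which determines only the modulus of the product kernel;
the remaining equality case is a Dirac law. -/
lemma re_cauchyTransform_sub_lt (ht : 0 < t) (hμ : ∀ x : ℝ, μ ≠ Measure.dirac x) {a b : ℝ}
    (hab : a < b) :
    (cauchyTransform μ (bianePoint μ t b)).re - (cauchyTransform μ (bianePoint μ t a)).re
      < (b - a) / t := by
  have hb := bianePoint_mem_upperRegion μ t b
  have ha := bianePoint_mem_upperRegion μ t a
  refine lt_of_le_of_ne (le_of_abs_le (abs_re_cauchyTransform_sub_le ht hab.le)) fun he => ?_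
  have hn : ‖productKernel μ (bianePoint μ t b) (bianePoint μ t a)‖ = 1 / t := by
    have h0 := norm_pos_iff.2 (bianePoint_sub_ne_zero (μ := μ) (t := t) hab)
    have hΔ : cauchyTransform μ (bianePoint μ t b) - cauchyTransform μ (bianePoint μ t a)
        = conj (bianePoint μ t b - bianePoint μ t a) / t := by
      apply Complex.ext
      · rw [Complex.sub_re, he, Complex.div_ofReal_re, Complex.conj_re, Complex.sub_re,
          re_bianePoint, re_bianePoint]
      · rw [im_cauchyTransform_bianePoint_sub ht, Complex.div_ofReal_im, Complex.conj_im]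
    have hΔn := congrArg norm hΔ
    rw [cauchyTransform_sub ht hb ha, norm_mul, norm_neg, norm_div, RCLike.norm_conj,
      Complex.norm_of_nonneg ht.le] at hΔn
    apply mul_left_cancel₀ h0.ne'
    rw [hΔn]; ring
  rcases productKernel_eq_or_dirac ht hb ha hn with h | ⟨x, hx⟩
  · exact not_conj_bianePoint_eq hab (conj_eq_of_productKernel_eq ht hb ha h)
  · exact hμ x hx

/-- Horizontal increments of `ρ G` cannot cancel those of `a` when `|ρ| ≤ t`. The two extreme values
of `ρ` rest on the two strict bounds above, and `ρ = -t` is the case `r = 2` of the theorem. -/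
lemma strictMono_bianeRe (ht : 0 < t) {ρ : ℝ} (h1 : ρ ≤ t)
    (h2 : -t < ρ ∨ (ρ = -t ∧ ∀ x : ℝ, μ ≠ Measure.dirac x)) :
    StrictMono (bianeRe μ t ρ) := by
  intro a b hab
  rw [bianeRe_eq, bianeRe_eq, ← sub_pos]
  have hd : 0 < (b - a) / t := div_pos (sub_pos.2 hab) ht
  have hba : b - a = t * ((b - a) / t) := by field_simp
  have hl := neg_lt_re_cauchyTransform_sub (μ := μ) ht hab
  have hu := abs_le.1 (abs_re_cauchyTransform_sub_le (μ := μ) ht hab.le)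
  set d := (b - a) / t
  set g := (cauchyTransform μ (bianePoint μ t b)).re - (cauchyTransform μ (bianePoint μ t a)).re
    with hg
  have hgoal : 0 < t * d + ρ * g := by
    rcases h2 with h2 | ⟨h2, hμ⟩
    · rcases le_or_gt 0 ρ with h0 | h0
      · rcases h0.eq_or_lt with h0 | h0
        · rw [← h0]; simpa using mul_pos ht hd
        · nlinarith
      · nlinarith [hu.2]
    · have := re_cauchyTransform_sub_lt ht hμ hab
      rw [h2]; nlinarith
  rw [← hba, hg] at hgoal
  linarith

lemma continuous_bianePoint (ht : 0 < t) : Continuous (bianePoint μ t) := by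
  have := continuous_bianeV (μ := μ) ht
  unfold bianePoint
  fun_prop

lemma continuousOn_cauchyTransform (ht : 0 < t) :
    ContinuousOn (cauchyTransform μ) (upperRegion μ t) := by
  have : LipschitzOnWith (Real.toNNReal (1 / t)) (cauchyTransform μ) (upperRegion μ t) :=
    LipschitzOnWith.of_dist_le_mul fun z hz w hw => by
      rw [dist_eq_norm, dist_eq_norm, Real.coe_toNNReal _ (by positivity)]
      exact norm_cauchyTransform_sub_le ht hz hw
  exact this.continuousOn

lemma continuous_bianeRe (ht : 0 < t) (ρ : ℝ) : Continuous (bianeRe μ t ρ) := by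
  have h1 : Continuous fun a => cauchyTransform μ (bianePoint μ t a) :=
    (continuousOn_cauchyTransform ht).comp_continuous (continuous_bianePoint ht)
      (bianePoint_mem_upperRegion μ t)
  have h2 : bianeRe μ t ρ = fun a => a + ρ * (cauchyTransform μ (bianePoint μ t a)).re := by
    ext a; exact bianeRe_eq μ t ρ a
  rw [h2]; fun_prop

lemma abs_bianeRe_sub_le (ht : 0 < t) (ρ a : ℝ) : |bianeRe μ t ρ a - a| ≤ |ρ| * (1 / √t) := by
  rw [bianeRe_eq, add_sub_cancel_left, abs_mul]
  exact mul_le_mul_of_nonneg_left ((Complex.abs_re_le_norm _).trans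
    (norm_cauchyTransform_le ht (bianePoint_mem_upperRegion μ t a))) (abs_nonneg _)

/-- The map is continuous and moves each point by at most `|ρ| / √t`. -/
lemma surjective_bianeRe (ht : 0 < t) (ρ : ℝ) : Function.Surjective (bianeRe μ t ρ) := by
  refine (continuous_bianeRe ht ρ).surjective ?_ ?_
  · refine tendsto_atTop_mono (fun a => ?_)
      (tendsto_atTop_add_const_right _ (-(|ρ| * (1 / √t))) tendsto_id)
    have := (abs_le.1 (abs_bianeRe_sub_le (μ := μ) ht ρ a)).1
    simp only [id]; linarith
  · refine tendsto_atBot_mono (fun a => ?_)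
      (tendsto_atBot_add_const_right _ (|ρ| * (1 / √t)) tendsto_id)
    have := (abs_le.1 (abs_bianeRe_sub_le (μ := μ) ht ρ a)).2
    simp only [id]; linarith

end Region

/-! ### Alternating products of free elements -/

section Free

/-- The list of factors of `altProd`, with their indices. -/
def altList {A : Type u} (x : Bool → A) : Bool → ℕ → List (Bool × A)
  | _, 0 => []
  | i, n + 1 => (i, x i) :: altList x (!i) n

lemma isChain_altList {A : Type u} (x : Bool → A) (i : Bool) (n : ℕ) :
    (altList x i n).IsChain (fun p q => p.1 ≠ q.1) := by
  induction n generalizing i with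
  | zero => simp [altList]
  | succ n ih =>
    cases n with
    | zero => simp [altList]
    | succ n =>
      have := ih (!i)
      rw [altList] at this ⊢
      rw [altList, List.isChain_cons_cons]
      exact ⟨by simp, this⟩

lemma mem_altList {A : Type u} {x : Bool → A} {i : Bool} {n : ℕ} {p : Bool × A} (hp : p ∈ altList x i n) :
    p.2 = x p.1 := by
  induction n generalizing i with
  | zero => simp [altList] at hp
  | succ n ih =>
    rw [altList, List.mem_cons] at hp
    rcases hp with rfl | hp
    · rfl
    · exact ih hp


variable {A : Type u} [CStarAlgebra A]

/-- The alternating product `x i * x (!i) * x i * ⋯` with `n` factors. -/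
def altProd (x : Bool → A) : Bool → ℕ → A
  | _, 0 => 1
  | i, n + 1 => x i * altProd x (!i) n

lemma prod_altList (x : Bool → A) (i : Bool) (n : ℕ) :
    ((altList x i n).map Prod.snd).prod = altProd x i n := by
  induction n generalizing i with
  | zero => simp [altList, altProd]
  | succ n ih => simp [altList, altProd, ih]

lemma continuous_altProd (i : Bool) (n : ℕ) : Continuous fun x : Bool → A => altProd x i n := by
  induction n generalizing i with
  | zero => simpa [altProd] using continuous_const
  | succ n ih => exact (continuous_apply i).mul (ih (!i))

lemma altProd_true_even (x : Bool → A) (n : ℕ) :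
    altProd x true (2 * n) = (x true * x false) ^ n := by
  induction n with
  | zero => simp [altProd]
  | succ n ih => simp [Nat.mul_succ, altProd, ih, pow_succ', mul_assoc]

lemma altProd_true_odd (x : Bool → A) (n : ℕ) :
    altProd x true (2 * n + 1) = (x true * x false) ^ n * x true := by
  induction n with
  | zero => simp [altProd]
  | succ n ih =>
    rw [show 2 * (n + 1) + 1 = (2 * n + 1) + 1 + 1 by ring, altProd, altProd]
    simp [ih, pow_succ', mul_assoc]

/-- Freeness extends to the norm closures of the two algebras. -/
lemma AreFree.altProd_eq_zero {τ : A →L[ℂ] ℂ} {a b : A} (hf : AreFree τ a b) (h1 : τ 1 = 1)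
    {x : Bool → A}
    (hx : ∀ i, x i ∈ closure (StarAlgebra.adjoin ℂ {if i then a else b} : Set A))
    (h0 : ∀ i, τ (x i) = 0) (i : Bool) {n : ℕ} (hn : n ≠ 0) : τ (altProd x i n) = 0 := by
  set S : Bool → StarSubalgebra ℂ A := fun i => StarAlgebra.adjoin ℂ {if i then a else b} with hS
  set c : (Bool → A) → Bool → A := fun y i => y i - τ (y i) • (1 : A) with hc
  have hcc : Continuous c := by
    refine continuous_pi fun i => ?_
    fun_prop
  have hcl : IsClosed {y : Bool → A | τ (altProd (c y) i n) = 0} :=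
    isClosed_eq (τ.continuous.comp ((continuous_altProd i n).comp hcc)) continuous_const
  have hsub : (univ : Set Bool).pi (fun i => (S i : Set A))
      ⊆ {y : Bool → A | τ (altProd (c y) i n) = 0} := by
    intro y hy
    change τ (altProd (c y) i n) = 0
    rw [← prod_altList]
    refine hf _ ?_ (isChain_altList _ _ _) fun p hp => ?_
    · cases n with
      | zero => exact absurd rfl hn
      | succ n => simp [altList]
    · rw [mem_altList hp]
      refine ⟨?_, by simp [hc, h1]⟩
      have hy1 : y p.1 ∈ S p.1 := hy p.1 (mem_univ _)
      exact sub_mem hy1 ((S p.1).smul_mem (one_mem _) _)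
  have hmem : x ∈ closure ((univ : Set Bool).pi (fun i => (S i : Set A))) := by
    rw [closure_pi_set]
    exact fun i _ => hx i
  have := closure_minimal hsub hcl hmem
  have hcx : c x = x := by
    ext i; simp [hc, h0]
  simpa [hcx] using this

/-- For centered elements of two free algebras, `τ((1 + y)(1 - x y)⁻¹(1 + x)) = 1`. -/
lemma AreFree.map_mul_inverse_one_sub {τ : A →L[ℂ] ℂ} {a b : A} (hf : AreFree τ a b)
    (h1 : τ 1 = 1) {x y : A} (hx : x ∈ closure (StarAlgebra.adjoin ℂ {a} : Set A))
    (hy : y ∈ closure (StarAlgebra.adjoin ℂ {b} : Set A)) (hx0 : τ x = 0) (hy0 : τ y = 0)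
    (hxy : ‖x * y‖ < 1) : τ ((1 + y) * Ring.inverse (1 - x * y) * (1 + x)) = 1 := by
  set f : Bool → A := fun i => if i then x else y with hfdef
  have hz : ∀ (i : Bool) {n : ℕ}, n ≠ 0 → τ (altProd f i n) = 0 := fun i n hn =>
    hf.altProd_eq_zero h1 (x := f) (fun i => by cases i <;> simpa [hfdef])
      (fun i => by cases i <;> simpa [hfdef]) i hn
  have hs := (((hasSum_geom_series_inverse (x * y) hxy).mul_left (1 + y)).mul_right
    (1 + x)).mapL τ
  refine hs.unique ?_
  -- Each term of the geometric series splits into four alternating words of centered elements; only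
  -- the empty word, at `n = 0`, has nonzero trace.
  have hexp : ∀ n : ℕ, τ ((1 + y) * (x * y) ^ n * (1 + x)) = τ (altProd f true (2 * n))
      + τ (altProd f false (2 * n + 1)) + τ (altProd f true (2 * n + 1))
      + τ (altProd f false (2 * n + 2)) := fun n => by
    have e1 : altProd f false (2 * n + 1) = y * (x * y) ^ n := by
      rw [altProd, Bool.not_false, altProd_true_even]; simp [hfdef]
    have e2 : altProd f false (2 * n + 2) = y * ((x * y) ^ n * x) := by
      rw [altProd, Bool.not_false, altProd_true_odd]; simp [hfdef]
    rw [e1, e2, altProd_true_odd, altProd_true_even, ← map_add, ← map_add, ← map_add]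
    simp only [hfdef, if_true, Bool.false_eq_true, if_false]
    congr 1
    noncomm_ring
  have hval : ∀ n : ℕ, τ ((1 + y) * (x * y) ^ n * (1 + x)) = if n = 0 then 1 else 0 := fun n => by
    rw [hexp]
    split_ifs with h
    · subst h
      rw [hz false (n := 2 * 0 + 1) (by simp), hz true (n := 2 * 0 + 1) (by simp),
        hz false (n := 2 * 0 + 2) (by simp)]
      simp [altProd, h1]
    · rw [hz true (n := 2 * n) (by omega), hz false (n := 2 * n + 1) (by omega),
        hz true (n := 2 * n + 1) (by omega), hz false (n := 2 * n + 2) (by omega)]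
      simp
  simp_rw [hval]
  exact hasSum_ite_eq 0 1

/-! ### Resolvents and Cauchy transforms -/

lemma mul_resolvent_eq_one {a : A} {z : ℂ} (hz : z ∈ resolventSet ℂ a) :
    (algebraMap ℂ A z - a) * resolvent a z = 1 :=
  Ring.mul_inverse_cancel _ (spectrum.mem_resolventSet_iff.1 hz)

lemma resolvent_mul_eq_one {a : A} {z : ℂ} (hz : z ∈ resolventSet ℂ a) :
    resolvent a z * (algebraMap ℂ A z - a) = 1 :=
  Ring.inverse_mul_cancel _ (spectrum.mem_resolventSet_iff.1 hz)

lemma eventually_mem_resolventSet (a : A) :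
    ∀ᶠ z in Bornology.cobounded ℂ, z ∈ resolventSet ℂ a := by
  filter_upwards [(tendsto_norm_cobounded_atTop (E := ℂ)).eventually_gt_atTop (‖a‖ * ‖(1 : A)‖)]
    with z hz using spectrum.mem_resolventSet_of_norm_lt_mul hz

lemma tendsto_smul_resolvent (a : A) :
    Tendsto (fun z : ℂ => z • resolvent a z) (Bornology.cobounded ℂ) (𝓝 1) := by
  have h : Tendsto (fun z : ℂ => 1 + a * resolvent a z) (Bornology.cobounded ℂ)
      (𝓝 (1 + a * 0)) :=
    ((spectrum.resolvent_tendsto_cobounded a).const_mul a).const_add 1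
  rw [mul_zero, add_zero] at h
  refine h.congr' ?_
  filter_upwards [eventually_mem_resolventSet a] with z hz
  rw [← mul_resolvent_eq_one hz, sub_mul, Algebra.algebraMap_eq_smul_one, smul_mul_assoc, one_mul]
  abel

lemma hasSum_resolvent {a : A} {z : ℂ} (hz0 : z ≠ 0) (hz : ‖z⁻¹ • a‖ < 1)
    (hz' : z ∈ resolventSet ℂ a) :
    HasSum (fun n : ℕ => (z⁻¹) ^ (n + 1) • a ^ n) (resolvent a z) := by
  have h := (hasSum_geom_series_inverse _ hz).const_smul z⁻¹
  have hu : IsUnit (1 - z⁻¹ • a) := isUnit_one_sub_of_norm_lt_one hz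
  have he : z⁻¹ • Ring.inverse (1 - z⁻¹ • a) = resolvent a z := by
    have h1 : (algebraMap ℂ A z - a) * (z⁻¹ • Ring.inverse (1 - z⁻¹ • a)) = 1 := by
      have : algebraMap ℂ A z - a = z • (1 - z⁻¹ • a) := by
        rw [smul_sub, smul_inv_smul₀ hz0, Algebra.algebraMap_eq_smul_one]
      rw [this, smul_mul_smul_comm, mul_inv_cancel₀ hz0, one_smul, Ring.mul_inverse_cancel _ hu]
    calc z⁻¹ • Ring.inverse (1 - z⁻¹ • a)
        = resolvent a z * (algebraMap ℂ A z - a) * (z⁻¹ • Ring.inverse (1 - z⁻¹ • a)) := by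
          rw [resolvent_mul_eq_one hz', one_mul]
      _ = resolvent a z := by rw [mul_assoc, h1, mul_one]
  rw [he] at h
  simpa only [smul_pow, smul_smul, pow_succ'] using h

/-- The partial sums of the Neumann series are polynomials in `a`. This is what lets freeness be
applied to resolvents. -/
lemma resolvent_mem_closure {a : A} {z : ℂ} (hz0 : z ≠ 0) (hz : ‖z⁻¹ • a‖ < 1)
    (hz' : z ∈ resolventSet ℂ a) :
    resolvent a z ∈ closure (StarAlgebra.adjoin ℂ {a} : Set A) := by
  refine mem_closure_of_tendsto (hasSum_resolvent hz0 hz hz') (Eventually.of_forall fun s => ?_)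
  refine sum_mem fun n _ => ?_
  exact (StarAlgebra.adjoin ℂ {a}).smul_mem
    (pow_mem (StarAlgebra.self_mem_adjoin_singleton ℂ a) n) _

end Free

lemma hasSum_cauchyTransform {μ : Measure ℝ} [IsProbabilityMeasure μ] {R : ℝ}
    (hR : ∀ᵐ x ∂μ, |x| ≤ R) {z : ℂ} (hz : R < ‖z‖) (hR0 : 0 ≤ R) :
    HasSum (fun n : ℕ => (z⁻¹) ^ (n + 1) * ((∫ x, x ^ n ∂μ : ℝ) : ℂ)) (cauchyTransform μ z) := by
  have hz0 : 0 < ‖z‖ := hR0.trans_lt hz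
  have hzne : z ≠ 0 := norm_pos_iff.1 hz0
  set q : ℝ := R / ‖z‖ with hq
  have hq0 : 0 ≤ q := by positivity
  have hq1 : q < 1 := (div_lt_one hz0).2 hz
  have h := hasSum_integral_of_dominated_convergence (μ := μ)
    (F := fun (n : ℕ) (x : ℝ) => (z⁻¹) ^ (n + 1) * ((x ^ n : ℝ) : ℂ))
    (f := fun x : ℝ => (z - (x : ℂ))⁻¹) (fun n _ => ‖z‖⁻¹ * q ^ n) ?_ ?_ ?_ ?_ ?_
  · have he : ∀ n : ℕ, ∫ x : ℝ, (z⁻¹) ^ (n + 1) * ((x ^ n : ℝ) : ℂ) ∂μ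
        = (z⁻¹) ^ (n + 1) * ((∫ x, x ^ n ∂μ : ℝ) : ℂ) := fun n => by
      rw [integral_const_mul, integral_complex_ofReal]
    simp_rw [he] at h
    exact h
  · intro n
    exact (Measurable.aestronglyMeasurable (by fun_prop))
  · intro n
    filter_upwards [hR] with x hx
    rw [norm_mul, norm_pow, norm_inv, Complex.norm_real, norm_pow, Real.norm_eq_abs, pow_succ',
      hq, div_eq_mul_inv, mul_pow, mul_assoc, mul_comm (R ^ n)]
    gcongr
  · exact Eventually.of_forall fun x => (summable_geometric_of_lt_one hq0 hq1).mul_left _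
  · exact integrable_const _
  · filter_upwards [hR] with x hx
    have hx1 : ‖z⁻¹ * (x : ℂ)‖ < 1 := by
      rw [norm_mul, norm_inv, Complex.norm_real, Real.norm_eq_abs, inv_mul_lt_iff₀ hz0, mul_one]
      exact hx.trans_lt hz
    have hzx : z - (x : ℂ) ≠ 0 := fun h0 => by
      rw [sub_eq_zero] at h0
      rw [← h0, inv_mul_cancel₀ hzne] at hx1
      simp at hx1
    have hg := (hasSum_geometric_of_norm_lt_one hx1).mul_left z⁻¹
    have e : z⁻¹ * (1 - z⁻¹ * (x : ℂ))⁻¹ = (z - (x : ℂ))⁻¹ := by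
      rw [← mul_inv]; congr 1; field_simp
    rw [e] at hg
    convert! hg using 2 with n
    push_cast
    rw [mul_pow]; ring

section Law

variable {A : Type u} [CStarAlgebra A] {τ : A →L[ℂ] ℂ} {a : A} {μ : Measure ℝ}

lemma exists_ae_abs_le {μ : Measure ℝ} (h : IsCompact μ.support) :
    ∃ R : ℝ, 0 ≤ R ∧ ∀ᵐ x ∂μ, |x| ≤ R := by
  obtain ⟨R, hR⟩ := h.isBounded.exists_norm_le
  refine ⟨max R 0, le_max_right _ _, ?_⟩
  filter_upwards [Measure.support_mem_ae (μ := μ)] with x hx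
  exact (hR x hx).trans (le_max_left _ _)

/-- Both sides have the same expansion in `1/z`, with the moments as coefficients. -/
lemma IsLaw.map_resolvent (h : IsLaw τ a μ) :
    ∀ᶠ z in Bornology.cobounded ℂ, τ (resolvent a z) = cauchyTransform μ z ∧
      z ∈ resolventSet ℂ a ∧ resolvent a z ∈ closure (StarAlgebra.adjoin ℂ {a} : Set A) := by
  have := h.isProbabilityMeasure
  obtain ⟨R, hR0, hR⟩ := exists_ae_abs_le h.isCompact_support
  filter_upwards [eventually_mem_resolventSet a,
    (tendsto_norm_cobounded_atTop (E := ℂ)).eventually_gt_atTop R,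
    (tendsto_norm_cobounded_atTop (E := ℂ)).eventually_gt_atTop ‖a‖] with z hz hzR hza
  have hz0 : 0 < ‖z‖ := hR0.trans_lt hzR
  have hzne : z ≠ 0 := norm_pos_iff.1 hz0
  have hlt : ‖z⁻¹ • a‖ < 1 := by
    rw [norm_smul, norm_inv, inv_mul_lt_iff₀ hz0, mul_one]; exact hza
  refine ⟨?_, hz, resolvent_mem_closure hzne hlt hz⟩
  have h1 := (hasSum_resolvent hzne hlt hz).mapL τ
  simp only [map_smul, h.moment, smul_eq_mul] at h1
  exact h1.unique (hasSum_cauchyTransform hR hzR hR0)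

lemma IsLaw.map_one (h : IsLaw τ a μ) : τ 1 = 1 := by
  have := h.isProbabilityMeasure
  simpa using h.moment 0

lemma IsLaw.tendsto_mul_cauchyTransform (h : IsLaw τ a μ) :
    Tendsto (fun z : ℂ => z * cauchyTransform μ z) (Bornology.cobounded ℂ) (𝓝 1) := by
  have h1 : Tendsto (fun z : ℂ => τ (z • resolvent a z)) (Bornology.cobounded ℂ) (𝓝 (τ 1)) :=
    (τ.continuous.tendsto 1).comp (tendsto_smul_resolvent a)
  rw [h.map_one] at h1
  refine h1.congr' ?_
  filter_upwards [h.map_resolvent] with z hz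
  rw [map_smul, hz.1, smul_eq_mul]

lemma IsLaw.eventually_cauchyTransform_ne_zero (h : IsLaw τ a μ) :
    ∀ᶠ z in Bornology.cobounded ℂ, cauchyTransform μ z ≠ 0 := by
  filter_upwards [h.tendsto_mul_cauchyTransform.eventually_ne one_ne_zero] with z hz h0
  exact hz (by rw [h0, mul_zero])

lemma IsLaw.tendsto_cauchyTransform (h : IsLaw τ a μ) :
    Tendsto (cauchyTransform μ) (Bornology.cobounded ℂ) (𝓝 0) := by
  have h1 := (tendsto_inv₀_cobounded (α := ℂ)).mul h.tendsto_mul_cauchyTransform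
  rw [zero_mul] at h1
  refine h1.congr' ?_
  filter_upwards [(tendsto_norm_cobounded_atTop (E := ℂ)).eventually_gt_atTop 0] with z hz
  rw [inv_mul_cancel_left₀ (norm_pos_iff.1 hz)]

/-- The normalized resolvent `(z - a)⁻¹ / τ((z - a)⁻¹)` tends to `1` at infinity. -/
lemma IsLaw.tendsto_normalized_resolvent (h : IsLaw τ a μ) :
    Tendsto (fun z : ℂ => (cauchyTransform μ z)⁻¹ • resolvent a z - 1) (Bornology.cobounded ℂ)
      (𝓝 0) := by
  have h1 := ((h.tendsto_mul_cauchyTransform.inv₀ one_ne_zero).smul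
    (tendsto_smul_resolvent a)).sub_const 1
  rw [inv_one, one_smul, sub_self] at h1
  refine h1.congr' ?_
  filter_upwards [(tendsto_norm_cobounded_atTop (E := ℂ)).eventually_gt_atTop 0] with z hz
  have hz0 : z ≠ 0 := norm_pos_iff.1 hz
  rw [smul_smul, mul_inv, mul_assoc, mul_comm, mul_assoc, mul_inv_cancel₀ hz0, mul_one]

/-- From `P U = h = V Q` one gets the factorization `P (U + V - U V) Q = h (P + Q - h)`, so
inverting the middle factor inverts `P + Q - h`. It is applied with `P = z - a`, `Q = w - b`, `h =
1/g` and the normalized resolvents `U = 1 + x`, `V = 1 + y`, for which `U + V - U V = 1 - x y`. -/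
lemma sub_smul_one_mul_eq_one {P Q U V T : A} {h : ℂ} (h0 : h ≠ 0) (hPU : P * U = h • 1)
    (hVQ : V * Q = h • 1) (hQV : Q * V = h • 1) (hT : (U + V - U * V) * T = 1) :
    (P + Q - h • 1) * (h⁻¹ • (V * T * U)) = 1 := by
  have e : P * (U + V - U * V) * Q = h • (P + Q - h • 1) := by
    have : P * (U + V - U * V) * Q = (P * U) * Q + P * (V * Q) - (P * U) * (V * Q) := by
      noncomm_ring
    rw [this, hPU, hVQ, smul_one_mul, mul_smul_one, smul_one_mul, smul_sub, smul_add]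
    abel
  have e2 : P + Q - h • 1 = h⁻¹ • (P * (U + V - U * V) * Q) := by
    rw [e, inv_smul_smul₀ h0]
  have e3 : P * (U + V - U * V) * Q * (V * T * U) = (h * h) • 1 := by
    calc P * (U + V - U * V) * Q * (V * T * U)
        = P * (U + V - U * V) * (Q * V) * T * U := by noncomm_ring
      _ = h • (P * ((U + V - U * V) * T) * U) := by
          rw [hQV, mul_smul_one, smul_mul_assoc, smul_mul_assoc]
          noncomm_ring
      _ = (h * h) • 1 := by rw [hT, mul_one, hPU, smul_smul]
  rw [e2, smul_mul_smul_comm, e3, smul_smul]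
  have : h⁻¹ * h⁻¹ * (h * h) = 1 := by field_simp
  rw [this, one_smul]

/-- If two free elements have resolvents of the same trace `g` at `z` and `w`, then the resolvent
of their sum has trace `g` at `z + w - 1 / g`. -/
lemma AreFree.map_resolvent_add {b : A} (hf : AreFree τ a b) (h1 : τ 1 = 1) {z w g : ℂ}
    (hg : g ≠ 0) (hz : z ∈ resolventSet ℂ a) (hw : w ∈ resolventSet ℂ b)
    (hza : resolvent a z ∈ closure (StarAlgebra.adjoin ℂ {a} : Set A))
    (hwb : resolvent b w ∈ closure (StarAlgebra.adjoin ℂ {b} : Set A))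
    (hgz : τ (resolvent a z) = g) (hgw : τ (resolvent b w) = g)
    (hz1 : ‖g⁻¹ • resolvent a z - 1‖ < 1) (hw1 : ‖g⁻¹ • resolvent b w - 1‖ < 1)
    (hzw : z + w - g⁻¹ ∈ resolventSet ℂ (a + b)) :
    τ (resolvent (a + b) (z + w - g⁻¹)) = g := by
  set p := resolvent a z with hp
  set q := resolvent b w with hq
  set P := algebraMap ℂ A z - a with hP
  set Q := algebraMap ℂ A w - b with hQ
  have hPp : P * p = 1 := mul_resolvent_eq_one hz
  have hpP : p * P = 1 := resolvent_mul_eq_one hz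
  have hQq : Q * q = 1 := mul_resolvent_eq_one hw
  have hqQ : q * Q = 1 := resolvent_mul_eq_one hw
  set x := g⁻¹ • p - 1 with hx
  set y := g⁻¹ • q - 1 with hy
  have hcl : ∀ (c : A) (r : A), r ∈ closure (StarAlgebra.adjoin ℂ {c} : Set A) →
      g⁻¹ • r - 1 ∈ closure (StarAlgebra.adjoin ℂ {c} : Set A) := fun c r hr => by
    rw [← StarSubalgebra.topologicalClosure_coe] at hr ⊢
    exact sub_mem (StarSubalgebra.smul_mem _ hr _) (one_mem _)
  have hτ : ∀ r : A, τ r = g → τ (g⁻¹ • r - 1) = 0 := fun r hr => by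
    rw [map_sub, map_smul, hr, h1, smul_eq_mul, inv_mul_cancel₀ hg, sub_self]
  have hxy : ‖x * y‖ < 1 :=
    (norm_mul_le _ _).trans_lt (mul_lt_one_of_nonneg_of_lt_one_left (norm_nonneg _) hz1 hw1.le)
  have hval := hf.map_mul_inverse_one_sub h1 (hcl a p hza) (hcl b q hwb) (hτ p hgz) (hτ q hgw) hxy
  set T := Ring.inverse (1 - x * y) with hT
  have hT1 : (1 - x * y) * T = 1 := Ring.mul_inverse_cancel _ (isUnit_one_sub_of_norm_lt_one hxy)
  set N := algebraMap ℂ A (z + w - g⁻¹) - (a + b) with hN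
  have hx1 : P * (1 + x) = g⁻¹ • 1 := by rw [hx, add_sub_cancel, mul_smul_comm, hPp]
  have hy1 : (1 + y) * Q = g⁻¹ • 1 := by rw [hy, add_sub_cancel, smul_mul_assoc, hqQ]
  have hx2 : Q * (1 + y) = g⁻¹ • 1 := by rw [hy, add_sub_cancel, mul_smul_comm, hQq]
  have hNPQ : N = P + Q - g⁻¹ • 1 := by
    rw [hN, hP, hQ, map_sub, map_add, Algebra.algebraMap_eq_smul_one g⁻¹]; abel
  have hX : N * (g • ((1 + y) * T * (1 + x))) = 1 := by
    have e : 1 + x + (1 + y) - (1 + x) * (1 + y) = 1 - x * y := by noncomm_ring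
    have := sub_smul_one_mul_eq_one (inv_ne_zero hg) hx1 hy1 hx2 (T := T) (by rw [e, hT1])
    rwa [inv_inv, ← hNPQ] at this
  have hres : resolvent (a + b) (z + w - g⁻¹) = g • ((1 + y) * T * (1 + x)) := by
    calc resolvent (a + b) (z + w - g⁻¹)
        = resolvent (a + b) (z + w - g⁻¹) * (N * (g • ((1 + y) * T * (1 + x)))) := by
          rw [hX, mul_one]
      _ = g • ((1 + y) * T * (1 + x)) := by
          rw [← mul_assoc, hN, resolvent_mul_eq_one hzw, one_mul]
  rw [hres, map_smul, hval, smul_eq_mul, mul_one]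

end Law

/-! ### The Cauchy transform of the semicircle law -/

lemma one_sub_two_mul_cos_ne_zero {q : ℂ} (hq : ‖q‖ < 1) (θ : ℝ) :
    1 - 2 * q * Complex.cos θ + q ^ 2
      = (1 - q * Complex.exp (θ * Complex.I)) * (1 - q * Complex.exp (-θ * Complex.I)) ∧
    1 - q * Complex.exp (θ * Complex.I) ≠ 0 ∧ 1 - q * Complex.exp (-θ * Complex.I) ≠ 0 := by
  have hn : ∀ w : ℂ, ‖w‖ = 1 → 1 - q * w ≠ 0 := fun w hw h0 => by
    have : ‖q * w‖ = 1 := by rw [← sub_eq_zero.1 h0]; simp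
    rw [norm_mul, hw, mul_one] at this
    exact hq.ne this
  have hm : Complex.exp (θ * Complex.I) * Complex.exp (-θ * Complex.I) = 1 := by
    rw [← Complex.exp_add]; simp
  refine ⟨?_, hn _ (Complex.norm_exp_ofReal_mul_I θ), hn _ ?_⟩
  · rw [Complex.cos]
    linear_combination (-q ^ 2) * hm
  · rw [← Complex.ofReal_neg]; exact Complex.norm_exp_ofReal_mul_I _

/-- The generating function of the Chebyshev polynomials of the second kind, as a difference of two
geometric series in `q e^{±iθ}`. -/
lemma hasSum_pow_mul_sin {q : ℂ} (hq : ‖q‖ < 1) (θ : ℝ) :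
    HasSum (fun n : ℕ => q ^ n * Complex.sin (((n + 1 : ℕ) : ℂ) * θ))
      (Complex.sin θ / (1 - 2 * q * Complex.cos θ + q ^ 2)) := by
  obtain ⟨hfac, h1, h2⟩ := one_sub_two_mul_cos_ne_zero hq θ
  set ζ := Complex.exp (θ * Complex.I) with hζ
  set ζ' := Complex.exp (-θ * Complex.I) with hζ'
  have hm : ζ * ζ' = 1 := by
    rw [hζ, hζ', ← Complex.exp_add]; simp
  have hn1 : ‖q * ζ‖ < 1 := by
    rw [norm_mul, hζ, Complex.norm_exp_ofReal_mul_I, mul_one]; exact hq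
  have hn2 : ‖q * ζ'‖ < 1 := by
    rw [norm_mul, hζ', ← Complex.ofReal_neg, Complex.norm_exp_ofReal_mul_I, mul_one]; exact hq
  have hs := (((hasSum_geometric_of_norm_lt_one hn2).mul_left ζ').sub
    ((hasSum_geometric_of_norm_lt_one hn1).mul_left ζ)).mul_right (Complex.I / 2)
  have hval : (ζ' * (1 - q * ζ')⁻¹ - ζ * (1 - q * ζ)⁻¹) * (Complex.I / 2)
      = Complex.sin θ / (1 - 2 * q * Complex.cos θ + q ^ 2) := by
    have i1 : (1 - q * ζ)⁻¹ * (1 - q * ζ) = 1 := inv_mul_cancel₀ h1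
    have i2 : (1 - q * ζ')⁻¹ * (1 - q * ζ') = 1 := inv_mul_cancel₀ h2
    rw [hfac, eq_div_iff (mul_ne_zero h1 h2), Complex.sin, ← hζ, ← hζ']
    linear_combination (Complex.I / 2) * ζ' * (1 - q * ζ) * i2
      - (Complex.I / 2) * ζ * (1 - q * ζ') * i1
  rw [hval] at hs
  convert! hs using 2 with n
  rw [Complex.sin, mul_pow, mul_pow]
  have e1 : Complex.exp (((n + 1 : ℕ) : ℂ) * θ * Complex.I) = ζ ^ (n + 1) := by
    rw [hζ, ← Complex.exp_nat_mul]; congr 1; ring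
  have e2 : Complex.exp (-(((n + 1 : ℕ) : ℂ) * θ) * Complex.I) = ζ' ^ (n + 1) := by
    rw [hζ', ← Complex.exp_nat_mul]; congr 1; ring
  rw [e1, e2]; ring

lemma integral_sin_nat_mul_sin (n : ℕ) :
    ∫ θ in (0 : ℝ)..Real.pi, Real.sin ((n + 1 : ℕ) * θ) * Real.sin θ
      = if n = 0 then Real.pi / 2 else 0 := by
  split_ifs with h
  · subst h
    have := integral_sin_sq (a := 0) (b := Real.pi)
    simp only [zero_add, Nat.cast_one, one_mul, ← sq]
    rw [this]; simp
  · have hn : (n : ℝ) ≠ 0 := Nat.cast_ne_zero.2 h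
    have hn2 : (n : ℝ) + 2 ≠ 0 := by positivity
    -- Product to sum: `sin((n+1)θ) sin θ = (cos(nθ) - cos((n+2)θ)) / 2`. The primitive divides by
    -- `n`, hence the separate case `n = 0`.
    have hd : ∀ θ ∈ uIcc (0 : ℝ) Real.pi, HasDerivAt
        (fun θ : ℝ => (Real.sin (n * θ) / n - Real.sin ((n + 2) * θ) / (n + 2)) / 2)
        (Real.sin ((n + 1 : ℕ) * θ) * Real.sin θ) θ := fun θ _ => by
      have h1 : HasDerivAt (fun θ : ℝ => Real.sin (n * θ)) (Real.cos (n * θ) * n) θ := by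
        simpa using ((hasDerivAt_id θ).const_mul (n : ℝ)).sin
      have h2 : HasDerivAt (fun θ : ℝ => Real.sin ((n + 2) * θ))
          (Real.cos ((n + 2) * θ) * (n + 2)) θ := by
        simpa using ((hasDerivAt_id θ).const_mul ((n : ℝ) + 2)).sin
      convert! ((h1.div_const n).sub (h2.div_const (n + 2))).div_const 2 using 1
      rw [mul_div_cancel_right₀ _ hn, mul_div_cancel_right₀ _ hn2]
      have e1 : (n : ℝ) * θ = (n + 1) * θ - θ := by ring
      have e2 : ((n : ℝ) + 2) * θ = (n + 1) * θ + θ := by ring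
      rw [e1, e2, Real.cos_sub, Real.cos_add]
      push_cast; ring
    rw [intervalIntegral.integral_eq_sub_of_hasDerivAt hd
      (Continuous.intervalIntegrable (by fun_prop) _ _)]
    have e : ((n : ℝ) + 2) * Real.pi = ((n + 2 : ℕ) : ℝ) * Real.pi := by push_cast; ring
    rw [e, Real.sin_nat_mul_pi, Real.sin_nat_mul_pi]
    simp

/-- By orthogonality of sines only the term `n = 0` of the generating series survives, so the value
does not depend on `q`. -/
lemma integral_sin_sq_div {q : ℂ} (hq : ‖q‖ < 1) :
    ∫ θ in (0 : ℝ)..Real.pi,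
        Complex.sin θ / (1 - 2 * q * Complex.cos θ + q ^ 2) * Complex.sin θ = (Real.pi / 2 : ℂ) := by
  have h := intervalIntegral.hasSum_integral_of_dominated_convergence (μ := volume) (a := 0)
    (b := Real.pi)
    (F := fun (n : ℕ) (θ : ℝ) => q ^ n * Complex.sin (((n + 1 : ℕ) : ℂ) * θ) * Complex.sin θ)
    (f := fun θ : ℝ => Complex.sin θ / (1 - 2 * q * Complex.cos θ + q ^ 2) * Complex.sin θ)
    (fun n _ => ‖q‖ ^ n) ?_ ?_ ?_ ?_ ?_
  · refine h.unique ?_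
    have he : ∀ n : ℕ, ∫ θ in (0 : ℝ)..Real.pi,
        q ^ n * Complex.sin (((n + 1 : ℕ) : ℂ) * θ) * Complex.sin θ
        = if n = 0 then (Real.pi / 2 : ℂ) else 0 := fun n => by
      have e1 : ∀ θ : ℝ, q ^ n * Complex.sin (((n + 1 : ℕ) : ℂ) * θ) * Complex.sin θ
          = q ^ n * ((Real.sin ((n + 1 : ℕ) * θ) * Real.sin θ : ℝ) : ℂ) := fun θ => by
        push_cast; ring
      simp_rw [e1]
      rw [intervalIntegral.integral_const_mul, intervalIntegral.integral_ofReal,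
        integral_sin_nat_mul_sin]
      split_ifs with hn
      · subst hn; simp
      · simp
    simp_rw [he]
    exact hasSum_ite_eq 0 _
  · intro n
    exact (Continuous.aestronglyMeasurable (by fun_prop))
  · intro n
    refine Eventually.of_forall fun θ _ => ?_
    have e1 : ‖Complex.sin (((n + 1 : ℕ) : ℂ) * θ)‖ ≤ 1 := by
      have : Complex.sin (((n + 1 : ℕ) : ℂ) * θ) = ((Real.sin ((n + 1 : ℕ) * θ) : ℝ) : ℂ) := by
        push_cast; rfl
      rw [this, Complex.norm_real]; exact Real.abs_sin_le_one _
    have e2 : ‖Complex.sin (θ : ℂ)‖ ≤ 1 := by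
      rw [← Complex.ofReal_sin, Complex.norm_real]; exact Real.abs_sin_le_one _
    rw [norm_mul, norm_mul, norm_pow, mul_assoc]
    exact mul_le_of_le_one_right (by positivity) (mul_le_one₀ e1 (norm_nonneg _) e2)
  · exact Eventually.of_forall fun θ _ => summable_geometric_of_lt_one (norm_nonneg _) hq
  · exact intervalIntegrable_const
  · exact Eventually.of_forall fun θ _ => (hasSum_pow_mul_sin hq θ).mul_right _

lemma integral_semicircle {c : ℝ} (hc : 0 < c) (f : ℝ → ℂ) (hf : ContinuousOn f (Icc (-(2 * √c)) (2 * √c))) :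
    ∫ x, f x ∂(semicircleLaw c)
      = (2 / Real.pi) * ∫ θ in (0 : ℝ)..Real.pi, Complex.sin θ ^ 2 * f (2 * √c * Real.cos θ) := by
  have hs : 0 < √c := Real.sqrt_pos.2 hc
  have hss : √c ^ 2 = c := Real.sq_sqrt hc.le
  set g : ℝ → ℂ := fun x => (Real.sqrt (4 * c - x ^ 2) / (2 * Real.pi * c)) • f x with hg
  have hr : ∀ θ : ℝ, 2 * √c * Real.cos θ ∈ Icc (-(2 * √c)) (2 * √c) := fun θ =>
    ⟨by nlinarith [Real.neg_one_le_cos θ], by nlinarith [Real.cos_le_one θ]⟩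
  have hgc : ContinuousOn g (Icc (-(2 * √c)) (2 * √c)) := by
    have hk : Continuous fun x : ℝ => √(4 * c - x ^ 2) / (2 * Real.pi * c) := by fun_prop
    exact hk.continuousOn.smul hf
  have h1 : ∫ x, f x ∂(semicircleLaw c) = ∫ x in (-(2 * √c))..(2 * √c), g x := by
    rw [semicircleLaw, if_neg hc.ne', integral_withDensity_eq_integral_toReal_smul (by fun_prop)
      (Eventually.of_forall fun _ => ENNReal.ofReal_lt_top),
      intervalIntegral.integral_of_le (by linarith), ← integral_indicator measurableSet_Ioc]
    congr 1 with x
    rw [ENNReal.toReal_ofReal (by positivity)]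
    by_cases hx : x ∈ Ioc (-(2 * √c)) (2 * √c)
    · rw [indicator_of_mem hx]
    · rw [indicator_of_notMem hx, Real.sqrt_eq_zero_of_nonpos, zero_div, zero_smul]
      rw [mem_Ioc, not_and_or, not_lt, not_le] at hx
      rcases hx with hx | hx <;> nlinarith
  have h2 := intervalIntegral.integral_deriv_smul_comp'' (a := 0) (b := Real.pi)
    (f := fun θ => 2 * √c * Real.cos θ) (f' := fun θ => 2 * √c * -Real.sin θ) (g := g)
    (by fun_prop) (fun x _ => ((Real.hasDerivAt_cos x).const_mul _).hasDerivWithinAt) (by fun_prop)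
    (hgc.mono (by rintro _ ⟨θ, -, rfl⟩; exact hr θ))
  simp only [Real.cos_zero, Real.cos_pi, mul_one, mul_neg] at h2
  rw [h1, intervalIntegral.integral_symm, ← h2, ← intervalIntegral.integral_neg,
    ← intervalIntegral.integral_const_mul]
  refine intervalIntegral.integral_congr fun θ hθ => ?_
  rw [uIcc_of_le Real.pi_pos.le] at hθ
  have hsin : 0 ≤ Real.sin θ := Real.sin_nonneg_of_mem_Icc hθ
  have hroot : √(4 * c - (2 * √c * Real.cos θ) ^ 2) = 2 * √c * Real.sin θ := by
    have : 4 * c - (2 * √c * Real.cos θ) ^ 2 = (2 * √c * Real.sin θ) ^ 2 := by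
      have h3 := Real.sin_sq_add_cos_sq θ
      linear_combination (-4 * √c ^ 2) * h3 - 4 * hss
    rw [this, Real.sqrt_sq (by positivity)]
  simp only [Function.comp, hg, hroot, Complex.real_smul]
  push_cast
  have hcc : (c : ℂ) = (√c : ℂ) ^ 2 := by rw [← Complex.ofReal_pow, hss]
  rw [hcc]
  have : (√c : ℂ) ≠ 0 := Complex.ofReal_ne_zero.2 hs.ne'
  have hpi : (Real.pi : ℂ) ≠ 0 := Complex.ofReal_ne_zero.2 Real.pi_ne_zero
  field_simp

/-- With `q = √c g` and `x = 2√c cos θ`, the denominator `c g + 1/g - x` becomes `(1 - 2q cos θ +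
q²) / g`, which reduces the integral to the previous one. Stating the inverse function avoids
choosing a branch of the square root. -/
lemma cauchyTransform_semicircleLaw {c : ℝ} (hc : 0 ≤ c) {g : ℂ} (hg : g ≠ 0)
    (hgc : √c * ‖g‖ < 1) : cauchyTransform (semicircleLaw c) (c * g + g⁻¹) = g := by
  rcases hc.eq_or_lt with rfl | hc
  · simp [semicircleLaw, cauchyTransform]
  have hs : 0 < √c := Real.sqrt_pos.2 hc
  have hcc : (c : ℂ) = (√c : ℂ) ^ 2 := by rw [← Complex.ofReal_pow, Real.sq_sqrt hc.le]
  set q : ℂ := √c * g with hq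
  have hq1 : ‖q‖ < 1 := by rw [hq, norm_mul, Complex.norm_of_nonneg hs.le]; exact hgc
  have hfac : ∀ θ : ℝ, c * g + g⁻¹ - ((2 * √c * Real.cos θ : ℝ) : ℂ)
      = g⁻¹ * (1 - 2 * q * Complex.cos θ + q ^ 2) := fun θ => by
    rw [hq, hcc]; push_cast; field_simp; ring
  have hne : ∀ θ : ℝ, 1 - 2 * q * Complex.cos θ + q ^ 2 ≠ 0 := fun θ => by
    obtain ⟨h, h1, h2⟩ := one_sub_two_mul_cos_ne_zero hq1 θ
    rw [h]; exact mul_ne_zero h1 h2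
  rw [cauchyTransform, integral_semicircle hc]
  · have : ∀ θ : ℝ, Complex.sin θ ^ 2 * (c * g + g⁻¹ - ((2 * √c * Real.cos θ : ℝ) : ℂ))⁻¹
        = g * (Complex.sin θ / (1 - 2 * q * Complex.cos θ + q ^ 2) * Complex.sin θ) := fun θ => by
      rw [hfac, mul_inv, inv_inv]; ring
    simp_rw [this]
    rw [intervalIntegral.integral_const_mul, integral_sin_sq_div hq1]
    have hpi : (Real.pi : ℂ) ≠ 0 := Complex.ofReal_ne_zero.2 Real.pi_ne_zero
    field_simp
  · refine ContinuousOn.inv₀ (by fun_prop) fun x hx => ?_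
    have hx' : x = 2 * √c * Real.cos (Real.arccos (x / (2 * √c))) := by
      rw [Real.cos_arccos]
      · field_simp
      · rw [le_div_iff₀ (by positivity)]; linarith [hx.1]
      · rw [div_le_iff₀ (by positivity)]; linarith [hx.2]
    rw [hx', hfac]
    exact mul_ne_zero (inv_ne_zero hg) (hne _)

lemma Filter.Tendsto.add_cobounded {α : Type*} {l : Filter α} {f g : α → ℂ}
    (hf : Tendsto f l (𝓝 0)) (hg : Tendsto g l (Bornology.cobounded ℂ)) :
    Tendsto (fun z => f z + g z) l (Bornology.cobounded ℂ) := by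
  rw [← tendsto_norm_atTop_iff_cobounded] at hg ⊢
  have hf1 : ∀ᶠ z in l, ‖f z‖ ≤ 1 := by
    have := hf.norm
    rw [norm_zero] at this
    exact this.eventually_le_const one_pos
  refine tendsto_atTop_mono' l ?_ (tendsto_atTop_add_const_right l (-1) hg)
  filter_upwards [hf1] with z hz
  have := norm_sub_le_norm_add (g z) (f z)
  rw [add_comm (g z)] at this
  linarith

/-- The functional equation of the free convolution with a semicircle law, near infinity. -/
lemma IsFreeConvolution.eventually_cauchyTransform_eq {ν μ : Measure ℝ} {c : ℝ} (hc : 0 ≤ c)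
    (h : IsFreeConvolution.{u} ν (semicircleLaw c) μ) :
    ∀ᶠ z in Bornology.cobounded ℂ,
      cauchyTransform μ (bianeH ν c z) = cauchyTransform ν z := by
  obtain ⟨A, _, τ, a, b, -, -, -, hf, ha, hb, hab⟩ := h
  have h1 : τ 1 = 1 := ha.map_one
  have hG := ha.tendsto_cauchyTransform
  have hG0 := ha.eventually_cauchyTransform_ne_zero
  have hcG : Tendsto (fun z => (c : ℂ) * cauchyTransform ν z) (Bornology.cobounded ℂ) (𝓝 0) := by
    simpa using hG.const_mul (c : ℂ)
  have hw : Tendsto (fun z => c * cauchyTransform ν z + (cauchyTransform ν z)⁻¹)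
      (Bornology.cobounded ℂ) (Bornology.cobounded ℂ) := by
    have hinv : Tendsto (fun z => (cauchyTransform ν z)⁻¹) (Bornology.cobounded ℂ)
        (Bornology.cobounded ℂ) :=
      (tendsto_inv₀_nhdsNE_zero (α := ℂ)).comp (tendsto_nhdsWithin_iff.2 ⟨hG, hG0⟩)
    exact hcG.add_cobounded hinv
  have hH : Tendsto (bianeH ν c) (Bornology.cobounded ℂ) (Bornology.cobounded ℂ) := by
    refine (hcG.add_cobounded tendsto_id).congr fun z => ?_
    rw [bianeH, add_comm, id]
  have hsmall : ∀ᶠ z in Bornology.cobounded ℂ, √c * ‖cauchyTransform ν z‖ < 1 := by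
    have : Tendsto (fun z => √c * ‖cauchyTransform ν z‖) (Bornology.cobounded ℂ) (𝓝 (√c * ‖(0 : ℂ)‖)) :=
      hG.norm.const_mul _
    rw [norm_zero, mul_zero] at this
    exact this.eventually_lt_const one_pos
  have hna := ha.tendsto_normalized_resolvent.norm
  have hnb := (hb.tendsto_normalized_resolvent.comp hw).norm
  rw [norm_zero] at hna hnb
  filter_upwards [hG0, hsmall, ha.map_resolvent, hw.eventually hb.map_resolvent,
    hH.eventually hab.map_resolvent, hna.eventually_lt_const one_pos,
    hnb.eventually_lt_const one_pos] with z hz0 hzs hza hzb hzab hn1 hn2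
  set g := cauchyTransform ν z with hg
  have hgb : cauchyTransform (semicircleLaw c) (c * g + g⁻¹) = g :=
    cauchyTransform_semicircleLaw hc hz0 hzs
  simp only [Function.comp, ← hg, hgb] at hn2
  -- The semicircular element is evaluated at `w = c g + 1/g`, where its resolvent has trace `g`;
  -- the point `z + w - 1/g` is then `H_c(z)`.
  have hz' : z + (c * g + g⁻¹) - g⁻¹ = bianeH ν c z := by rw [bianeH, ← hg]; ring
  have := hf.map_resolvent_add h1 hz0 hza.2.1 hzb.2.1 hza.2.2 hzb.2.2 hza.1
    (by rw [← hgb]; simpa [hgb] using hzb.1) hn1 hn2 (by rw [hz']; exact hzab.2.1)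
  rw [hz', hzab.1] at this
  exact this

/-! ### Subordination -/

lemma differentiableAt_cauchyTransform {μ : Measure ℝ} [IsProbabilityMeasure μ] {z : ℂ}
    (hz : 0 < z.im) : DifferentiableAt ℂ (cauchyTransform μ) z := by
  set r := z.im / 2 with hr
  have hr0 : 0 < r := half_pos hz
  have him : ∀ w ∈ Metric.ball z r, r < w.im := fun w hw => by
    have h1 := Complex.abs_im_le_norm (w - z)
    rw [Metric.mem_ball, dist_eq_norm] at hw
    have h2 := (abs_lt.1 (h1.trans_lt hw)).1
    rw [Complex.sub_im] at h2
    linarith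
  refine (hasDerivAt_integral_of_dominated_loc_of_deriv_le (μ := μ)
    (F := fun (w : ℂ) (x : ℝ) => (w - (x : ℂ))⁻¹)
    (F' := fun (w : ℂ) (x : ℝ) => -1 / (w - (x : ℂ)) ^ 2)
    (bound := fun _ => (1 / r) ^ 2) (Metric.ball_mem_nhds z hr0)
    (Eventually.of_forall fun w => (measurable_inv_sub_ofReal w).aestronglyMeasurable)
    (integrable_inv_sub_ofReal hz.ne') (Measurable.aestronglyMeasurable (by fun_prop))
    (Eventually.of_forall fun x w hw => ?_) (integrable_const _)
    (Eventually.of_forall fun x w hw => ?_)).2.differentiableAt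
  · have h1 := him w hw
    have h0 : 0 < w.im := hr0.trans h1
    have := norm_inv_sub_ofReal_le h0.ne' x
    rw [norm_div, norm_neg, norm_one, norm_pow, one_div, ← inv_pow, ← norm_inv]
    refine pow_le_pow_left₀ (norm_nonneg _) (this.trans ?_) 2
    rw [abs_of_pos h0]
    exact one_div_le_one_div_of_le hr0 h1.le
  · have h0 : 0 < w.im := hr0.trans (him w hw)
    have := ((hasDerivAt_id w).sub_const (x : ℂ)).inv (sub_ofReal_ne_zero h0.ne' x)
    exact this

/-- The open region above the graph of `bianeV μ t`. -/
def openUpperRegion (μ : Measure ℝ) (t : ℝ) : Set ℂ :=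
  {z : ℂ | bianeV μ t z.re < z.im}

lemma openUpperRegion_subset (μ : Measure ℝ) (t : ℝ) : openUpperRegion μ t ⊆ upperRegion μ t :=
  fun z (hz : bianeV μ t z.re < z.im) => hz.le

section Continuation

variable {μ : Measure ℝ} [IsProbabilityMeasure μ] {t : ℝ}

lemma isOpen_openUpperRegion (ht : 0 < t) : IsOpen (openUpperRegion μ t) :=
  isOpen_lt ((continuous_bianeV ht).comp Complex.continuous_re) Complex.continuous_im

/-- Since `v_t ≤ √t`, the half-plane `Im z > √t` lies in the region, and every point is joined to it
by a vertical half-line. -/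
lemma isPreconnected_openUpperRegion (ht : 0 < t) : IsPreconnected (openUpperRegion μ t) := by
  set P : Set ℂ := {z : ℂ | √t < z.im} with hP
  have hPΓ : P ⊆ openUpperRegion μ t := fun z (hz : √t < z.im) =>
    (bianeV_le_sqrt ht z.re).trans_lt hz
  have hPc : IsPreconnected P := (convex_halfSpace_im_gt (√t)).isPreconnected
  refine isPreconnected_of_forall (((√t + 1 : ℝ) : ℂ) * Complex.I) fun z hz => ?_
  set L : Set ℂ := {w : ℂ | w.re = z.re} ∩ {w : ℂ | z.im ≤ w.im} with hL
  have hLΓ : L ⊆ openUpperRegion μ t := fun w hw => by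
    have h1 : w.re = z.re := hw.1
    have h2 : z.im ≤ w.im := hw.2
    change bianeV μ t w.re < w.im
    rw [h1]; exact lt_of_lt_of_le hz h2
  have hLc : IsPreconnected L := ((convex_hyperplane Complex.reLm.isLinear z.re).inter
    (convex_halfSpace_im_ge z.im)).isPreconnected
  refine ⟨P ∪ L, union_subset hPΓ hLΓ, Or.inl (by simp [hP]), Or.inr ⟨rfl, le_refl z.im⟩, ?_⟩
  refine hPc.union' ⟨z.re + ((max z.im (√t + 1) : ℝ) : ℂ) * Complex.I, ?_, ?_, ?_⟩ hLc
  · change √t < _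
    simp
  · change _ = z.re
    simp
  · change z.im ≤ _
    simp

lemma kernelIntegral_lt_of_mem_openUpperRegion (ht : 0 < t) {z : ℂ}
    (hz : z ∈ openUpperRegion μ t) : 0 < z.im ∧ kernelIntegral μ z.re z.im < 1 / t := by
  have h0 : 0 < z.im := (bianeV_nonneg t z.re).trans_lt hz
  exact ⟨h0, (kernelIntegral_lt_iff ht h0 _).2 hz⟩

variable {ν : Measure ℝ} [IsProbabilityMeasure ν] {s c : ℝ}

lemma im_bianeH_pos (hs : 0 < s) (hc : 0 ≤ c) (hcs : c < s) {z : ℂ}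
    (hz : z ∈ openUpperRegion ν s) :
    0 < (bianeH ν c z).im ∧ 0 < 1 - c * kernelIntegral ν z.re z.im := by
  obtain ⟨h0, hI⟩ := kernelIntegral_lt_of_mem_openUpperRegion hs hz
  have h1 : 0 < 1 - c * kernelIntegral ν z.re z.im := by
    have h2 : c * kernelIntegral ν z.re z.im ≤ c * (1 / s) := mul_le_mul_of_nonneg_left hI.le hc
    have h3 : c * (1 / s) < 1 := by rw [mul_one_div, div_lt_one hs]; exact hcs
    linarith
  exact ⟨by rw [im_bianeH]; exact mul_pos h0 h1, h1⟩

/-- Identity theorem: above the graph of `v_s` the kernel integral is below `1/s`, so for `c < s`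
the map `H_c` stays in the upper half-plane and both sides are holomorphic. -/
lemma cauchyTransform_bianeH (hs : 0 < s) (hc : 0 ≤ c) (hcs : c < s)
    (h : ∀ᶠ z in Bornology.cobounded ℂ,
      cauchyTransform μ (bianeH ν c z) = cauchyTransform ν z) {z : ℂ}
    (hz : z ∈ openUpperRegion ν s) :
    cauchyTransform μ (bianeH ν c z) = cauchyTransform ν z := by
  have hopen := isOpen_openUpperRegion (μ := ν) hs
  have hdν : DifferentiableOn ℂ (cauchyTransform ν) (openUpperRegion ν s) := fun w hw =>
    (differentiableAt_cauchyTransform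
      (kernelIntegral_lt_of_mem_openUpperRegion hs hw).1).differentiableWithinAt
  have hdH : DifferentiableOn ℂ (bianeH ν c) (openUpperRegion ν s) := by
    unfold bianeH; fun_prop
  have hdμ : DifferentiableOn ℂ (fun w => cauchyTransform μ (bianeH ν c w))
      (openUpperRegion ν s) := fun w hw =>
    ((differentiableAt_cauchyTransform (im_bianeH_pos hs hc hcs hw).1).comp w
      (hdH.differentiableAt (hopen.mem_nhds hw))).differentiableWithinAt
  obtain ⟨R, -, hR⟩ := (hasBasis_cobounded_norm (E := ℂ)).eventually_iff.1 h
  -- High enough to lie both above the graph (`v_s ≤ √s`) and in the neighbourhood of infinity where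
  -- the identity is known.
  set z₀ : ℂ := ((|R| + √s + 1 : ℝ) : ℂ) * Complex.I with hz₀
  have him : z₀.im = |R| + √s + 1 := by simp [hz₀]
  have hz₀Γ : z₀ ∈ openUpperRegion ν s := by
    change bianeV ν s z₀.re < z₀.im
    rw [him]
    have := bianeV_le_sqrt (μ := ν) hs z₀.re
    have := abs_nonneg R
    linarith
  refine (hdμ.analyticOnNhd hopen).eqOn_of_preconnected_of_eventuallyEq (hdν.analyticOnNhd hopen)
    (isPreconnected_openUpperRegion hs) hz₀Γ ?_ hz
  have hn : R < ‖z₀‖ := by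
    have h1 := Complex.abs_im_le_norm z₀
    rw [him] at h1
    have h2 := le_abs_self R
    have h3 := le_abs_self (|R| + √s + 1)
    have h4 := Real.sqrt_nonneg s
    linarith
  filter_upwards [continuous_norm.continuousAt.eventually_const_lt hn] with w hw
  exact hR hw.le

/-- Subordination up to the boundary: for `u = s - c`, the point `H_c(α + i v_s(α))` lies on the
graph of `v_u` of the free convolution, and the Cauchy transforms correspond there. -/
lemma subordination_boundary (hs : 0 < s) (hc : 0 ≤ c) (hcs : c < s)
    (h : ∀ᶠ z in Bornology.cobounded ℂ,
      cauchyTransform μ (bianeH ν c z) = cauchyTransform ν z) (α : ℝ) :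
    cauchyTransform μ (bianeH ν c (bianePoint ν s α)) = cauchyTransform ν (bianePoint ν s α) ∧
      bianeH ν c (bianePoint ν s α) = bianePoint μ (s - c) (bianeRe ν s c α) ∧
      bianeV μ (s - c) (bianeRe ν s c α) = (s - c) / s * bianeV ν s α := by
  have hu : 0 < s - c := sub_pos.2 hcs
  set z := bianePoint ν s α with hz
  have hzE : z ∈ upperRegion ν s := bianePoint_mem_upperRegion ν s α
  -- The boundary point is approached vertically from inside the open region.
  set p : ℝ → ℂ := fun ε => z + (ε : ℂ) * Complex.I with hp
  have hpΓ : ∀ ε, 0 < ε → p ε ∈ openUpperRegion ν s := fun ε hε => by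
    change bianeV ν s (p ε).re < (p ε).im
    simp only [hp, Complex.add_re, Complex.add_im, Complex.mul_re, Complex.mul_im,
      Complex.ofReal_re, Complex.ofReal_im, Complex.I_re, Complex.I_im, mul_zero, mul_one,
      sub_zero, add_zero]
    exact lt_of_le_of_lt hzE (by linarith)
  have hpt : Tendsto p (𝓝[>] 0) (𝓝[upperRegion ν s] z) := by
    refine tendsto_nhdsWithin_iff.2 ⟨?_, ?_⟩
    · have : Continuous p := by fun_prop
      have h1 : Tendsto p (𝓝 0) (𝓝 (p 0)) := this.tendsto 0
      simp only [hp, Complex.ofReal_zero, zero_mul, add_zero] at h1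
      exact h1.mono_left nhdsWithin_le_nhds
    · filter_upwards [self_mem_nhdsWithin] with ε hε
      exact openUpperRegion_subset ν s (hpΓ ε hε)
  have hGν : Tendsto (fun ε => cauchyTransform ν (p ε)) (𝓝[>] 0) (𝓝 (cauchyTransform ν z)) :=
    (continuousOn_cauchyTransform hs z hzE).tendsto.comp hpt
  have hH : Tendsto (fun ε => bianeH ν c (p ε)) (𝓝[>] 0) (𝓝 (bianeH ν c z)) :=
    (hpt.mono_right nhdsWithin_le_nhds).add (hGν.const_mul _)
  have hmem : ∀ ε, 0 < ε → bianeH ν c (p ε) ∈ upperRegion μ (s - c) := fun ε hε => by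
    have hΓ := hpΓ ε hε
    obtain ⟨h0, hI⟩ := kernelIntegral_lt_of_mem_openUpperRegion hs hΓ
    obtain ⟨him, hpos⟩ := im_bianeH_pos hs hc hcs hΓ
    refine (kernelIntegral_le_iff hu him _).1 ?_
    have e1 := im_cauchyTransform μ (bianeH ν c (p ε))
    rw [cauchyTransform_bianeH hs hc hcs h hΓ, im_cauchyTransform, im_bianeH] at e1
    set I := kernelIntegral ν (p ε).re (p ε).im
    set J := kernelIntegral μ (bianeH ν c (p ε)).re ((p ε).im * (1 - c * I)) with hJ
    -- Imaginary parts of the functional equation: `J = I / (1 - c I)`, so `I < 1/s` yields `J ≤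
    -- 1/(s - c)`. The image therefore lies above the graph of `v_{s-c}` of the convolution.
    have e2 : I = (1 - c * I) * J := by
      apply mul_left_cancel₀ (neg_ne_zero.2 h0.ne')
      rw [e1]; ring
    rw [im_bianeH]
    change J ≤ 1 / (s - c)
    have e3 : J = I / (1 - c * I) := by rw [eq_div_iff hpos.ne']; linarith
    rw [e3, div_le_div_iff₀ hpos hu]
    have : I * s < 1 := by rwa [lt_div_iff₀ hs] at hI
    linarith
  have hev : ∀ᶠ ε in 𝓝[>] (0 : ℝ), bianeH ν c (p ε) ∈ upperRegion μ (s - c) :=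
    eventually_mem_nhdsWithin.mono fun ε hε => hmem ε hε
  have hwE : bianeH ν c z ∈ upperRegion μ (s - c) := (isClosed_upperRegion hu).mem_of_tendsto hH hev
  have hG : cauchyTransform μ (bianeH ν c z) = cauchyTransform ν z := by
    have h1 : Tendsto (fun ε => cauchyTransform μ (bianeH ν c (p ε))) (𝓝[>] 0)
        (𝓝 (cauchyTransform μ (bianeH ν c z))) :=
      (continuousOn_cauchyTransform hu _ hwE).tendsto.comp (tendsto_nhdsWithin_iff.2 ⟨hH, hev⟩)
    refine tendsto_nhds_unique (h1.congr' ?_) hGν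
    filter_upwards [self_mem_nhdsWithin] with ε hε
    exact cauchyTransform_bianeH hs hc hcs h (hpΓ ε hε)
  have him : (bianeH ν c z).im = (s - c) / s * bianeV ν s α := by
    have h1 : (bianeH ν c z).im = z.im + c * (cauchyTransform ν z).im := by simp [bianeH]
    rw [h1, hz, im_cauchyTransform_bianePoint hs, im_bianePoint]
    field_simp
    ring
  have hv : bianeV μ (s - c) (bianeRe ν s c α) = (s - c) / s * bianeV ν s α := by
    have hle : bianeV μ (s - c) (bianeRe ν s c α) ≤ (s - c) / s * bianeV ν s α := by
      rw [← him]; exact hwE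
    -- At height zero the upper bound `hle` is enough. At positive height the imaginary parts of the
    -- two transforms give the kernel integral exactly, which identifies `v_{s-c}`.
    rcases (bianeV_nonneg (μ := ν) s α).eq_or_lt with h0 | h0
    · rw [← h0, mul_zero] at hle ⊢
      exact le_antisymm hle (bianeV_nonneg _ _)
    · have hpos : 0 < (s - c) / s * bianeV ν s α := by positivity
      refine bianeV_eq_of_kernelIntegral_eq hu hpos ?_
      have e1 := im_cauchyTransform μ (bianeH ν c z)
      rw [hG, hz, im_cauchyTransform_bianePoint hs, ← hz, him] at e1
      change _ = -_ * kernelIntegral μ (bianeRe ν s c α) _ at e1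
      field_simp at e1 ⊢
      linarith
  refine ⟨hG, ?_, hv⟩
  apply Complex.ext
  · rw [re_bianePoint]; rfl
  · rw [im_bianePoint, hv, him]

end Continuation

/-! ### Transfer of the skew domain of the convolution to the initial law -/

section Skew

variable {μ ν : Measure ℝ} [IsProbabilityMeasure μ] [IsProbabilityMeasure ν] {s c : ℝ}

/-- Subordination keeps `G` unchanged, so `H_{-(s-c)}` after `H_c` adds `c G - (s-c) G` to `z` in
total. -/
lemma skewRe_bianeRe (hs : 0 < s) (hc : 0 ≤ c) (hcs : c < s)
    (h : ∀ᶠ z in Bornology.cobounded ℂ,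
      cauchyTransform μ (bianeH ν c z) = cauchyTransform ν z) (α : ℝ) :
    skewRe μ (s - c) (bianeRe ν s c α) = bianeRe ν s (2 * c - s) α := by
  obtain ⟨hG, hp, -⟩ := subordination_boundary hs hc hcs h α
  rw [skewRe, ← hp, bianeH, hG, bianeRe, bianeH, bianeH]
  congr 1
  push_cast
  ring

/-- Needed for `Function.invFun` in `skewB` to be a true inverse. It is inherited from the strict
monotonicity for the initial law, so the convolution need not be shown to be non-Dirac. -/
lemma injective_skewRe (hs : 0 < s) (hc : 0 ≤ c) (hcs : c < s)
    (h : ∀ᶠ z in Bornology.cobounded ℂ,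
      cauchyTransform μ (bianeH ν c z) = cauchyTransform ν z)
    (hmono : StrictMono (bianeRe ν s (2 * c - s))) : Function.Injective (skewRe μ (s - c)) := by
  intro a b hab
  obtain ⟨α, rfl⟩ := surjective_bianeRe (μ := ν) hs c a
  obtain ⟨β, rfl⟩ := surjective_bianeRe (μ := ν) hs c b
  rw [skewRe_bianeRe hs hc hcs h, skewRe_bianeRe hs hc hcs h] at hab
  rw [hmono.injective hab]

lemma skewB_bianeRe (hs : 0 < s) (hc : 0 ≤ c) (hcs : c < s)
    (h : ∀ᶠ z in Bornology.cobounded ℂ,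
      cauchyTransform μ (bianeH ν c z) = cauchyTransform ν z)
    (hmono : StrictMono (bianeRe ν s (2 * c - s))) (α : ℝ) :
    skewB μ (s - c) (bianeRe ν s (2 * c - s) α) = 2 * ((s - c) / s * bianeV ν s α) := by
  rw [skewB, ← skewRe_bianeRe hs hc hcs h, Function.leftInverse_invFun
    (injective_skewRe hs hc hcs h hmono), (subordination_boundary hs hc hcs h α).2.2]

lemma realTrace_skewDomain (hs : 0 < s) (hc : 0 ≤ c) (hcs : c < s)
    (h : ∀ᶠ z in Bornology.cobounded ℂ,
      cauchyTransform μ (bianeH ν c z) = cauchyTransform ν z)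
    (hmono : StrictMono (bianeRe ν s (2 * c - s))) :
    realTrace (skewDomain μ (s - c)) = bianeRe ν s (2 * c - s) '' {α | 0 < bianeV ν s α} := by
  have hu : 0 < s - c := sub_pos.2 hcs
  ext a
  obtain ⟨α, rfl⟩ := surjective_bianeRe (μ := ν) hs (2 * c - s) a
  rw [hmono.injective.mem_set_image]
  change ¬ (((bianeRe ν s (2 * c - s) α : ℝ) : ℂ) ∈ bianeH μ (-(s - c)) '' (circularDomain μ (s - c))ᶜ)
    ↔ 0 < bianeV ν s α
  rw [not_iff_comm, not_lt]
  constructor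
  · intro hv
    have hv0 : bianeV μ (s - c) (bianeRe ν s c α) = 0 := by
      rw [(subordination_boundary hs hc hcs h α).2.2, le_antisymm hv (bianeV_nonneg _ _), mul_zero]
    refine ⟨bianePoint μ (s - c) (bianeRe ν s c α), ?_, ?_⟩
    · change ¬ (|(bianePoint μ (s - c) (bianeRe ν s c α)).im|
        < bianeV μ (s - c) (bianePoint μ (s - c) (bianeRe ν s c α)).re)
      rw [re_bianePoint, im_bianePoint, hv0]; simp
    · apply Complex.ext
      · rw [Complex.ofReal_re, ← skewRe_bianeRe hs hc hcs h]; rfl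
      · rw [im_bianeH, im_bianePoint, hv0]; simp
  -- `Im H_{-u}(w) = Im w · (1 + u I)` with `u I ≥ 0`, so a real value comes only from a real `w`.
  -- Lying outside the circular domain, such a `w` has `v = 0` and is on the graph.
  · rintro ⟨w, hw, hwα⟩
    have him := congrArg Complex.im hwα
    rw [im_bianeH, Complex.ofReal_im] at him
    have hw0 : w.im = 0 := by
      rcases mul_eq_zero.1 him with h0 | h0
      · exact h0
      · have := mul_nonneg hu.le (kernelIntegral_nonneg (μ := μ) w.re w.im)
        linarith
    have hv : bianeV μ (s - c) w.re = 0 := by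
      have : ¬ (|w.im| < bianeV μ (s - c) w.re) := hw
      rw [hw0, abs_zero, not_lt] at this
      exact le_antisymm this (bianeV_nonneg _ _)
    have hwp : w = bianePoint μ (s - c) w.re := by
      apply Complex.ext
      · rw [re_bianePoint]
      · rw [im_bianePoint, hv, hw0]
    obtain ⟨β, hβ⟩ := surjective_bianeRe (μ := ν) hs c w.re
    have hre : skewRe μ (s - c) w.re = bianeRe ν s (2 * c - s) α := by
      rw [skewRe, ← hwp, hwα, Complex.ofReal_re]
    rw [← hβ, skewRe_bianeRe hs hc hcs h] at hre
    rw [← hβ, (subordination_boundary hs hc hcs h β).2.2, hmono.injective hre] at hv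
    rcases mul_eq_zero.1 hv with h0 | h0
    · exact absurd h0 (by positivity)
    · exact h0.le

end Skew

/-- The boundary curve and the real trace of the elliptic domain in terms of the initial law. -/
lemma IsFreeConvolution.elliptic {ν μ : Measure ℝ} [IsProbabilityMeasure ν] {s t : ℝ}
    (h : IsFreeConvolution.{u} ν (semicircleLaw (s - t / 2)) μ) (ht : 0 < t) (hts : t ≤ 2 * s)
    (hmono : StrictMono (bianeRe ν s (s - t))) :
    (∀ α, ellipticB μ t (bianeRe ν s (s - t) α) = t / s * bianeV ν s α) ∧
      realTrace (ellipticDomain μ t) = bianeRe ν s (s - t) '' {α | 0 < bianeV ν s α} := by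
  have hs : 0 < s := by linarith
  have hc : 0 ≤ s - t / 2 := by linarith
  have hcs : s - t / 2 < s := by linarith
  have hμ : IsProbabilityMeasure μ := by
    obtain ⟨A, _, τ, a, b, -, -, -, -, -, -, hab⟩ := h
    exact hab.isProbabilityMeasure
  have he := h.eventually_cauchyTransform_eq hc
  have e1 : s - (s - t / 2) = t / 2 := by ring
  have e2 : 2 * (s - t / 2) - s = s - t := by ring
  have hB := skewB_bianeRe hs hc hcs he (by rwa [e2])
  have hT := realTrace_skewDomain hs hc hcs he (by rwa [e2])
  rw [e1, e2] at hT
  refine ⟨fun α => ?_, hT⟩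
  have := hB α
  rw [e1, e2] at this
  rw [ellipticB, this]
  ring

/-- The standing assumption makes `bianeRe ν s (s - t)` strictly monotone. -/
lemma strictMono_bianeRe_sub {ν : Measure ℝ} [IsProbabilityMeasure ν] {r : ℝ} (hr₀ : 0 < r)
    (hr₂ : r ≤ 2) (h : r < 2 ∨ ∀ x : ℝ, ν ≠ Measure.dirac x) {s t : ℝ} (hs : 0 < s)
    (ht : t = r * s) : StrictMono (bianeRe ν s (s - t)) := by
  subst ht
  refine strictMono_bianeRe hs (by nlinarith) ?_
  rcases hr₂.lt_or_eq with h2 | h2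
  · left; nlinarith
  · rcases h with h | h
    · exact absurd h2 h.ne
    · exact Or.inr ⟨by rw [h2]; ring, h⟩

/-! ### Unimodality -/

section Unimodal

variable {ν : Measure ℝ} [IsProbabilityMeasure ν] {s : ℝ}

lemma one_div_lt_kernelIntegral {a v d : ℝ} (hv : 0 < v) (h : ∀ᵐ x ∂ν, |a - x| ≤ d)
    (hd : d ^ 2 + v ^ 2 < s) : 1 / s < kernelIntegral ν a v := by
  have h1 : 1 / (d ^ 2 + v ^ 2) ≤ kernelIntegral ν a v := by
    have := integral_mono_ae (integrable_const (1 / (d ^ 2 + v ^ 2)))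
      (integrable_kernel (μ := ν) hv a) (by
        filter_upwards [h] with x hx
        refine one_div_le_one_div_of_le (by positivity) ?_
        have : (a - x) ^ 2 ≤ d ^ 2 := sq_le_sq' (abs_le.1 hx).1 (abs_le.1 hx).2
        linarith)
    simpa [kernelIntegral] using this
  exact (one_div_lt_one_div_of_lt (by positivity) hd).trans_le h1

lemma bianeV_pos_of_ae_abs_le {a d : ℝ} (h : ∀ᵐ x ∂ν, |a - x| ≤ d) (hd : d ^ 2 < s) :
    0 < bianeV ν s a := by
  have hs : 0 < s := (sq_nonneg d).trans_lt hd
  have hv : 0 < √((s - d ^ 2) / 2) := Real.sqrt_pos.2 (by linarith)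
  refine hv.trans ((lt_kernelIntegral_iff hs hv a).1 (one_div_lt_kernelIntegral hv h ?_))
  rw [Real.sq_sqrt (by linarith)]; linarith

lemma bianeV_eq_zero_of_ae_le_abs {a : ℝ} (hs : 0 < s) (h : ∀ᵐ x ∂ν, √s ≤ |a - x|) :
    bianeV ν s a = 0 := by
  refine bianeV_eq_zero_of_forall hs fun v hv => ?_
  have := integral_mono_ae (integrable_kernel (μ := ν) hv a) (integrable_const (1 / s)) (by
    filter_upwards [h] with x hx
    refine one_div_le_one_div_of_le hs ?_
    have : √s ^ 2 ≤ |a - x| ^ 2 := pow_le_pow_left₀ (Real.sqrt_nonneg s) hx 2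
    rw [Real.sq_sqrt hs.le, sq_abs] at this
    nlinarith)
  simpa [kernelIntegral] using this

lemma kernelIntegral_mono_of_sq_le {a b v : ℝ} (hv : 0 < v)
    (h : ∀ᵐ x ∂ν, (b - x) ^ 2 ≤ (a - x) ^ 2) : kernelIntegral ν a v ≤ kernelIntegral ν b v := by
  refine integral_mono_ae (integrable_kernel hv a) (integrable_kernel hv b) ?_
  filter_upwards [h] with x hx
  exact one_div_le_one_div_of_le (by positivity) (by linarith)

/-- The kernel `1 / (x² + v²)` is concave on `[-d, d]` if `3 d² ≤ v²`. -/
lemma kernel_concave {p m q v d : ℝ} (hv : 0 < v) (hdv : 3 * d ^ 2 ≤ v ^ 2) (hpm : p ≤ m)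
    (hmq : m ≤ q) (hp : |p| ≤ d) (hm : |m| ≤ d) (hq : |q| ≤ d) :
    (q - m) * (1 / (p ^ 2 + v ^ 2)) + (m - p) * (1 / (q ^ 2 + v ^ 2))
      ≤ (q - p) * (1 / (m ^ 2 + v ^ 2)) := by
  have hP : 0 < p ^ 2 + v ^ 2 := by positivity
  have hM : 0 < m ^ 2 + v ^ 2 := by positivity
  have hQ : 0 < q ^ 2 + v ^ 2 := by positivity
  have hprod : ∀ x y : ℝ, |x| ≤ d → |y| ≤ d → x * y ≤ d ^ 2 := fun x y hx hy => by
    have := mul_le_mul hx hy (abs_nonneg _) ((abs_nonneg _).trans hx)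
    rw [← abs_mul] at this
    nlinarith [le_abs_self (x * y)]
  -- Numerator of the second divided difference. Each of the three products is at most `d²`, so `3
  -- d² ≤ v²` fixes the sign.
  have hnum : 0 ≤ (q - m) * (m - p) * (q - p) * (v ^ 2 - p * q - p * m - q * m) := by
    have h1 := hprod p q hp hq
    have h2 := hprod p m hp hm
    have h3 := hprod q m hq hm
    have h4 : 0 ≤ q - m := sub_nonneg.2 hmq
    have h5 : 0 ≤ m - p := sub_nonneg.2 hpm
    have h6 : 0 ≤ q - p := by linarith
    have h7 : 0 ≤ v ^ 2 - p * q - p * m - q * m := by linarith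
    positivity
  have hid : (q - p) * (1 / (m ^ 2 + v ^ 2)) - ((q - m) * (1 / (p ^ 2 + v ^ 2))
      + (m - p) * (1 / (q ^ 2 + v ^ 2)))
      = (q - m) * (m - p) * (q - p) * (v ^ 2 - p * q - p * m - q * m)
        / ((p ^ 2 + v ^ 2) * (m ^ 2 + v ^ 2) * (q ^ 2 + v ^ 2)) := by
    field_simp
    ring
  have : 0 ≤ (q - m) * (m - p) * (q - p) * (v ^ 2 - p * q - p * m - q * m)
        / ((p ^ 2 + v ^ 2) * (m ^ 2 + v ^ 2) * (q ^ 2 + v ^ 2)) := by positivity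
  linarith

/-- Quasi-concavity of `a ↦ ∫ dν / ((a-x)² + v²)` at the level `1/s`. Outside `[A, B]` the integral
decreases with the distance to the interval. Inside, a small `v` makes the whole interval exceed the
level, since `(B-A)² + v² < 4 (B-A)² ≤ s`; a large `v` makes the kernel concave. -/
lemma one_div_lt_kernelIntegral_of_between {A B : ℝ} (hAB : ∀ᵐ x ∂ν, x ∈ Icc A B)
    (hs : 4 * (B - A) ^ 2 ≤ s) {p m q v : ℝ} (hv : 0 < v) (hpm : p ≤ m) (hmq : m ≤ q)
    (hp : 1 / s < kernelIntegral ν p v) (hq : 1 / s < kernelIntegral ν q v) :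
    1 / s < kernelIntegral ν m v := by
  rcases lt_or_ge m A with hmA | hmA
  · refine hp.trans_le (kernelIntegral_mono_of_sq_le hv ?_)
    filter_upwards [hAB] with x hx
    nlinarith [hx.1]
  rcases lt_or_ge B m with hmB | hmB
  · refine hq.trans_le (kernelIntegral_mono_of_sq_le hv ?_)
    filter_upwards [hAB] with x hx
    nlinarith [hx.2]
  rcases lt_or_ge (v ^ 2) (3 * (B - A) ^ 2) with hvd | hvd
  · refine one_div_lt_kernelIntegral (d := B - A) hv ?_ (by linarith)
    filter_upwards [hAB] with x hx
    exact abs_le.2 ⟨by linarith [hx.2], by linarith [hx.1]⟩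
  -- Clamping the outer points to `[A, B]` brings them closer to every point of the support, so
  -- their integrals only grow and concavity applies between the clamped points.
  have hp' : 1 / s < kernelIntegral ν (max p A) v := by
    refine hp.trans_le (kernelIntegral_mono_of_sq_le hv ?_)
    filter_upwards [hAB] with x hx
    rcases le_total p A with h | h
    · rw [max_eq_right h]; nlinarith [hx.1]
    · rw [max_eq_left h]
  have hq' : 1 / s < kernelIntegral ν (min q B) v := by
    refine hq.trans_le (kernelIntegral_mono_of_sq_le hv ?_)
    filter_upwards [hAB] with x hx
    rcases le_total q B with h | h
    · rw [min_eq_left h]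
    · rw [min_eq_right h]; nlinarith [hx.2]
  have hpm' : max p A ≤ m := max_le hpm hmA
  have hmq' : m ≤ min q B := le_min hmq hmB
  have hpA : A ≤ max p A := le_max_right _ _
  have hqB : min q B ≤ B := min_le_right _ _
  generalize max p A = p' at *
  generalize min q B = q' at *
  rcases hpm'.eq_or_lt with rfl | hlt
  · exact hp'
  have hpq : 0 < q' - p' := by linarith
  have hint : (q' - m) * kernelIntegral ν p' v + (m - p') * kernelIntegral ν q' v
      ≤ (q' - p') * kernelIntegral ν m v := by
    simp only [kernelIntegral]
    rw [← integral_const_mul, ← integral_const_mul, ← integral_const_mul,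
      ← integral_add ((integrable_kernel hv p').const_mul _) ((integrable_kernel hv q').const_mul _)]
    refine integral_mono_ae (((integrable_kernel hv p').const_mul _).add
      ((integrable_kernel hv q').const_mul _)) ((integrable_kernel hv m).const_mul _) ?_
    filter_upwards [hAB] with x hx
    have := kernel_concave (p := p' - x) (m := m - x) (q := q' - x) hv hvd (by linarith)
      (by linarith) (abs_le.2 ⟨by linarith [hx.2], by linarith [hx.1]⟩)
      (abs_le.2 ⟨by linarith [hx.2], by linarith [hx.1]⟩)
      (abs_le.2 ⟨by linarith [hx.2], by linarith [hx.1]⟩)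
    simpa only [sub_sub_sub_cancel_right] using this
  have h1 : (q' - p') * (1 / s) < (q' - p') * kernelIntegral ν m v := by
    refine lt_of_lt_of_le ?_ hint
    have e1 := mul_le_mul_of_nonneg_left hp'.le (sub_nonneg.2 hmq')
    have e2 := mul_lt_mul_of_pos_left hq' (sub_pos.2 hlt)
    linarith
  exact lt_of_mul_lt_mul_left h1 hpq.le

lemma isUnimodal_bianeV {A B : ℝ} (hs0 : 0 < s) (hAB : ∀ᵐ x ∂ν, x ∈ Icc A B)
    (hs : 4 * (B - A) ^ 2 ≤ s) : IsUnimodal (bianeV ν s) := by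
  obtain ⟨x₀, hx₀⟩ := hAB.exists
  have hle : A ≤ B := hx₀.1.trans hx₀.2
  have hout : ∀ a, a ∉ Icc (A - √s) (B + √s) → bianeV ν s a = 0 := fun a ha => by
    refine bianeV_eq_zero_of_ae_le_abs hs0 ?_
    filter_upwards [hAB] with x hx
    rw [mem_Icc, not_and_or, not_le, not_le] at ha
    rcases ha with ha | ha
    · rw [abs_sub_comm]; exact (by linarith [hx.1] : √s ≤ x - a).trans (le_abs_self _)
    · exact (by linarith [hx.2] : √s ≤ a - x).trans (le_abs_self _)
  have hsq := Real.sqrt_nonneg s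
  obtain ⟨m, -, hm⟩ := isCompact_Icc.exists_isMaxOn
    (⟨A, by constructor <;> linarith⟩ : (Icc (A - √s) (B + √s)).Nonempty)
    (continuous_bianeV (μ := ν) hs0).continuousOn
  have hmax : ∀ a, bianeV ν s a ≤ bianeV ν s m := fun a => by
    by_cases ha : a ∈ Icc (A - √s) (B + √s)
    · exact hm ha
    · rw [hout a ha]; exact bianeV_nonneg _ _
  -- No strict dip is possible: a height `w` between would violate quasi-concavity at that height.
  -- With a global maximum at `m`, this is unimodality.
  have key : ∀ p b q, p ≤ b → b ≤ q → ¬ (bianeV ν s b < bianeV ν s p ∧ bianeV ν s b < bianeV ν s q) := by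
    rintro p b q hpb hbq ⟨h1, h2⟩
    obtain ⟨w, hw, hw'⟩ := exists_between (lt_min h1 h2)
    have hw0 : 0 < w := (bianeV_nonneg s b).trans_lt hw
    have := one_div_lt_kernelIntegral_of_between hAB hs hw0 hpb hbq
      ((lt_kernelIntegral_iff hs0 hw0 p).2 (hw'.trans_le (min_le_left _ _)))
      ((lt_kernelIntegral_iff hs0 hw0 q).2 (hw'.trans_le (min_le_right _ _)))
    exact lt_asymm hw ((lt_kernelIntegral_iff hs0 hw0 b).1 this)
  refine ⟨m, fun a _ b hb hab => ?_, fun a ha b _ hab => ?_⟩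
  · by_contra! hlt
    exact key a b m hab hb ⟨hlt, hlt.trans_le (hmax a)⟩
  · by_contra! hlt
    exact key m a b ha hab ⟨hlt.trans_le (hmax b), hlt⟩

lemma IsUnimodal.ordConnected_pos {f : ℝ → ℝ} (h : IsUnimodal f) :
    OrdConnected {x | 0 < f x} := by
  obtain ⟨m, h1, h2⟩ := h
  refine ⟨fun a ha b hb x hx => ?_⟩
  rcases le_total x m with hxm | hxm
  · exact lt_of_lt_of_le ha (h1 (mem_Iic.2 (hx.1.trans hxm)) hxm hx.1)
  · exact lt_of_lt_of_le hb (h2 hxm (mem_Ici.2 (hxm.trans hx.2)) hx.2)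

lemma IsUnimodal.of_comp_strictMono {f g v : ℝ → ℝ} {k : ℝ} (hk : 0 ≤ k) (hv : IsUnimodal v)
    (hf : StrictMono f) (hs : Function.Surjective f) (h : ∀ a, g (f a) = k * v a) :
    IsUnimodal g := by
  obtain ⟨m, h1, h2⟩ := hv
  refine ⟨f m, fun a ha b hb hab => ?_, fun a ha b hb hab => ?_⟩ <;>
  · obtain ⟨a, rfl⟩ := hs a
    obtain ⟨b, rfl⟩ := hs b
    rw [h, h]
    refine mul_le_mul_of_nonneg_left ?_ hk
    first
    | exact h1 (hf.le_iff_le.1 ha) (hf.le_iff_le.1 hb) (hf.le_iff_le.1 hab)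
    | exact h2 (hf.le_iff_le.1 ha) (hf.le_iff_le.1 hb) (hf.le_iff_le.1 hab)

lemma ordConnected_image_of_strictMono {f : ℝ → ℝ} (hf : StrictMono f)
    (hs : Function.Surjective f) {S : Set ℝ} (hS : S.OrdConnected) : (f '' S).OrdConnected := by
  refine ⟨?_⟩
  rintro _ ⟨a, ha, rfl⟩ _ ⟨b, hb, rfl⟩ x hx
  obtain ⟨y, rfl⟩ := hs x
  exact ⟨y, hS.out ha hb ⟨hf.le_iff_le.1 hx.1, hf.le_iff_le.1 hx.2⟩, rfl⟩

lemma exists_ae_mem_Icc_of_isCompact_support (hν : IsCompact ν.support) :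
    ∃ A B : ℝ, A ≤ B ∧ B - A ≤ Metric.diam ν.support ∧ ∀ᵐ x ∂ν, x ∈ Icc A B := by
  have hne : ν.support.Nonempty := Measure.nonempty_support (IsProbabilityMeasure.ne_zero ν)
  obtain ⟨A, hA⟩ := hν.exists_isLeast hne
  obtain ⟨B, hB⟩ := hν.exists_isGreatest hne
  refine ⟨A, B, hA.2 hB.1, ?_, ?_⟩
  · have := Metric.dist_le_diam_of_mem hν.isBounded hB.1 hA.1
    rw [Real.dist_eq] at this
    exact (le_abs_self _).trans this
  · filter_upwards [Measure.support_mem_ae (μ := ν)] with x hx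
    exact ⟨hA.2 hx, hB.2 hx⟩

end Unimodal

/-- The elliptic domain has a unimodal boundary function and a real trace that is an interval as
soon as `s ≥ 4 D²`, with `D` the diameter of the support of the initial law. -/
lemma IsFreeConvolution.isUnimodal_ellipticB {ν μ : Measure ℝ} [IsProbabilityMeasure ν]
    (hν : IsCompact ν.support) {s t : ℝ}
    (h : IsFreeConvolution.{u} ν (semicircleLaw (s - t / 2)) μ) (ht : 0 < t) (hts : t ≤ 2 * s)
    (hmono : StrictMono (bianeRe ν s (s - t))) (hs : 4 * Metric.diam ν.support ^ 2 ≤ s) :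
    IsUnimodal (ellipticB μ t) ∧ (realTrace (ellipticDomain μ t)).Nonempty ∧
      (realTrace (ellipticDomain μ t)).OrdConnected := by
  have hs0 : 0 < s := by linarith
  obtain ⟨A, B, hle, hd, hAB⟩ := exists_ae_mem_Icc_of_isCompact_support hν
  have hs' : 4 * (B - A) ^ 2 ≤ s := by nlinarith
  obtain ⟨hB, hT⟩ := h.elliptic ht hts hmono
  have huni := isUnimodal_bianeV hs0 hAB hs'
  have hsurj := surjective_bianeRe (μ := ν) hs0 (s - t)
  refine ⟨huni.of_comp_strictMono (by positivity) hmono hsurj hB, ?_, ?_⟩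
  · rw [hT]
    refine Nonempty.image _ ⟨A, bianeV_pos_of_ae_abs_le (d := B - A) ?_ (by nlinarith)⟩
    filter_upwards [hAB] with x hx
    exact abs_le.2 ⟨by linarith [hx.2], by linarith [hx.1]⟩
  · rw [hT]
    exact ordConnected_image_of_strictMono hmono hsurj huni.ordConnected_pos

/-! ### Asymptotics of the endpoints of the real trace -/

lemma abs_one_div_one_sub_sq_sub_le {y δ : ℝ} (hy : |y| ≤ δ) (hδ : δ ≤ 1 / 28) :
    |1 / (1 - y) ^ 2 - (1 + 2 * y + 3 * y ^ 2)| ≤ 6 * δ * y ^ 2 := by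
  obtain ⟨h1, h2⟩ := abs_le.1 hy
  have hpos : 0 < 1 - y := by linarith
  have hid : 1 / (1 - y) ^ 2 - (1 + 2 * y + 3 * y ^ 2)
      = y ^ 2 * (y * (4 - 3 * y) / (1 - y) ^ 2) := by
    field_simp
    ring
  rw [hid, abs_mul, abs_of_nonneg (sq_nonneg y), mul_comm]
  refine mul_le_mul_of_nonneg_right ?_ (sq_nonneg y)
  rw [abs_div, abs_mul, abs_of_pos (by linarith : (0 : ℝ) < 4 - 3 * y),
    abs_of_pos (by positivity : 0 < (1 - y) ^ 2), div_le_iff₀ (by positivity)]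
  have h3 : (27 / 28 : ℝ) ^ 2 ≤ (1 - y) ^ 2 := pow_le_pow_left₀ (by norm_num) (by linarith) 2
  have h4 : 0 ≤ δ := (abs_nonneg y).trans hy
  calc |y| * (4 - 3 * y) ≤ δ * 5 := mul_le_mul hy (by linarith) (by linarith) h4
    _ ≤ 6 * δ * (27 / 28 : ℝ) ^ 2 := by nlinarith
    _ ≤ 6 * δ * (1 - y) ^ 2 := by gcongr

lemma abs_one_div_one_sub_sub_le {y δ : ℝ} (hy : |y| ≤ δ) (hδ : δ ≤ 1 / 28) :
    |1 / (1 - y) - (1 + y + y ^ 2)| ≤ 2 * δ * y ^ 2 := by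
  obtain ⟨h1, h2⟩ := abs_le.1 hy
  have hpos : 0 < 1 - y := by linarith
  have hid : 1 / (1 - y) - (1 + y + y ^ 2) = y ^ 2 * (y / (1 - y)) := by
    field_simp
    ring
  rw [hid, abs_mul, abs_of_nonneg (sq_nonneg y), mul_comm]
  refine mul_le_mul_of_nonneg_right ?_ (sq_nonneg y)
  rw [abs_div, abs_of_pos hpos, div_le_iff₀ hpos]
  have h4 : 0 ≤ δ := (abs_nonneg y).trans hy
  nlinarith

/-- To first order `p = 1 + 3κ/2` and `Q/p = 1 - κ/2`, whence the coefficient `3/2 - (1-r)/2 = 1 +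
r/2`. The constant `26` is `6 + 2 + 18`, the errors coming from `P`, from `Q` and from `(2-r) w`. -/
lemma endpoint_algebra {p P Q κ δ r : ℝ} (hp : 0 < p) (hpP : p ^ 2 = P)
    (hP : |P - (1 + 3 * κ)| ≤ 6 * δ * κ) (hQ : |Q - (1 + κ)| ≤ 2 * δ * κ) (hκ0 : 0 ≤ κ)
    (hκδ : κ ≤ δ) (hδ : δ ≤ 1 / 28) (hr₀ : 0 < r) (hr₂ : r ≤ 2) :
    1 ≤ p ∧ |p + (1 - r) * (Q / p) - (2 - r)| ≤ (1 + r / 2 + 26 * δ) * κ := by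
  have hδ0 : 0 ≤ δ := hκ0.trans hκδ
  have hδκ : 0 ≤ δ * κ := mul_nonneg hδ0 hκ0
  obtain ⟨hP1, hP2⟩ := abs_le.1 hP
  obtain ⟨hQ1, hQ2⟩ := abs_le.1 hQ
  have hP3 : 1 ≤ P := by nlinarith
  have hp1 : 1 ≤ p := by nlinarith
  refine ⟨hp1, ?_⟩
  have hκκ : κ * κ ≤ δ * κ := mul_le_mul_of_nonneg_right hκδ hκ0
  set w := p - (1 + 3 / 2 * κ) with hw
  have hwid : w * (p + (1 + 3 / 2 * κ)) = P - (1 + 3 * κ) - 9 / 4 * (κ * κ) := by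
    rw [hw, ← hpP]; ring
  have hwabs : |w| ≤ 9 * (δ * κ) := by
    have h1 : |w| * 1 ≤ |w| * (p + (1 + 3 / 2 * κ)) :=
      mul_le_mul_of_nonneg_left (by linarith) (abs_nonneg w)
    have h2 : |w| * (p + (1 + 3 / 2 * κ)) = |P - (1 + 3 * κ) - 9 / 4 * (κ * κ)| := by
      rw [← hwid, abs_mul, abs_of_pos (by positivity : 0 < p + (1 + 3 / 2 * κ))]
    have h3 : |P - (1 + 3 * κ) - 9 / 4 * (κ * κ)| ≤ 9 * (δ * κ) :=
      abs_le.2 ⟨by nlinarith [mul_nonneg hκ0 hκ0], by nlinarith [mul_nonneg hκ0 hκ0]⟩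
    linarith
  obtain ⟨hw1, hw2⟩ := abs_le.1 hwabs
  have hN : p + (1 - r) * (Q / p) - (2 - r)
      = ((1 + r / 2) * κ + ((P - (1 + 3 * κ)) + (1 - r) * (Q - (1 + κ)) - (2 - r) * w)) / p := by
    rw [hw, ← hpP]
    field_simp
    ring
  have hQ' : |(1 - r) * (Q - (1 + κ))| ≤ 2 * δ * κ := by
    rw [abs_mul]
    calc |1 - r| * |Q - (1 + κ)| ≤ 1 * (2 * δ * κ) :=
          mul_le_mul (abs_le.2 ⟨by linarith, by linarith⟩) hQ (abs_nonneg _) zero_le_one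
      _ = _ := one_mul _
  have hw' : |(2 - r) * w| ≤ 18 * (δ * κ) := by
    rw [abs_mul]
    calc |2 - r| * |w| ≤ 2 * (9 * (δ * κ)) :=
          mul_le_mul (abs_le.2 ⟨by linarith, by linarith⟩) hwabs (abs_nonneg _) zero_le_two
      _ = _ := by ring
  obtain ⟨a1, a2⟩ := abs_le.1 hQ'
  obtain ⟨b1, b2⟩ := abs_le.1 hw'
  have hrκ : 0 ≤ (1 + r / 2) * κ := by positivity
  rw [hN, abs_div, abs_of_pos hp]
  refine (div_le_self (abs_nonneg _) hp1).trans (abs_le.2 ⟨by nlinarith, by nlinarith⟩)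

lemma bianeRe_eq_of_bianeV_eq_zero {ν : Measure ℝ} {s ρ a : ℝ} (h : bianeV ν s a = 0) :
    bianeRe ν s ρ a = a + ρ * ∫ x, 1 / (a - x) ∂ν := by
  have : cauchyTransform ν (bianePoint ν s a) = ((∫ x : ℝ, 1 / (a - x) ∂ν : ℝ) : ℂ) := by
    rw [cauchyTransform, ← integral_complex_ofReal]
    congr 1 with x
    rw [bianePoint, h]
    push_cast
    simp
  rw [bianeRe_eq, this, Complex.ofReal_re]

section Endpoint

variable {ν : Measure ℝ} [IsProbabilityMeasure ν]

/-- The second-order Taylor bounds are integrated; the linear terms vanish because `Y` is centered.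
-/
lemma integral_one_div_estimates {Y : ℝ → ℝ} (hY : Measurable Y) {δ : ℝ}
    (hYδ : ∀ᵐ x ∂ν, |Y x| ≤ δ) (hδ : δ ≤ 1 / 28) (hY0 : ∫ x, Y x ∂ν = 0) :
    |∫ x, 1 / (1 - Y x) ^ 2 ∂ν - (1 + 3 * ∫ x, Y x ^ 2 ∂ν)| ≤ 6 * δ * ∫ x, Y x ^ 2 ∂ν ∧
    |∫ x, 1 / (1 - Y x) ∂ν - (1 + ∫ x, Y x ^ 2 ∂ν)| ≤ 2 * δ * ∫ x, Y x ^ 2 ∂ν ∧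
    ∫ x, Y x ^ 2 ∂ν ≤ δ := by
  obtain ⟨x₀, hx₀⟩ := hYδ.exists
  have hδ0 : 0 ≤ δ := (abs_nonneg _).trans hx₀
  have i1 : Integrable Y ν := Integrable.of_bound hY.aestronglyMeasurable δ (by simpa using hYδ)
  have i2 : Integrable (fun x => Y x ^ 2) ν :=
    Integrable.of_bound (hY.pow_const 2).aestronglyMeasurable (δ ^ 2) (by
      filter_upwards [hYδ] with x hx
      rw [norm_pow, Real.norm_eq_abs]
      exact pow_le_pow_left₀ (abs_nonneg _) hx 2)
  have hlow : ∀ᵐ x ∂ν, 27 / 28 ≤ 1 - Y x := by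
    filter_upwards [hYδ] with x hx
    linarith [(abs_le.1 hx).2]
  have i3 : Integrable (fun x => 1 / (1 - Y x)) ν :=
    Integrable.of_bound (Measurable.aestronglyMeasurable (by fun_prop)) (1 / (27 / 28)) (by
      filter_upwards [hlow] with x hx
      rw [Real.norm_of_nonneg (one_div_nonneg.2 (by linarith))]
      exact one_div_le_one_div_of_le (by norm_num) hx)
  have i4 : Integrable (fun x => 1 / (1 - Y x) ^ 2) ν :=
    Integrable.of_bound (Measurable.aestronglyMeasurable (by fun_prop)) (1 / (27 / 28) ^ 2) (by
      filter_upwards [hlow] with x hx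
      rw [Real.norm_of_nonneg (by positivity)]
      exact one_div_le_one_div_of_le (by norm_num) (pow_le_pow_left₀ (by norm_num) hx 2))
  refine ⟨?_, ?_, ?_⟩
  · have e : ∫ x, 1 / (1 - Y x) ^ 2 ∂ν - (1 + 3 * ∫ x, Y x ^ 2 ∂ν)
        = ∫ x, (1 / (1 - Y x) ^ 2 - (1 + 2 * Y x + 3 * Y x ^ 2)) ∂ν := by
      have i5 : Integrable (fun x => 1 + 2 * Y x) ν := (integrable_const 1).add (i1.const_mul 2)
      have i6 : Integrable (fun x => 1 + 2 * Y x + 3 * Y x ^ 2) ν := i5.add (i2.const_mul 3)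
      rw [integral_sub i4 i6, integral_add i5 (i2.const_mul 3),
        integral_add (integrable_const 1) (i1.const_mul 2), integral_const_mul,
        integral_const_mul, hY0]
      simp
    rw [e, ← integral_const_mul, ← Real.norm_eq_abs]
    refine norm_integral_le_of_norm_le (i2.const_mul _) ?_
    filter_upwards [hYδ] with x hx
    exact abs_one_div_one_sub_sq_sub_le hx hδ
  · have e : ∫ x, 1 / (1 - Y x) ∂ν - (1 + ∫ x, Y x ^ 2 ∂ν)
        = ∫ x, (1 / (1 - Y x) - (1 + Y x + Y x ^ 2)) ∂ν := by
      have i5 : Integrable (fun x => 1 + Y x) ν := (integrable_const 1).add i1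
      have i6 : Integrable (fun x => 1 + Y x + Y x ^ 2) ν := i5.add i2
      rw [integral_sub i3 i6, integral_add i5 i2, integral_add (integrable_const 1) i1, hY0]
      simp
    rw [e, ← integral_const_mul, ← Real.norm_eq_abs]
    refine norm_integral_le_of_norm_le (i2.const_mul _) ?_
    filter_upwards [hYδ] with x hx
    exact abs_one_div_one_sub_sub_le hx hδ
  · have := integral_mono_ae i2 (integrable_const δ) (by
      filter_upwards [hYδ] with x hx
      have := pow_le_pow_left₀ (abs_nonneg _) hx 2
      rw [sq_abs] at this
      change Y x ^ 2 ≤ δ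
      nlinarith)
    simpa using this

/-- If `∫ (e - X)⁻² = 1 / s` for a centered bounded `X`, then `e + (1 - r) s ∫ (e - X)⁻¹` is close
to `(2 - r) √s`. -/
lemma abs_endpoint_sub_le {X : ℝ → ℝ} (hX : Measurable X) {D e s r : ℝ}
    (hXD : ∀ᵐ x ∂ν, |X x| ≤ D) (hX0 : ∫ x, X x ∂ν = 0) (he : 0 < e) (hDe : 28 * D ≤ e)
    (hs : 0 < s) (hr₀ : 0 < r) (hr₂ : r ≤ 2) (h : ∫ x, 1 / (e - X x) ^ 2 ∂ν = 1 / s) :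
    √s ≤ e ∧ |e + (1 - r) * s * ∫ x, 1 / (e - X x) ∂ν - (2 - r) * √s|
      ≤ (1 + r / 2 + 26 * (D / e)) * ((∫ x, X x ^ 2 ∂ν) / √s) := by
  have hS : 0 < √s := Real.sqrt_pos.2 hs
  have hSs : √s ^ 2 = s := Real.sq_sqrt hs.le
  have hδ : D / e ≤ 1 / 28 := by rw [div_le_div_iff₀ he (by norm_num)]; linarith
  obtain ⟨hP, hQ, hκδ⟩ := integral_one_div_estimates (ν := ν) (Y := fun x => X x / e)
    (hX.div_const e) (δ := D / e) (by
      filter_upwards [hXD] with x hx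
      rw [abs_div, abs_of_pos he]
      gcongr) hδ (by rw [integral_div, hX0, zero_div])
  have e1 : ∀ x, 1 / (1 - X x / e) ^ 2 = e ^ 2 * (1 / (e - X x) ^ 2) := fun x => by
    have : 1 - X x / e = (e - X x) / e := by field_simp
    rw [this, div_pow, one_div_div]; ring
  have e2 : ∀ x, 1 / (1 - X x / e) = e * (1 / (e - X x)) := fun x => by
    have : 1 - X x / e = (e - X x) / e := by field_simp
    rw [this, one_div_div]; ring
  simp only [e1, e2, integral_const_mul, h, div_pow, integral_div] at hP hQ hκδ
  set V := ∫ x, X x ^ 2 ∂ν with hV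
  have hV0 : 0 ≤ V := integral_nonneg fun x => sq_nonneg _
  have hκ0 : 0 ≤ V / e ^ 2 := by positivity
  obtain ⟨hp1, hmain⟩ := endpoint_algebra (p := e / √s) (by positivity)
    (by rw [div_pow, hSs]; ring) hP hQ hκ0 hκδ hδ hr₀ hr₂
  have hse : √s ≤ e := by rwa [le_div_iff₀ hS, one_mul] at hp1
  refine ⟨hse, ?_⟩
  -- Everything is scaled by `√s`, with `p = e / √s` and `Q = e ∫ (e - X)⁻¹`.
  have e3 : e + (1 - r) * s * ∫ x, 1 / (e - X x) ∂ν - (2 - r) * √s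
      = √s * (e / √s + (1 - r) * (e * (∫ x, 1 / (e - X x) ∂ν) / (e / √s)) - (2 - r)) := by
    have hs2 : s = √s * √s := by rw [← hSs, sq]; simp
    field_simp
    rw [hSs]
    ring
  rw [e3, abs_mul, abs_of_pos hS]
  have hD0 : 0 ≤ D / e := by
    obtain ⟨x, hx⟩ := hXD.exists
    exact div_nonneg ((abs_nonneg _).trans hx) he.le
  calc √s * _ ≤ √s * ((1 + r / 2 + 26 * (D / e)) * (V / e ^ 2)) :=
        mul_le_mul_of_nonneg_left hmain hS.le
    _ ≤ √s * ((1 + r / 2 + 26 * (D / e)) * (V / √s ^ 2)) := by gcongr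
    _ = (1 + r / 2 + 26 * (D / e)) * (V / √s) := by field_simp

lemma continuousAt_kernelIntegral_zero {m D a : ℝ} (hD : ∀ᵐ x ∂ν, |x - m| ≤ D) (ha : m + D < a) :
    ContinuousAt (fun p : ℝ × ℝ => kernelIntegral ν p.1 p.2) (a, 0) := by
  set γ := (a - m - D) / 2 with hγ
  have hγ0 : 0 < γ := by rw [hγ]; linarith
  refine continuousAt_of_dominated (bound := fun _ => 1 / γ ^ 2) ?_ ?_ (integrable_const _) ?_
  · exact Eventually.of_forall fun p => (measurable_kernel p.1 p.2).aestronglyMeasurable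
  · have : ∀ᶠ p : ℝ × ℝ in 𝓝 (a, 0), m + D + γ < p.1 :=
      continuousAt_fst.eventually_const_lt (by simp only [hγ]; linarith)
    filter_upwards [this] with p hp
    filter_upwards [hD] with x hx
    rw [Real.norm_of_nonneg (kernel_nonneg _ _ x)]
    refine one_div_le_one_div_of_le (by positivity) ?_
    have h1 : γ ≤ p.1 - x := by linarith [(abs_le.1 hx).2]
    have h2 := pow_le_pow_left₀ hγ0.le h1 2
    nlinarith [sq_nonneg p.2]
  · filter_upwards [hD] with x hx
    have h1 : 0 < a - x := by linarith [(abs_le.1 hx).2]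
    have : (a - x) ^ 2 + (0 : ℝ) ^ 2 ≠ 0 := by positivity
    exact ContinuousAt.div (by fun_prop) (by fun_prop) this

/-- The right endpoint of the set where `v_s` is positive. -/
lemma exists_isLUB_bianeV_pos {m D s : ℝ} (hD0 : 0 ≤ D) (hD : ∀ᵐ x ∂ν, |x - m| ≤ D)
    (hs : 4 * D ^ 2 < s) :
    ∃ a, m + D < a ∧ √s - D ≤ a - m ∧ IsLUB {α | 0 < bianeV ν s α} a ∧ bianeV ν s a = 0 ∧
      ∫ x, 1 / (a - x) ^ 2 ∂ν = 1 / s := by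
  have hs0 : 0 < s := by nlinarith [sq_nonneg D]
  set V := {α | 0 < bianeV ν s α} with hV
  have hmem : m + D ∈ V := by
    refine bianeV_pos_of_ae_abs_le (d := 2 * D) ?_ (by nlinarith)
    filter_upwards [hD] with x hx
    exact abs_le.2 ⟨by linarith [(abs_le.1 hx).2], by linarith [(abs_le.1 hx).1]⟩
  have hbdd : BddAbove V := by
    refine ⟨m + D + √s, fun α hα => ?_⟩
    by_contra! hlt
    have h0 : bianeV ν s α = 0 := by
      refine bianeV_eq_zero_of_ae_le_abs hs0 ?_
      filter_upwards [hD] with x hx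
      exact (by linarith [(abs_le.1 hx).2] : √s ≤ α - x).trans (le_abs_self _)
    exact (ne_of_gt hα) h0
  have hlub : IsLUB V (sSup V) := isLUB_csSup ⟨_, hmem⟩ hbdd
  generalize sSup V = a at hlub
  have hopen : IsOpen V := isOpen_lt continuous_const (continuous_bianeV hs0)
  have hnot : a ∉ V := fun haV => by
    obtain ⟨ε, hε, hball⟩ := Metric.isOpen_iff.1 hopen a haV
    have : a + ε / 2 ∈ V := hball (by
      rw [Metric.mem_ball, Real.dist_eq, add_sub_cancel_left, abs_of_pos (half_pos hε)]
      linarith)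
    linarith [hlub.1 this]
  have hva : bianeV ν s a = 0 := le_antisymm (not_lt.1 hnot) (bianeV_nonneg _ _)
  have hma : m + D < a := lt_of_le_of_ne (hlub.1 hmem) fun h => hnot (h ▸ hmem)
  refine ⟨a, hma, ?_, hlub, hva, ?_⟩
  · by_contra! hlt
    refine hnot (bianeV_pos_of_ae_abs_le (d := a - m + D) ?_ ?_)
    · filter_upwards [hD] with x hx
      exact abs_le.2 ⟨by linarith [(abs_le.1 hx).2], by linarith [(abs_le.1 hx).1]⟩
    · have h1 : a - m + D < √s := by linarith
      have h2 := mul_self_lt_mul_self (by linarith) h1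
      rw [Real.mul_self_sqrt hs0.le] at h2
      linarith
  -- Inside `V` the kernel integral at height `v_s` is exactly `1/s`. The value at `a` is its limit,
  -- `a` being away from the support, where the kernel is continuous down to height zero.
  · have hne : (𝓝[V] a).NeBot := mem_closure_iff_nhdsWithin_neBot.1 (hlub.mem_closure ⟨_, hmem⟩)
    have ht : Tendsto (fun α => (α, bianeV ν s α)) (𝓝[V] a) (𝓝 (a, 0)) := by
      have : Continuous fun α => (α, bianeV ν s α) :=
        continuous_id.prodMk (continuous_bianeV hs0)
      have h1 := this.tendsto a
      rw [hva] at h1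
      exact h1.mono_left nhdsWithin_le_nhds
    have hcont : Tendsto (fun p : ℝ × ℝ => kernelIntegral ν p.1 p.2) (𝓝 (a, 0))
      (𝓝 (kernelIntegral ν a 0)) := continuousAt_kernelIntegral_zero (ν := ν) hD hma
    have h2 : Tendsto (fun α => kernelIntegral ν α (bianeV ν s α)) (𝓝[V] a)
        (𝓝 (kernelIntegral ν a 0)) := by
      have := hcont.comp ht
      simpa only [Function.comp_def] using this
    have h3 : Tendsto (fun α => kernelIntegral ν α (bianeV ν s α)) (𝓝[V] a) (𝓝 (1 / s)) := by
      refine tendsto_const_nhds.congr' ?_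
      filter_upwards [self_mem_nhdsWithin] with α hα
      exact (kernelIntegral_bianeV hs0 hα).symm
    have := tendsto_nhds_unique h2 h3
    simpa [kernelIntegral] using this

lemma integral_sub_integral_eq_zero {f : ℝ → ℝ} (hf : Integrable f ν) :
    ∫ x, (f x - ∫ y, f y ∂ν) ∂ν = 0 := by
  rw [integral_sub hf (integrable_const _)]; simp

/-- The image under `bianeRe ν s (s - r s)` of the right endpoint. -/
lemma exists_right_endpoint {D s r : ℝ} (hD0 : 0 < D)
    (hD : ∀ᵐ x ∂ν, |x - ∫ y, y ∂ν| ≤ D) (hi : Integrable (fun x : ℝ => x) ν) (hs : 29 * D ≤ √s)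
    (hr₀ : 0 < r) (hr₂ : r ≤ 2) :
    ∃ a, IsLUB {α | 0 < bianeV ν s α} a ∧ bianeV ν s a = 0 ∧
      |bianeRe ν s (s - r * s) a - ((∫ x, x ∂ν) + (2 - r) * √s)|
        ≤ (1 + r / 2 + 26 * (D / √s)) * ((∫ x, (x - ∫ y, y ∂ν) ^ 2 ∂ν) / √s) := by
  have hS : 0 < √s := lt_of_lt_of_le (by positivity) hs
  have hs0 : 0 < s := Real.sqrt_pos.1 hS
  have hss : √s * √s = s := Real.mul_self_sqrt hs0.le
  set m := ∫ y, y ∂ν with hm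
  obtain ⟨a, hma, hsa, hlub, hva, hint⟩ := exists_isLUB_bianeV_pos hD0.le hD (s := s)
    (by nlinarith)
  obtain ⟨hse, hest⟩ := abs_endpoint_sub_le (ν := ν) (X := fun x => x - m) (by fun_prop) hD
    (integral_sub_integral_eq_zero hi) (e := a - m) (by linarith) (by linarith) hs0 hr₀ hr₂
    (by simpa only [sub_sub_sub_cancel_right] using hint)
  refine ⟨a, hlub, hva, ?_⟩
  simp only [sub_sub_sub_cancel_right] at hest
  rw [bianeRe_eq_of_bianeV_eq_zero hva]
  have e : a + (s - r * s) * ∫ x, 1 / (a - x) ∂ν - (m + (2 - r) * √s)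
      = a - m + (1 - r) * s * ∫ x, 1 / (a - x) ∂ν - (2 - r) * √s := by ring
  rw [e]
  refine hest.trans ?_
  have hV : 0 ≤ ∫ x, (x - m) ^ 2 ∂ν := integral_nonneg fun x => sq_nonneg _
  gcongr

end Endpoint

/-! ### The left endpoint by reflection, and moments of the initial law -/

section Reflection

variable {ν : Measure ℝ}

lemma kernelIntegral_map_neg (a v : ℝ) :
    kernelIntegral (ν.map Neg.neg) a v = kernelIntegral ν (-a) v := by
  rw [kernelIntegral, integral_map measurable_neg.aemeasurable
    (measurable_kernel a v).aestronglyMeasurable, kernelIntegral]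
  congr 1 with x
  congr 2; ring

lemma bianeV_map_neg (t a : ℝ) : bianeV (ν.map Neg.neg) t a = bianeV ν t (-a) := by
  have h := kernelIntegral_map_neg (ν := ν) a
  simp only [kernelIntegral] at h
  simp only [bianeV, h]

/-- Restricted to `v = 0`, where `G` is a real integral that changes sign under reflection; only the
endpoint is needed. -/
lemma bianeRe_map_neg_of_bianeV_eq_zero {s ρ a : ℝ} (h : bianeV ν s (-a) = 0) :
    bianeRe (ν.map Neg.neg) s ρ a = -bianeRe ν s ρ (-a) := by
  rw [bianeRe_eq_of_bianeV_eq_zero h, bianeRe_eq_of_bianeV_eq_zero (by rwa [bianeV_map_neg]),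
    integral_map measurable_neg.aemeasurable (Measurable.aestronglyMeasurable (by fun_prop))]
  have : ∀ x : ℝ, 1 / (a - -x) = -(1 / (-a - x)) := fun x => by
    rw [← one_div_neg_eq_neg_one_div]; congr 1; ring
  simp only [this, integral_neg]
  ring

variable [IsProbabilityMeasure ν]

/-- The image under `bianeRe ν s (s - r s)` of the left endpoint. -/
lemma exists_left_endpoint {D s r : ℝ} (hD0 : 0 < D)
    (hD : ∀ᵐ x ∂ν, |x - ∫ y, y ∂ν| ≤ D) (hi : Integrable (fun x : ℝ => x) ν) (hs : 29 * D ≤ √s)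
    (hr₀ : 0 < r) (hr₂ : r ≤ 2) :
    ∃ a, IsGLB {α | 0 < bianeV ν s α} a ∧ bianeV ν s a = 0 ∧
      |bianeRe ν s (s - r * s) a - ((∫ x, x ∂ν) - (2 - r) * √s)|
        ≤ (1 + r / 2 + 26 * (D / √s)) * ((∫ x, (x - ∫ y, y ∂ν) ^ 2 ∂ν) / √s) := by
  have hp : IsProbabilityMeasure (ν.map Neg.neg) :=
    Measure.isProbabilityMeasure_map measurable_neg.aemeasurable
  have hm : ∫ x, x ∂(ν.map Neg.neg) = -∫ x, x ∂ν := by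
    rw [integral_map (f := fun x : ℝ => x) measurable_neg.aemeasurable
      measurable_id.aestronglyMeasurable, integral_neg]
  have hvar : ∫ x, (x - ∫ y, y ∂(ν.map Neg.neg)) ^ 2 ∂(ν.map Neg.neg)
      = ∫ x, (x - ∫ y, y ∂ν) ^ 2 ∂ν := by
    rw [hm, integral_map measurable_neg.aemeasurable
      (Measurable.aestronglyMeasurable (by fun_prop))]
    congr 1 with x
    ring
  obtain ⟨a, hlub, hva, hest⟩ := exists_right_endpoint (ν := ν.map Neg.neg) (r := r) hD0 (by
    rw [hm, ae_map_iff measurable_neg.aemeasurable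
      (measurableSet_le (by fun_prop) measurable_const)]
    filter_upwards [hD] with x hx
    rwa [neg_sub_neg, abs_sub_comm]) (by
    rw [integrable_map_measure (g := fun x : ℝ => x) measurable_id.aestronglyMeasurable measurable_neg.aemeasurable]
    exact hi.neg) hs hr₀ hr₂
  rw [bianeV_map_neg] at hva
  rw [hvar, hm, bianeRe_map_neg_of_bianeV_eq_zero hva] at hest
  refine ⟨-a, ?_, hva, ?_⟩
  · simp only [bianeV_map_neg] at hlub
    have : {α | 0 < bianeV ν s α} = -{α | 0 < bianeV ν s (-α)} := by
      ext α; simp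
    rw [this, isGLB_neg, neg_neg]
    exact hlub
  · rw [← abs_neg]
    convert hest using 2
    ring

lemma exists_ae_abs_sub_mean_le (hν : IsCompact ν.support) :
    Integrable (fun x : ℝ => x) ν ∧ Integrable (fun x : ℝ => x ^ 2) ν ∧
      ∃ D, 0 < D ∧ ∀ᵐ x ∂ν, |x - ∫ y, y ∂ν| ≤ D := by
  obtain ⟨A, B, hle, -, hAB⟩ := exists_ae_mem_Icc_of_isCompact_support hν
  have hb : ∀ᵐ x ∂ν, ‖x‖ ≤ |A| + |B| := by
    filter_upwards [hAB] with x hx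
    rw [Real.norm_eq_abs]
    exact abs_le.2 ⟨by linarith [hx.1, neg_abs_le A, abs_nonneg B],
      by linarith [hx.2, le_abs_self B, abs_nonneg A]⟩
  have i1 : Integrable (fun x : ℝ => x) ν :=
    Integrable.of_bound measurable_id.aestronglyMeasurable _ hb
  have i2 : Integrable (fun x : ℝ => x ^ 2) ν :=
    Integrable.of_bound (Measurable.aestronglyMeasurable (by fun_prop)) ((|A| + |B|) ^ 2) (by
      filter_upwards [hb] with x hx
      rw [norm_pow]
      exact pow_le_pow_left₀ (norm_nonneg _) hx 2)
  refine ⟨i1, i2, B - A + 1, by linarith, ?_⟩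
  have h1 : A ≤ ∫ y, y ∂ν := by
    have := integral_mono_ae (integrable_const A) i1 (hAB.mono fun x hx => hx.1)
    simpa using this
  have h2 : ∫ y, y ∂ν ≤ B := by
    have := integral_mono_ae i1 (integrable_const B) (hAB.mono fun x hx => hx.2)
    simpa using this
  filter_upwards [hAB] with x hx
  exact abs_le.2 ⟨by linarith [hx.1], by linarith [hx.2]⟩

lemma integral_sub_mean_sq_le (h1 : Integrable (fun x : ℝ => x) ν)
    (h2 : Integrable (fun x : ℝ => x ^ 2) ν) :
    ∫ x, (x - ∫ y, y ∂ν) ^ 2 ∂ν ≤ ∫ x, x ^ 2 ∂ν := by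
  set m := ∫ y, y ∂ν with hm
  have e : ∀ x : ℝ, (x - m) ^ 2 = x ^ 2 - 2 * m * x + m ^ 2 := fun x => by ring
  have i3 : Integrable (fun x : ℝ => x ^ 2 - 2 * m * x) ν := h2.sub (h1.const_mul _)
  simp_rw [e]
  rw [integral_add i3 (integrable_const _), integral_sub h2 (h1.const_mul _), integral_const_mul,
    ← hm]
  simp only [integral_const, probReal_univ, one_smul]
  nlinarith [sq_nonneg m]

lemma integral_sq_pos_of_ne_dirac (h2 : Integrable (fun x : ℝ => x ^ 2) ν)
    (h : ν ≠ Measure.dirac 0) : 0 < ∫ x, x ^ 2 ∂ν := by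
  refine lt_of_le_of_ne (integral_nonneg fun x => sq_nonneg x) fun h0 => h ?_
  have := (integral_eq_zero_iff_of_nonneg (fun x => sq_nonneg x) h2).1 h0.symm
  exact eq_dirac_of_ae_eq (this.mono fun x hx => by simpa using hx)

end Reflection

/-- Large-time asymptotics of the endpoints of the real trace of the elliptic domain. -/
lemma eventually_endpoints {ν : Measure ℝ} [IsProbabilityMeasure ν] (hν : IsCompact ν.support)
    {r : ℝ} (hr₀ : 0 < r) (hr₂ : r ≤ 2) (hst : r < 2 ∨ ∀ x : ℝ, ν ≠ Measure.dirac x)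
    {c : ℝ} (hc : 1 < c) :
    ∀ᶠ s : ℝ in atTop, ∀ t : ℝ, t = r * s →
      ∀ μ : Measure ℝ, IsFreeConvolution.{u} ν (semicircleLaw (s - t / 2)) μ →
        ∃ m M : ℝ, IsGLB (realTrace (ellipticDomain μ t)) m ∧
          IsLUB (realTrace (ellipticDomain μ t)) M ∧
          |M - ((∫ x, x ∂ν) + (2 * s - t) / √s)|
            ≤ c * (3 * r + 2 * |1 - r|) * (∫ x, x ^ 2 ∂ν) / (2 * √s) ∧
          |m - ((∫ x, x ∂ν) - (2 * s - t) / √s)|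
            ≤ c * (3 * r + 2 * |1 - r|) * (∫ x, x ^ 2 ∂ν) / (2 * √s) ∧
          (ν ≠ Measure.dirac 0 →
            |M - ((∫ x, x ∂ν) + (2 * s - t) / √s)|
              < c * (3 * r + 2 * |1 - r|) * (∫ x, x ^ 2 ∂ν) / (2 * √s) ∧
            |m - ((∫ x, x ∂ν) - (2 * s - t) / √s)|
              < c * (3 * r + 2 * |1 - r|) * (∫ x, x ^ 2 ∂ν) / (2 * √s)) ∧
          realTrace (ellipticDomain μ t) ⊆
            Ioo ((∫ x, x ∂ν) - (2 * s - t) / √s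
                - c * (3 * r + 2 * |1 - r|) * (∫ x, x ^ 2 ∂ν) / (2 * √s))
              ((∫ x, x ∂ν) + (2 * s - t) / √s
                + c * (3 * r + 2 * |1 - r|) * (∫ x, x ^ 2 ∂ν) / (2 * √s)) := by
  obtain ⟨i1, i2, D, hD0, hD⟩ := exists_ae_abs_sub_mean_le hν
  -- A constant strictly between `1` and `c`: it absorbs the error `26 D / √s`, and the gap to `c`
  -- makes the final inequalities strict when the second moment is positive.
  set c' := (1 + c) / 2 with hc'
  have hc'1 : 1 < c' := by rw [hc']; linarith
  have hc'c : c' < c := by rw [hc']; linarith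
  filter_upwards [Real.tendsto_sqrt_atTop.eventually_ge_atTop (29 * D),
    Real.tendsto_sqrt_atTop.eventually_ge_atTop (26 * D / (c' - 1)),
    eventually_gt_atTop 0] with s hs1 hs2 hs0 t ht μ hμ
  have hS : 0 < √s := Real.sqrt_pos.2 hs0
  have hss : √s * √s = s := Real.mul_self_sqrt hs0.le
  have hmono := strictMono_bianeRe_sub hr₀ hr₂ hst hs0 ht
  have hsurj := surjective_bianeRe (μ := ν) hs0 (s - t)
  obtain ⟨-, hT⟩ := hμ.elliptic (by rw [ht]; positivity) (by rw [ht]; nlinarith) hmono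
  obtain ⟨a, hlub, hva, hMest⟩ := exists_right_endpoint hD0 hD i1 hs1 hr₀ hr₂
  obtain ⟨b, hglb, hvb, hmest⟩ := exists_left_endpoint hD0 hD i1 hs1 hr₀ hr₂
  rw [← ht] at hMest hmest
  have hk : (2 * s - t) / √s = (2 - r) * √s := by
    rw [div_eq_iff hS.ne', mul_assoc, hss, ht]; ring
  have hvar := integral_sub_mean_sq_le i1 i2
  have hvar0 : 0 ≤ ∫ x, (x - ∫ y, y ∂ν) ^ 2 ∂ν := integral_nonneg fun x => sq_nonneg _
  rw [hk]
  set V := ∫ x, (x - ∫ y, y ∂ν) ^ 2 ∂ν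
  set m₁ := ∫ x, x ∂ν
  have hm₂ : 0 ≤ ∫ x, x ^ 2 ∂ν := integral_nonneg fun x => sq_nonneg _
  have hm₂pos : ν ≠ Measure.dirac 0 → 0 < ∫ x, x ^ 2 ∂ν := integral_sq_pos_of_ne_dirac i2
  set m₂ := ∫ x, x ^ 2 ∂ν
  set K := 3 * r + 2 * |1 - r| with hK
  have hK0 : 0 < K := by positivity
  -- The true leading coefficient is `1 + r/2`; it equals `K / 2` for `r ≤ 1` and is smaller for `r
  -- > 1`.
  have hrK : 1 + r / 2 ≤ K / 2 := by
    rw [hK]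
    rcases le_total r 1 with h | h
    · rw [abs_of_nonneg (by linarith)]; linarith
    · rw [abs_of_nonpos (by linarith)]; linarith
  have hcoef : 1 + r / 2 + 26 * (D / √s) ≤ c' * (K / 2) := by
    have h1 : 26 * (D / √s) ≤ c' - 1 := by
      rw [div_le_iff₀ (by linarith)] at hs2
      rw [← mul_div_assoc, div_le_iff₀ hS]; linarith
    nlinarith
  have hbound : (1 + r / 2 + 26 * (D / √s)) * (V / √s) ≤ c' * K * m₂ / (2 * √s) := by
    calc (1 + r / 2 + 26 * (D / √s)) * (V / √s) ≤ (c' * (K / 2)) * (m₂ / √s) := by gcongr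
      _ = c' * K * m₂ / (2 * √s) := by ring
  have hle : c' * K * m₂ / (2 * √s) ≤ c * K * m₂ / (2 * √s) := by gcongr
  have hlt : ν ≠ Measure.dirac 0 → c' * K * m₂ / (2 * √s) < c * K * m₂ / (2 * √s) := fun h => by
    have := hm₂pos h
    gcongr
  have hM := hMest.trans hbound
  have hm := hmest.trans hbound
  refine ⟨bianeRe ν s (s - t) b, bianeRe ν s (s - t) a, ?_, ?_, hM.trans hle, hm.trans hle,
    fun h => ⟨hM.trans_lt (hlt h), hm.trans_lt (hlt h)⟩, ?_⟩
  · rw [hT]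
    exact (hmono.orderIsoOfSurjective _ hsurj).isGLB_image'.2 hglb
  · rw [hT]
    exact (hmono.orderIsoOfSurjective _ hsurj).isLUB_image'.2 hlub
  · rw [hT]
    rintro _ ⟨α, hα, rfl⟩
    -- The endpoints have `v = 0` and are not in the set, so the inclusion in the open interval is
    -- strict even for a Dirac mass at `0`.
    have hαa : α < a := lt_of_le_of_ne (hlub.1 hα) fun h => by
      rw [mem_ofPred_eq, h, hva] at hα; exact lt_irrefl _ hα
    have hbα : b < α := lt_of_le_of_ne (hglb.1 hα) fun h => by
      rw [mem_ofPred_eq, ← h, hvb] at hα; exact lt_irrefl _ hα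
    have h1 := hmono hαa
    have h2 := hmono hbα
    have h3 := (abs_le.1 (hM.trans hle)).2
    have h4 := (abs_le.1 (hm.trans hle)).1
    exact ⟨by linarith, by linarith⟩

/-! ### Asymptotics of the boundary curve -/

section Boundary

variable {ν : Measure ℝ} [IsProbabilityMeasure ν]

/-- Jensen's inequality for `1 / (e - X)`. -/
lemma one_div_le_integral_one_div {X : ℝ → ℝ} (hX : Measurable X) {D e : ℝ}
    (hXD : ∀ᵐ x ∂ν, |X x| ≤ D) (hX0 : ∫ x, X x ∂ν = 0) (he : 0 < e) (hDe : D < e) :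
    1 / e ≤ ∫ x, 1 / (e - X x) ∂ν := by
  have i1 : Integrable X ν := Integrable.of_bound hX.aestronglyMeasurable D hXD
  have i2 : Integrable (fun x => 1 / (e - X x)) ν :=
    Integrable.of_bound (Measurable.aestronglyMeasurable (by fun_prop)) (1 / (e - D)) (by
      filter_upwards [hXD] with x hx
      have := (abs_le.1 hx).2
      rw [Real.norm_of_nonneg (one_div_nonneg.2 (by linarith))]
      exact one_div_le_one_div_of_le (by linarith) (by linarith))
  have h : ∫ x, (1 / e + X x / e ^ 2) ∂ν = 1 / e := by
    rw [integral_add (integrable_const _) (i1.div_const _), integral_div _ X, hX0]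
    simp
  rw [← h]
  refine integral_mono_ae ((integrable_const _).add (i1.div_const _)) i2 ?_
  filter_upwards [hXD] with x hx
  have h1 : 0 < e - X x := by linarith [(abs_le.1 hx).2]
  have h2 : 1 / (e - X x) - (1 / e + X x / e ^ 2) = X x ^ 2 / (e ^ 2 * (e - X x)) := by
    field_simp
    ring
  have h3 : 0 ≤ X x ^ 2 / (e ^ 2 * (e - X x)) := by positivity
  change 1 / e + X x / e ^ 2 ≤ _
  linarith

lemma two_mul_sqrt_le_add_div {s e : ℝ} (hs : 0 < s) (he : 0 < e) : 2 * √s ≤ e + s * (1 / e) := by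
  have h : e + s * (1 / e) - 2 * √s = (e - √s) ^ 2 / e := by
    rw [sub_sq, Real.sq_sqrt hs.le]
    field_simp
    ring
  have : 0 ≤ (e - √s) ^ 2 / e := by positivity
  linarith

/-- Where `v_s` vanishes, `H_s` takes values outside `(m - 2√s, m + 2√s)`. -/
lemma two_mul_sqrt_le_abs_bianeRe_sub {D s α : ℝ} (hD : ∀ᵐ x ∂ν, |x - ∫ y, y ∂ν| ≤ D)
    (hi : Integrable (fun x : ℝ => x) ν) (hs : 4 * D ^ 2 < s) (hv : bianeV ν s α = 0) :
    2 * √s ≤ |bianeRe ν s s α - ∫ y, y ∂ν| := by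
  have hs0 : 0 < s := by nlinarith [sq_nonneg D]
  have hD0 : 0 ≤ D := by
    obtain ⟨x, hx⟩ := hD.exists
    exact (abs_nonneg _).trans hx
  have h0 := integral_sub_integral_eq_zero hi
  rw [bianeRe_eq_of_bianeV_eq_zero hv]
  set m := ∫ y, y ∂ν with hm
  have hout : D < |α - m| := by
    by_contra! h
    refine (bianeV_pos_of_ae_abs_le (ν := ν) (s := s) (a := α) (d := 2 * D) ?_ (by nlinarith)).ne' hv
    filter_upwards [hD] with x hx
    have := abs_sub_le α m x
    rw [abs_sub_comm m x] at this
    linarith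
  rcases lt_abs.1 hout with h | h
  · have h1 := one_div_le_integral_one_div (ν := ν) (X := fun x => x - m) (by fun_prop) hD h0
      (by linarith) h
    simp only [sub_sub_sub_cancel_right] at h1
    have h2 := two_mul_sqrt_le_add_div hs0 (by linarith : 0 < α - m)
    have h3 := mul_le_mul_of_nonneg_left h1 hs0.le
    exact le_trans (by linarith) (le_abs_self _)
  · have h1 := one_div_le_integral_one_div (ν := ν) (X := fun x => m - x) (D := D) (e := m - α)
      (by fun_prop) (by simpa only [abs_sub_comm] using hD) (by
        have : ∀ x : ℝ, m - x = -(x - m) := fun x => by ring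
        simp only [this, integral_neg, h0, neg_zero]) (by linarith) (by linarith)
    have e1 : ∀ x : ℝ, 1 / (m - α - (m - x)) = -(1 / (α - x)) := fun x => by
      rw [← one_div_neg_eq_neg_one_div]; congr 1; ring
    simp only [e1, integral_neg] at h1
    have h2 := two_mul_sqrt_le_add_div hs0 (by linarith : 0 < m - α)
    have h3 := mul_le_mul_of_nonneg_left h1 hs0.le
    exact le_trans (by linarith) (neg_le_abs _)

/-- Adding the term `(x-m)/(z-m)²`, which integrates to zero, leaves the remainder `(x-m)² / ((z-m)²
(z-x))`, so the error is governed by the variance. -/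
lemma norm_cauchyTransform_sub_one_div_le {m D V : ℝ} (hD : ∀ᵐ x ∂ν, |x - m| ≤ D)
    (hi : Integrable (fun x : ℝ => x) ν) (hm : ∫ y, y ∂ν = m)
    (hV : ∫ x, (x - m) ^ 2 ∂ν = V) {z : ℂ} (hz : 0 < z.im) (hzD : D < ‖z - m‖) :
    ‖cauchyTransform ν z - 1 / (z - m)‖ ≤ V / (‖z - m‖ ^ 2 * (‖z - m‖ - D)) := by
  have hw0 : z - (m : ℂ) ≠ 0 := sub_ofReal_ne_zero hz.ne' m
  have h0 : ∫ x, (x - m) ∂ν = 0 := by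
    have := integral_sub_integral_eq_zero hi
    rwa [hm] at this
  have i1 : Integrable (fun x : ℝ => ((x - m : ℝ) : ℂ)) ν := (hi.sub (integrable_const m)).ofReal
  have i2 : Integrable (fun x => (x - m) ^ 2) ν :=
    Integrable.of_bound (Measurable.aestronglyMeasurable (by fun_prop)) (D ^ 2) (by
      filter_upwards [hD] with x hx
      rw [norm_pow, Real.norm_eq_abs]
      exact pow_le_pow_left₀ (abs_nonneg _) hx 2)
  have i3 : Integrable (fun x : ℝ => 1 / (z - m) + ((x - m : ℝ) : ℂ) / (z - m) ^ 2) ν :=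
    (integrable_const _).add (i1.div_const _)
  have h1 : cauchyTransform ν z - 1 / (z - m)
      = ∫ x : ℝ, ((z - (x : ℂ))⁻¹ - (1 / (z - m) + ((x - m : ℝ) : ℂ) / (z - m) ^ 2)) ∂ν := by
    rw [integral_sub (integrable_inv_sub_ofReal hz.ne') i3,
      integral_add (integrable_const _) (i1.div_const _),
      integral_div _ (fun x : ℝ => ((x - m : ℝ) : ℂ)), integral_complex_ofReal, h0]
    simp [cauchyTransform]
  rw [h1, ← hV, ← integral_div]
  refine norm_integral_le_of_norm_le (i2.div_const _) ?_
  filter_upwards [hD] with x hx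
  have hzx : z - (x : ℂ) ≠ 0 := sub_ofReal_ne_zero hz.ne' x
  have e : (z - (x : ℂ))⁻¹ - (1 / (z - m) + ((x - m : ℝ) : ℂ) / (z - m) ^ 2)
      = ((x - m : ℝ) : ℂ) ^ 2 / ((z - m) ^ 2 * (z - x)) := by
    push_cast
    field_simp
    ring
  have hn : ‖z - m‖ - D ≤ ‖z - (x : ℂ)‖ := by
    have h2 : z - (x : ℂ) = (z - m) - ((x - m : ℝ) : ℂ) := by push_cast; ring
    have h3 := norm_sub_norm_le (z - (m : ℂ)) ((x - m : ℝ) : ℂ)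
    rw [← h2, Complex.norm_real, Real.norm_eq_abs] at h3
    linarith
  have hpos : 0 < ‖z - m‖ := norm_pos_iff.2 hw0
  rw [e, norm_div, norm_pow, norm_mul, norm_pow, Complex.norm_real, Real.norm_eq_abs, sq_abs]
  have : 0 < ‖z - m‖ - D := sub_pos.2 hzD
  gcongr

/-- `H_s` flattens the graph of `v_s` onto the real line, so the complex equation for `α` reduces to
its real part. -/
lemma bianeH_bianePoint_eq {s : ℝ} (hs : 0 < s) (α : ℝ) :
    bianeH ν s (bianePoint ν s α) = ((bianeRe ν s s α : ℝ) : ℂ) := by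
  apply Complex.ext
  · rfl
  · rw [im_bianeH, re_bianePoint, im_bianePoint, Complex.ofReal_im]
    rcases (bianeV_nonneg (μ := ν) s α).eq_or_lt with h | h
    · rw [← h, zero_mul]
    · rw [kernelIntegral_bianeV hs h, mul_one_div, div_self hs.ne', sub_self, mul_zero]

/-- The point of the graph of `v_s` that `H_s` maps to `m + 2√s cos φ` is close to
`m + √s e^{iφ}`. -/
lemma norm_bianePoint_sub_le {D s α φ σ V : ℝ} (hD : ∀ᵐ x ∂ν, |x - ∫ y, y ∂ν| ≤ D)
    (hi : Integrable (fun x : ℝ => x) ν) (hV : ∫ x, (x - ∫ y, y ∂ν) ^ 2 ∂ν = V)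
    (hφ0 : 0 < φ) (hφπ : φ < Real.pi) (hσ : 0 < σ) (hσφ : σ ≤ Real.sin φ) (hD0 : 0 < D)
    (hs : 40 * D ≤ √s * σ)
    (hα : bianeH ν s (bianePoint ν s α) = (((∫ x, x ∂ν) + 2 * √s * Real.cos φ : ℝ) : ℂ)) :
    ‖bianePoint ν s α - (∫ x, x ∂ν : ℝ)
        - √s * (Real.cos φ + Real.sin φ * Complex.I)‖ ≤ 3 / 4 * (V / (σ * √s)) := by
  have hS : 0 < √s := by
    by_contra! h
    have := mul_nonpos_of_nonpos_of_nonneg h hσ.le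
    linarith
  have hs0 : 0 < s := Real.sqrt_pos.1 hS
  have hss : √s * √s = s := Real.mul_self_sqrt hs0.le
  have hσ1 : σ ≤ 1 := hσφ.trans (Real.sin_le_one φ)
  have hSD : 40 * D ≤ √s := hs.trans (mul_le_of_le_one_right hS.le hσ1)
  have hV0 : 0 ≤ V := hV ▸ integral_nonneg fun x => sq_nonneg _
  have hVD : V ≤ D ^ 2 := by
    rw [← hV]
    have := integral_mono_of_nonneg (μ := ν) (Eventually.of_forall fun x => sq_nonneg _)
      (integrable_const (D ^ 2)) (f := fun x => (x - ∫ y, y ∂ν) ^ 2) (by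
      filter_upwards [hD] with x hx
      exact sq_le_sq' (abs_le.1 hx).1 (abs_le.1 hx).2)
    simpa using this
  have hcos1 : Real.cos φ < 1 := by
    have := Real.cos_lt_cos_of_nonneg_of_le_pi le_rfl hφπ.le hφ0
    rwa [Real.cos_zero] at this
  have hcos2 : -1 < Real.cos φ := by
    have := Real.cos_lt_cos_of_nonneg_of_le_pi hφ0.le le_rfl hφπ
    rwa [Real.cos_pi] at this
  have hre : bianeRe ν s s α = (∫ x, x ∂ν) + 2 * √s * Real.cos φ := by
    rw [bianeRe, hα, Complex.ofReal_re]
  -- Otherwise `H_s` would take a value outside `(m - 2√s, m + 2√s)`.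
  have hv : 0 < bianeV ν s α := by
    refine lt_of_le_of_ne (bianeV_nonneg _ _) fun h => ?_
    have := two_mul_sqrt_le_abs_bianeRe_sub hD hi (by nlinarith : 4 * D ^ 2 < s) h.symm
    rw [hre, add_sub_cancel_left, abs_mul, abs_of_pos (by positivity)] at this
    have habs : |Real.cos φ| < 1 := abs_lt.2 ⟨hcos2, hcos1⟩
    nlinarith
  set m := ∫ y, y ∂ν with hm
  set z := bianePoint ν s α with hz
  have hzim : z.im = bianeV ν s α := im_bianePoint _ _ _
  have hzre : z.re = α := re_bianePoint _ _ _
  set R := ‖z - m‖ with hR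
  -- At positive height `1/s = ∫ |z-x|⁻² dν ≥ (R + D)⁻²`.
  have hRS : √s - D ≤ R := by
    have hd : 0 ≤ R + D := by positivity
    have h1 : 1 / (R + D) ^ 2 ≤ kernelIntegral ν α (bianeV ν s α) := by
      have := integral_mono_ae (integrable_const (1 / (R + D) ^ 2))
        (integrable_kernel (μ := ν) hv α) (by
          filter_upwards [hD] with x hx
          refine one_div_le_one_div_of_le (by positivity) ?_
          have h5 := normSq_sub_ofReal z x
          rw [hzre, hzim] at h5
          rw [← h5]
          refine pow_le_pow_left₀ (norm_nonneg _) ?_ 2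
          have h2 : z - (x : ℂ) = (z - m) - ((x - m : ℝ) : ℂ) := by push_cast; ring
          have h3 := norm_sub_le (z - (m : ℂ)) ((x - m : ℝ) : ℂ)
          rw [← h2, Complex.norm_real, Real.norm_eq_abs] at h3
          linarith)
      simpa [kernelIntegral] using this
    rw [kernelIntegral_bianeV hs0 hv, div_le_div_iff₀ (by positivity) hs0] at h1
    have h4 : √s ≤ R + D := Real.sqrt_le_iff.2 ⟨hd, by linarith⟩
    linarith
  have hRD : D < R := by linarith
  have hG := norm_cauchyTransform_sub_one_div_le hD hi hm.symm hV (z := z) (by rw [hzim]; exact hv)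
    hRD
  rw [← hR] at hG
  have hR0 : 0 < R := hD0.trans hRD
  have hw0 : z - (m : ℂ) ≠ 0 := norm_pos_iff.1 hR0
  set ω : ℂ := √s * (Real.cos φ + Real.sin φ * Complex.I) with hω
  set ω' : ℂ := √s * (Real.cos φ - Real.sin φ * Complex.I) with hω'
  -- The equation multiplied by `z - m`: a quadratic with roots `ω`, `ω'` and, on the right, the
  -- deviation of `G` from `1/(z-m)`.
  have hfac : (z - m - ω) * (z - m - ω') = -s * (z - m) * (cauchyTransform ν z - 1 / (z - m)) := by
    have h1 : z + s * cauchyTransform ν z = m + 2 * √s * Real.cos φ := by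
      have := hα
      rw [bianeH] at this
      rw [this]; push_cast; ring
    have h2 : (Real.sin φ : ℂ) ^ 2 + (Real.cos φ : ℂ) ^ 2 = 1 := by
      rw [← Complex.ofReal_pow, ← Complex.ofReal_pow, ← Complex.ofReal_add,
        Real.sin_sq_add_cos_sq, Complex.ofReal_one]
    have h3 : (√s : ℂ) * √s = s := by rw [← Complex.ofReal_mul, hss]
    have h4 : (z - m) * (1 / (z - m)) = 1 := mul_one_div_cancel hw0
    have hI := Complex.I_sq
    rw [hω, hω']
    linear_combination (z - m) * h1 + (√s : ℂ) * √s * h2 + h3 - s * h4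
      - (√s : ℂ) * √s * (Real.sin φ : ℂ) ^ 2 * hI
  have hprod : ‖z - m - ω‖ * ‖z - m - ω'‖ ≤ 11 / 10 * V := by
    rw [← norm_mul, hfac, norm_mul, norm_mul, norm_neg, Complex.norm_of_nonneg hs0.le, ← hR]
    calc s * R * ‖cauchyTransform ν z - 1 / (z - m)‖
        ≤ s * R * (V / (R ^ 2 * (R - D))) := by gcongr
      _ = s * V / (R * (R - D)) := by
        have : 0 < R - D := sub_pos.2 hRD
        field_simp
      _ ≤ 11 / 10 * V := by
        rw [div_le_iff₀ (mul_pos hR0 (sub_pos.2 hRD))]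
        have h1 : s ≤ 11 / 10 * (R * (R - D)) := by
          have h2 : 39 / 40 * √s ≤ R := by linarith
          have h3 : 38 / 40 * √s ≤ R - D := by linarith
          have h4 := mul_le_mul h2 h3 (by positivity) hR0.le
          nlinarith
        nlinarith
  have him' : (z - m - ω').im = bianeV ν s α + √s * Real.sin φ := by
    rw [hω']
    simp [hzim, -Complex.ofReal_sin, -Complex.ofReal_cos]
  have him : (z - m - ω).im = bianeV ν s α - √s * Real.sin φ := by
    rw [hω]
    simp [hzim, -Complex.ofReal_sin, -Complex.ofReal_cos]
  have hlow : bianeV ν s α + √s * Real.sin φ ≤ ‖z - m - ω'‖ := by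
    rw [← him']; exact (le_abs_self _).trans (Complex.abs_im_le_norm _)
  have hup : √s * Real.sin φ - bianeV ν s α ≤ ‖z - m - ω‖ := by
    have := (neg_le_abs _).trans (Complex.abs_im_le_norm (z - m - ω))
    rw [him] at this
    linarith
  have hq : √s * σ ≤ √s * Real.sin φ := mul_le_mul_of_nonneg_left hσφ hS.le
  have hq0 : 0 < √s * σ := mul_pos hS hσ
  generalize ‖z - m - ω‖ = x at *
  generalize ‖z - m - ω'‖ = y at *
  -- Bootstrap: the crude bound `y ≥ √s σ` first gives `x ≤ √s σ / 2`. Then `v_s` is close to `√s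
  -- sin φ`, so `y ≥ (3/2) √s σ`, and the product bound yields `x ≤ (11/15) V / (√s σ)`.
  have hx0 : x ≤ √s * σ / 2 := by
    by_contra! h
    have h1 : √s * σ ≤ y := by linarith
    nlinarith
  have hy : 3 / 2 * (√s * σ) ≤ y := by linarith
  have hxx : x * (3 / 2 * (√s * σ)) ≤ 11 / 10 * V := by
    rcases le_or_gt 0 x with h | h
    · exact (mul_le_mul_of_nonneg_left hy h).trans hprod
    · nlinarith
  have : 3 / 4 * (V / (σ * √s)) = 3 / 4 * V / (√s * σ) := by rw [mul_comm σ]; ring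
  rw [this, le_div_iff₀ hq0]
  linarith

end Boundary

/-- Large-time asymptotics of the boundary curve of the elliptic domain. -/
lemma eventually_boundary {ν : Measure ℝ} [IsProbabilityMeasure ν] (hν : IsCompact ν.support)
    {r : ℝ} (hr₀ : 0 < r) (hr₂ : r ≤ 2) (hst : r < 2 ∨ ∀ x : ℝ, ν ≠ Measure.dirac x)
    {φ₀ : ℝ} (hφ₀ : 0 < φ₀) (hφ₀' : φ₀ < Real.pi / 2) :
    ∀ᶠ s : ℝ in atTop, ∀ t : ℝ, t = r * s →
      ∀ φ : ℝ, 0 < φ → φ < Real.pi → |Real.cos φ| ≤ Real.cos φ₀ →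
        (∃! α : ℝ, bianeH ν s (bianePoint ν s α)
            = (((∫ x, x ∂ν) + 2 * √s * Real.cos φ : ℝ) : ℂ)) ∧
        ∀ α : ℝ, bianeH ν s (bianePoint ν s α)
            = (((∫ x, x ∂ν) + 2 * √s * Real.cos φ : ℝ) : ℂ) →
          (∀ μ : Measure ℝ, IsFreeConvolution.{u} ν (semicircleLaw (s - t / 2)) μ →
            ellipticB μ t (ellipticU ν s t (bianePoint ν s α)).re
              = (ellipticU ν s t (bianePoint ν s α)).im) ∧
          ‖ellipticU ν s t (bianePoint ν s α)
              - (((∫ x, x ∂ν) + (2 * s - t) / √s * Real.cos φ : ℝ)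
                + (t / √s * Real.sin φ : ℝ) * Complex.I : ℂ)‖
            ≤ r * (∫ x, x ^ 2 ∂ν) / (Real.sin φ₀ * √s) ∧
          (ν ≠ Measure.dirac 0 →
            ‖ellipticU ν s t (bianePoint ν s α)
                - (((∫ x, x ∂ν) + (2 * s - t) / √s * Real.cos φ : ℝ)
                  + (t / √s * Real.sin φ : ℝ) * Complex.I : ℂ)‖
              < r * (∫ x, x ^ 2 ∂ν) / (Real.sin φ₀ * √s)) := by
  obtain ⟨i1, i2, D, hD0, hD⟩ := exists_ae_abs_sub_mean_le hν
  have hσ : 0 < Real.sin φ₀ := Real.sin_pos_of_pos_of_lt_pi hφ₀ (by linarith [Real.pi_pos])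
  filter_upwards [Real.tendsto_sqrt_atTop.eventually_ge_atTop (40 * D / Real.sin φ₀),
    eventually_gt_atTop 0] with s hs1 hs0 t ht φ hφ0 hφπ hcos
  rw [div_le_iff₀ hσ] at hs1
  have hS : 0 < √s := Real.sqrt_pos.2 hs0
  have hss : √s * √s = s := Real.mul_self_sqrt hs0.le
  have hmono := strictMono_bianeRe_sub hr₀ hr₂ hst hs0 ht
  have hsin : Real.sin φ₀ ≤ Real.sin φ := by
    have h1 : 0 ≤ Real.sin φ := (Real.sin_pos_of_pos_of_lt_pi hφ0 hφπ).le
    refine le_of_sq_le_sq ?_ h1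
    have h2 := pow_le_pow_left₀ (abs_nonneg _) hcos 2
    rw [sq_abs] at h2
    have h3 := Real.sin_sq_add_cos_sq φ
    have h4 := Real.sin_sq_add_cos_sq φ₀
    linarith
  refine ⟨?_, fun α hα => ⟨fun μ hμ => ?_, ?_⟩⟩
  · obtain ⟨α, hα⟩ := surjective_bianeRe (μ := ν) hs0 s ((∫ x, x ∂ν) + 2 * √s * Real.cos φ)
    refine ⟨α, by rw [← hα]; exact bianeH_bianePoint_eq hs0 α, fun β hβ => ?_⟩
    refine (strictMono_bianeRe (μ := ν) hs0 (ρ := s) le_rfl (Or.inl (by linarith))).injective ?_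
    rw [hα]
    have := congrArg Complex.re hβ
    rwa [Complex.ofReal_re] at this
  · obtain ⟨hB, -⟩ := hμ.elliptic (by rw [ht]; positivity) (by rw [ht]; nlinarith) hmono
    have h1 : (ellipticU ν s t (bianePoint ν s α)).re = bianeRe ν s (s - t) α := by
      simp [ellipticU, re_bianePoint, ellipticRe, bianeRe]
    have h2 : (ellipticU ν s t (bianePoint ν s α)).im = t * bianeV ν s α / s := by
      simp only [ellipticU, re_bianePoint, im_bianePoint]
      simp
    rw [h1, h2, hB]
    ring
  · have hbound := norm_bianePoint_sub_le hD i1 rfl hφ0 hφπ hσ hsin hD0 hs1 hα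
    have hre : bianeRe ν s s α = (∫ x, x ∂ν) + 2 * √s * Real.cos φ := by
      rw [bianeRe, hα, Complex.ofReal_re]
    -- Since `s G(z) = H_s(z) - z` with `H_s(z)` prescribed, `U` is affine in `z` with slope `r`,
    -- and so is the target in `m + √s e^{iφ}`; the error is exactly `r` times that of the point of
    -- the graph.
    have hU : ellipticU ν s t (bianePoint ν s α)
        - (((∫ x, x ∂ν) + (2 * s - t) / √s * Real.cos φ : ℝ)
          + (t / √s * Real.sin φ : ℝ) * Complex.I : ℂ)
        = r * (bianePoint ν s α - (∫ x, x ∂ν : ℝ)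
          - √s * (Real.cos φ + Real.sin φ * Complex.I)) := by
      have h1 : ellipticRe ν s t α = α + (1 - r) * ((∫ x, x ∂ν) + 2 * √s * Real.cos φ - α) := by
        change bianeRe ν s (s - t) α = _
        rw [← hre, bianeRe_eq, bianeRe_eq, ht]
        ring
      have h2 : (2 * s - t) / √s = (2 - r) * √s := by
        rw [div_eq_iff hS.ne', mul_assoc, hss, ht]; ring
      have h3 : t / √s = r * √s := by
        rw [div_eq_iff hS.ne', mul_assoc, hss, ht]
      have h4 : t * bianeV ν s α / s = r * bianeV ν s α := by
        rw [ht]; field_simp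
      simp only [ellipticU, re_bianePoint, im_bianePoint, h1, h2, h3, h4]
      rw [bianePoint]
      push_cast
      ring
    rw [hU, norm_mul, Complex.norm_of_nonneg hr₀.le]
    have hvar := integral_sub_mean_sq_le i1 i2
    have h5 : r * ‖bianePoint ν s α - (∫ x, x ∂ν : ℝ)
          - √s * (Real.cos φ + Real.sin φ * Complex.I)‖
        ≤ 3 / 4 * (r * (∫ x, x ^ 2 ∂ν) / (Real.sin φ₀ * √s)) := by
      calc _ ≤ r * (3 / 4 * ((∫ x, (x - ∫ y, y ∂ν) ^ 2 ∂ν) / (Real.sin φ₀ * √s))) := by gcongr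
        _ ≤ r * (3 / 4 * ((∫ x, x ^ 2 ∂ν) / (Real.sin φ₀ * √s))) := by gcongr
        _ = _ := by ring
    have hm₂ : 0 ≤ ∫ x, x ^ 2 ∂ν := integral_nonneg fun x => sq_nonneg _
    refine ⟨h5.trans (mul_le_of_le_one_left (by positivity) (by norm_num)), fun h => ?_⟩
    have := integral_sq_pos_of_ne_dirac i2 h
    -- The factor `3/4 < 1` supplies strictness once the second moment is positive.
    exact h5.trans_lt (mul_lt_of_lt_one_left (by positivity) (by norm_num))

theorem theorem6p1
    -- `ν` is the law of the bounded self-adjoint element `y₀`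
    (ν : Measure ℝ) [IsProbabilityMeasure ν] (hν : IsCompact ν.support)
    (r : ℝ) (hr₀ : 0 < r) (hr₂ : r ≤ 2)
    (hstanding : r < 2 ∨ ∀ x : ℝ, ν ≠ Measure.dirac x) :
    -- unimodality
    (∀ s t : ℝ, 0 < s → t = r * s → 4 * Metric.diam ν.support ^ 2 ≤ s →
      ∀ μ : Measure ℝ, IsFreeConvolution.{u} ν (semicircleLaw (s - t / 2)) μ →
        IsUnimodal (ellipticB μ t) ∧
        (realTrace (ellipticDomain μ t)).Nonempty ∧
        (realTrace (ellipticDomain μ t)).OrdConnected) ∧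
    -- endpoints
    (∀ c : ℝ, 1 < c → ∀ᶠ s : ℝ in atTop, ∀ t : ℝ, t = r * s →
      ∀ μ : Measure ℝ, IsFreeConvolution.{u} ν (semicircleLaw (s - t / 2)) μ →
        ∃ m M : ℝ, IsGLB (realTrace (ellipticDomain μ t)) m ∧
          IsLUB (realTrace (ellipticDomain μ t)) M ∧
          |M - ((∫ x, x ∂ν) + (2 * s - t) / √s)|
            ≤ c * (3 * r + 2 * |1 - r|) * (∫ x, x ^ 2 ∂ν) / (2 * √s) ∧
          |m - ((∫ x, x ∂ν) - (2 * s - t) / √s)|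
            ≤ c * (3 * r + 2 * |1 - r|) * (∫ x, x ^ 2 ∂ν) / (2 * √s) ∧
          (ν ≠ Measure.dirac 0 →
            |M - ((∫ x, x ∂ν) + (2 * s - t) / √s)|
              < c * (3 * r + 2 * |1 - r|) * (∫ x, x ^ 2 ∂ν) / (2 * √s) ∧
            |m - ((∫ x, x ∂ν) - (2 * s - t) / √s)|
              < c * (3 * r + 2 * |1 - r|) * (∫ x, x ^ 2 ∂ν) / (2 * √s)) ∧
          realTrace (ellipticDomain μ t) ⊆
            Ioo ((∫ x, x ∂ν) - (2 * s - t) / √s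
                - c * (3 * r + 2 * |1 - r|) * (∫ x, x ^ 2 ∂ν) / (2 * √s))
              ((∫ x, x ∂ν) + (2 * s - t) / √s
                + c * (3 * r + 2 * |1 - r|) * (∫ x, x ^ 2 ∂ν) / (2 * √s))) ∧
    -- the boundary curve away from the endpoints
    (∀ φ₀ : ℝ, 0 < φ₀ → φ₀ < Real.pi / 2 → ∀ᶠ s : ℝ in atTop, ∀ t : ℝ, t = r * s →
      ∀ φ : ℝ, 0 < φ → φ < Real.pi → |Real.cos φ| ≤ Real.cos φ₀ →
        (∃! α : ℝ, bianeH ν s (bianePoint ν s α)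
            = (((∫ x, x ∂ν) + 2 * √s * Real.cos φ : ℝ) : ℂ)) ∧
        ∀ α : ℝ, bianeH ν s (bianePoint ν s α)
            = (((∫ x, x ∂ν) + 2 * √s * Real.cos φ : ℝ) : ℂ) →
          -- `U_{s,t}(α + i v(α))` is the point `a + i b_{s,t}(a)` of the boundary curve
          (∀ μ : Measure ℝ, IsFreeConvolution.{u} ν (semicircleLaw (s - t / 2)) μ →
            ellipticB μ t (ellipticU ν s t (bianePoint ν s α)).re
              = (ellipticU ν s t (bianePoint ν s α)).im) ∧
          ‖ellipticU ν s t (bianePoint ν s α)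
              - (((∫ x, x ∂ν) + (2 * s - t) / √s * Real.cos φ : ℝ)
                + (t / √s * Real.sin φ : ℝ) * Complex.I : ℂ)‖
            ≤ r * (∫ x, x ^ 2 ∂ν) / (Real.sin φ₀ * √s) ∧
          (ν ≠ Measure.dirac 0 →
            ‖ellipticU ν s t (bianePoint ν s α)
                - (((∫ x, x ∂ν) + (2 * s - t) / √s * Real.cos φ : ℝ)
                  + (t / √s * Real.sin φ : ℝ) * Complex.I : ℂ)‖
              < r * (∫ x, x ^ 2 ∂ν) / (Real.sin φ₀ * √s))) := by
  refine ⟨fun s t hs ht hsD μ hμ => ?_, fun c hc => ?_, fun φ₀ hφ₀ hφ₀' => ?_⟩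
  · exact hμ.isUnimodal_ellipticB hν (by rw [ht]; positivity) (by rw [ht]; nlinarith)
      (strictMono_bianeRe_sub hr₀ hr₂ hstanding hs ht) hsD
  · exact eventually_endpoints hν hr₀ hr₂ hstanding hc
  · exact eventually_boundary hν hr₀ hr₂ hstanding hφ₀ hφ₀'
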